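/- Let $\mathcal V$ be a complete and cocomplete symmetric monoidal closed category, let $\mathcal A$ be a small symmetric monoidal $\mathcal V$-category with tensor $\otimes$ and unit $I$, and let $T:\mathcal V\to\mathcal V$ be a commutative strong $\mathcal V$-monad with unit $\eta$, multiplication $\mu$ and strength $t_{X,Y}:X\otimes TY\to T(X\otimes Y)$. (Here a strong $\mathcal V$-monad on a symmetric monoidal $\mathcal V$-category is a $\mathcal V$-functor $T$ with $\mathcal V$-natural $\eta,\mu$ satisfying the monad laws and a $\mathcal V$-natural $t_{X,Y}:X\otimes TY\to T(X\otimes Y)$ compatible with $\eta$, $\mu$, the left unitor and the associator. It is commutative if $\mu\circ T(t_{X,Y})\circ\sigma_{X,TY}=\mu\circ T(\sigma_{X,Y})\circ t_{TX,Y}$ as maps $TX\otimes TY\to T(X\otimes Y)$, where $\sigma_{X,Y}:TX\otimes Y\to T(X\otimes Y)$ is obtained from $t_{Y,X}$ by conjugating with the braiding.) 1. For every small $\mathcal V$-category $\mathcal K$ and every $\mathcal V$-functor $H:\mathcal K^{\mathrm{op}}\otimes\mathcal K\to\mathcal V$, with coprojections $e_k:H(k,k)\to\int^{k}H(k,k)$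 and $e'_k:TH(k,k)\to\int^{k}TH(k,k)$, there is a unique map $$\xi_H:\int^{k}T H(k,k)\to T\int^{k}H(k,k)\qquad\text{with}\qquad \xi_H\circ e'_k=T(e_k)\ \text{ for all }k.$$ 2. The $\mathcal V$-category $\mathcal V^{\mathcal A^{\mathrm{op}}}$ of $\mathcal V$-functors $\mathcal A^{\mathrm{op}}\to\mathcal V$ is symmetric monoidal with the Day tensor $$(F\otimes G)(C)=\int^{(X,Y)}\mathcal A(C,X\otimes Y)\otimes FX\otimes GY,$$ unit $\mathcal A(-,I)$, and the canonical associator, unitors and braiding induced by those of $\mathcal V$ and $\mathcal A$. The $\mathcal V$-functor $\overline T:\mathcal V^{\mathcal A^{\mathrm{op}}}\to\mathcal V^{\mathcal A^{\mathrm{op}}}$, $\overline T(F)=T\circ F$, is a commutative strong $\mathcal V$-monad on it, with unit and multiplication $(\overline\eta_F)_C=\eta_{FC}$ and $(\overline\mu_F)_C=\mu_{FC}$, and with strength $\overline t_{F,G}:F\otimes\overline TG\to\overline T(F\otimes G)$ whose component at $C$ is the composite $$\int^{(X,Y)}\mathcal A(C,X\otimes Y)\otimes FX\otimes TGY\ \xrightarrow{\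 \int t\ }\ \int^{(X,Y)}T\bigl(\mathcal A(C,X\otimes Y)\otimes FX\otimes GY\bigr)\ \xrightarrow{\ \xi\ }\ T\int^{(X,Y)}\mathcal A(C,X\otimes Y)\otimes FX\otimes GY,$$ where $\int t$ is induced by the maps $t_{\mathcal A(C,X\otimes Y)\otimes FX,\;GY}$ and $\xi$ is the map of part 1 for $\mathcal K=\mathcal A\otimes\mathcal A$. -/

import Mathlib

open CategoryTheory MonoidalCategory Limits Opposite
open scoped CategoryTheory.MonoidalClosed

universe w w₁ w₂ w₃ w₄ v u

set_option linter.unusedSectionVars false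

noncomputable section

namespace DayMonad

section Base

variable (V : Type u) [Category.{v} V] [MonoidalCategory V]

/-- The hom-object `C(X, Y)` of a `V`-category. -/
abbrev hom {C : Type w} [EnrichedCategory V C] (X Y : C) : V := EnrichedCategory.Hom X Y

section Self

variable {V} [MonoidalClosed V]

/-- Evaluation for the self-enrichment `V(X, Y) = [X, Y]`. -/
def ev (X Y : V) : X ⊗ hom V X Y ⟶ Y := (ihom.ev X).app Y

/-- Currying into the self-enrichment. -/
def lam {X Y W : V} (g : X ⊗ W ⟶ Y) : W ⟶ hom V X Y := MonoidalClosed.curry g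

lemma lam_ev {X Y W : V} (g : X ⊗ W ⟶ Y) : X ◁ lam g ≫ ev X Y = g :=
  MonoidalClosed.whiskerLeft_curry_ihom_ev_app _ _ _

lemma lam_ev_assoc {X Y W Z : V} (g : X ⊗ W ⟶ Y) (h : Y ⟶ Z) :
    X ◁ lam g ≫ ev X Y ≫ h = g ≫ h := by
  rw [← Category.assoc, lam_ev]

lemma self_hom_ext {X Y W : V} {f g : W ⟶ hom V X Y} (h : X ◁ f ≫ ev X Y = X ◁ g ≫ ev X Y) :
    f = g := by
  apply MonoidalClosed.uncurry_injective
  rw [MonoidalClosed.uncurry_eq, MonoidalClosed.uncurry_eq]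
  exact h

lemma lam_natural {X Y W W' : V} (f : W' ⟶ W) (g : X ⊗ W ⟶ Y) : f ≫ lam g = lam (X ◁ f ≫ g) :=
  (MonoidalClosed.curry_natural_left f g).symm

lemma lam_inj {X Y W : V} {f g : X ⊗ W ⟶ Y} (h : lam f = lam g) : f = g :=
  MonoidalClosed.curry_injective h

lemma ev_id (X : V) : X ◁ eId V X ≫ ev X X = (ρ_ X).hom :=
  lam_ev (ρ_ X).hom

lemma ev_comp (X Y Z : V) : X ◁ eComp V X Y Z ≫ ev X Z =
    (α_ X (hom V X Y) (hom V Y Z)).inv ≫ ev X Y ▷ hom V Y Z ≫ ev Y Z :=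
  lam_ev (MonoidalClosed.compTranspose X Y Z)

variable {D : Type w} [EnrichedCategory V D]

/-- The action `F X ⊗ D(X, Y) ⟶ F Y` of a `V`-functor `F : D ⟶ V`. -/
def act (F : EnrichedFunctor V D V) (X Y : D) : F.obj X ⊗ hom V X Y ⟶ F.obj Y :=
  F.obj X ◁ F.map X Y ≫ ev (F.obj X) (F.obj Y)

lemma act_id (F : EnrichedFunctor V D V) (X : D) :
    F.obj X ◁ eId V X ≫ act F X X = (ρ_ _).hom := by
  rw [act, ← MonoidalCategory.whiskerLeft_comp_assoc, EnrichedFunctor.map_id, ev_id]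

lemma act_comp (F : EnrichedFunctor V D V) (X Y Z : D) :
    F.obj X ◁ eComp V X Y Z ≫ act F X Z =
      (α_ (F.obj X) (hom V X Y) (hom V Y Z)).inv ≫ act F X Y ▷ hom V Y Z ≫ act F Y Z := by
  simp only [act]
  rw [← MonoidalCategory.whiskerLeft_comp_assoc,
    EnrichedFunctor.map_comp, MonoidalCategory.whiskerLeft_comp_assoc, ev_comp,
    MonoidalCategory.tensorHom_def, MonoidalCategory.whiskerLeft_comp, comp_whiskerRight,
    Category.assoc, Category.assoc, associator_inv_naturality_right_assoc,
    whisker_exchange_assoc, associator_inv_naturality_middle_assoc]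

/-- A `V`-functor `D ⟶ V` from an action. -/
@[simps obj]
def ofAct (obj : D → V) (a : ∀ X Y : D, obj X ⊗ hom V X Y ⟶ obj Y)
    (h_id : ∀ X, obj X ◁ eId V X ≫ a X X = (ρ_ _).hom)
    (h_comp : ∀ X Y Z, obj X ◁ eComp V X Y Z ≫ a X Z =
      (α_ (obj X) (hom V X Y) (hom V Y Z)).inv ≫ a X Y ▷ hom V Y Z ≫ a Y Z) :
    EnrichedFunctor V D V where
  obj := obj
  map X Y := lam (a X Y)
  map_id X := by
    apply self_hom_ext
    rw [MonoidalCategory.whiskerLeft_comp_assoc, lam_ev, h_id, ev_id]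
  map_comp X Y Z := by
    apply self_hom_ext
    rw [MonoidalCategory.whiskerLeft_comp_assoc, lam_ev, h_comp,
      MonoidalCategory.whiskerLeft_comp_assoc, ev_comp, MonoidalCategory.tensorHom_def,
      MonoidalCategory.whiskerLeft_comp_assoc, associator_inv_naturality_right_assoc,
      whisker_exchange_assoc, lam_ev, associator_inv_naturality_middle_assoc,
      ← comp_whiskerRight_assoc, lam_ev]

lemma act_ofAct (obj : D → V) (a h_id h_comp) (X Y : D) :
    act (ofAct (D := D) obj a h_id h_comp) X Y = a X Y :=
  lam_ev _

end Self

section Braid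

variable {V} [SymmetricCategory V]

lemma tensorμ_braiding (X₁ X₂ Y₁ Y₂ : V) :
    tensorμ X₁ X₂ Y₁ Y₂ ≫ (β_ (X₁ ⊗ Y₁) (X₂ ⊗ Y₂)).hom =
      ((β_ X₁ X₂).hom ⊗ₘ (β_ Y₁ Y₂).hom) ≫ tensorμ X₂ X₁ Y₂ Y₁ := by
  simp [tensorμ, SymmetricCategory.braiding_swap_eq_inv_braiding Y₁ X₂,
    MonoidalCategory.tensorHom_def]

lemma braiding_tensorμ (X₁ X₂ Y₁ Y₂ : V) :
    (β_ (X₁ ⊗ X₂) (Y₁ ⊗ Y₂)).hom ≫ tensorμ Y₁ Y₂ X₁ X₂ =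
      tensorμ X₁ X₂ Y₁ Y₂ ≫ ((β_ X₁ Y₁).hom ⊗ₘ (β_ X₂ Y₂).hom) := by
  simp [tensorμ, SymmetricCategory.braiding_swap_eq_inv_braiding X₁ Y₂,
    MonoidalCategory.tensorHom_def]

/-- Exchange of the last two factors. -/
def swapR (X Y Z : V) : (X ⊗ Y) ⊗ Z ⟶ (X ⊗ Z) ⊗ Y :=
  (α_ X Y Z).hom ≫ X ◁ (β_ Y Z).hom ≫ (α_ X Z Y).inv

lemma swapR_natural {X X' Y Y' Z Z' : V} (f : X ⟶ X') (g : Y ⟶ Y') (h : Z ⟶ Z') :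
    ((f ⊗ₘ g) ⊗ₘ h) ≫ swapR X' Y' Z' = swapR X Y Z ≫ ((f ⊗ₘ h) ⊗ₘ g) := by
  rw [swapR, associator_naturality_assoc, ← id_tensorHom,
    tensorHom_comp_tensorHom_assoc, BraidedCategory.braiding_naturality, Category.comp_id,
    swapR, Category.assoc, Category.assoc, ← associator_inv_naturality, ← id_tensorHom,
    tensorHom_comp_tensorHom_assoc, Category.id_comp]

end Braid

variable [SymmetricCategory V]

/-- The tensor product `C ⊗ D` of two `V`-categories. -/
instance prodEnriched (C : Type w₁) (D : Type w₂) [EnrichedCategory V C] [EnrichedCategory V D] :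
    EnrichedCategory V (C × D) where
  Hom X Y := hom V X.1 Y.1 ⊗ hom V X.2 Y.2
  id X := (λ_ (𝟙_ V)).inv ≫ (eId V X.1 ⊗ₘ eId V X.2)
  comp X Y Z := tensorμ _ _ _ _ ≫ (eComp V X.1 Y.1 Z.1 ⊗ₘ eComp V X.2 Y.2 Z.2)
  id_comp X Y := by
    rw [comp_whiskerRight_assoc, tensorμ_natural_left_assoc, tensorHom_comp_tensorHom,
      Iso.inv_comp_eq, tensor_left_unitality, Category.assoc, Category.assoc, Category.comp_id]
    have h1 := e_id_comp V X.1 Y.1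
    have h2 := e_id_comp V X.2 Y.2
    rw [Iso.inv_comp_eq, Category.comp_id] at h1 h2
    rw [h1, h2]
  comp_id X Y := by
    rw [MonoidalCategory.whiskerLeft_comp_assoc, tensorμ_natural_right_assoc,
      tensorHom_comp_tensorHom, Iso.inv_comp_eq, tensor_right_unitality, Category.assoc,
      Category.assoc, Category.comp_id]
    have h1 := e_comp_id V X.1 Y.1
    have h2 := e_comp_id V X.2 Y.2
    rw [Iso.inv_comp_eq, Category.comp_id] at h1 h2
    rw [h1, h2]
  assoc W X Y Z := by
    rw [Iso.inv_comp_eq, comp_whiskerRight, MonoidalCategory.whiskerLeft_comp]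
    simp only [Category.assoc]
    rw [tensorμ_natural_left_assoc, tensorμ_natural_right_assoc, tensorHom_comp_tensorHom,
      tensorHom_comp_tensorHom, ← e_assoc', ← e_assoc', ← tensorHom_comp_tensorHom,
      tensor_associativity_assoc]

section Functors

variable {V}
variable {C : Type w₁} {D : Type w₂} {C' : Type w₃} {D' : Type w₄}
  [EnrichedCategory V C] [EnrichedCategory V D] [EnrichedCategory V C'] [EnrichedCategory V D']

lemma prod_eId (X : C × D) :
    eId V X = (λ_ (𝟙_ V)).inv ≫ (eId V X.1 ⊗ₘ eId V X.2) := rfl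

lemma prod_eComp (X Y Z : C × D) : eComp V X Y Z =
    tensorμ (hom V X.1 Y.1) (hom V X.2 Y.2) (hom V Y.1 Z.1) (hom V Y.2 Z.2) ≫
      (eComp V X.1 Y.1 Z.1 ⊗ₘ eComp V X.2 Y.2 Z.2) := rfl

/-- The product `F ⊗ G : C ⊗ D ⟶ C' ⊗ D'` of two `V`-functors. -/
@[simps]
def prodMap (F : EnrichedFunctor V C C') (G : EnrichedFunctor V D D') :
    EnrichedFunctor V (C × D) (C' × D') where
  obj X := (F.obj X.1, G.obj X.2)
  map X Y := F.map X.1 Y.1 ⊗ₘ G.map X.2 Y.2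
  map_id X := by
    rw [prod_eId, prod_eId, Category.assoc, tensorHom_comp_tensorHom, EnrichedFunctor.map_id,
      EnrichedFunctor.map_id]
  map_comp X Y Z := by
    rw [prod_eComp, prod_eComp, Category.assoc, tensorHom_comp_tensorHom,
      EnrichedFunctor.map_comp, EnrichedFunctor.map_comp, tensorμ_natural_assoc,
      tensorHom_comp_tensorHom]

variable (V C D) in
/-- The symmetry `C ⊗ D ⟶ D ⊗ C`. -/
@[simps]
def prodSwap : EnrichedFunctor V (C × D) (D × C) where
  obj X := (X.2, X.1)
  map X Y := (β_ (hom V X.1 Y.1) (hom V X.2 Y.2)).hom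
  map_id X := by
    rw [prod_eId, prod_eId, Category.assoc, BraidedCategory.braiding_naturality]
    simp [unitors_inv_equal]
  map_comp X Y Z := by
    rw [prod_eComp, prod_eComp, Category.assoc, BraidedCategory.braiding_naturality,
      ← Category.assoc, tensorμ_braiding, Category.assoc]

variable (V C D) in
/-- The identification of `(C ⊗ D)ᵒᵖ` with `Cᵒᵖ ⊗ Dᵒᵖ`. -/
@[simps]
def opProd : EnrichedFunctor V (C × D)ᵒᵖ (Cᵒᵖ × Dᵒᵖ) where
  obj X := (op X.unop.1, op X.unop.2)
  map X Y := 𝟙 (hom V Y.unop.1 X.unop.1 ⊗ hom V Y.unop.2 X.unop.2)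
  map_id X := Category.comp_id _
  map_comp X Y Z := by
    refine (Category.comp_id _).trans ?_
    refine Eq.trans ?_ (congrArg (· ≫ _) (id_tensorHom_id _ _).symm)
    refine Eq.trans ?_ (Category.id_comp _).symm
    rw [prod_eComp, eComp_op_eq, eComp_op_eq, eComp_op_eq, prod_eComp,
      ← tensorHom_comp_tensorHom, ← Category.assoc, ← Category.assoc]
    exact congrArg (· ≫ _) (braiding_tensorμ _ _ _ _)

variable [MonoidalClosed V]

variable (V) in
/-- The tensor product of `V` as a `V`-functor `V ⊗ V ⟶ V`. -/
def selfTensor : EnrichedFunctor V (V × V) V :=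
  ofAct (fun X => X.1 ⊗ X.2)
    (fun X Y => tensorμ X.1 X.2 (hom V X.1 Y.1) (hom V X.2 Y.2) ≫ (ev X.1 Y.1 ⊗ₘ ev X.2 Y.2))
    (fun X => by
      rw [prod_eId, MonoidalCategory.whiskerLeft_comp_assoc, tensorμ_natural_right_assoc,
        tensorHom_comp_tensorHom, ev_id, ev_id, tensor_right_unitality])
    (fun X Y Z => by
      rw [prod_eComp, MonoidalCategory.whiskerLeft_comp_assoc, tensorμ_natural_right_assoc,
        tensorHom_comp_tensorHom, ev_comp, ev_comp, Iso.eq_inv_comp, comp_whiskerRight_assoc,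
        ← tensorHom_comp_tensorHom, ← tensorHom_comp_tensorHom]
      have h := tensorμ_natural_left_assoc (ev X.1 Y.1) (ev X.2 Y.2) (hom V Y.1 Z.1)
        (hom V Y.2 Z.2) (ev Y.1 Z.1 ⊗ₘ ev Y.2 Z.2)
      refine Eq.trans ?_ (congrArg (_ ≫ ·) h.symm)
      refine Eq.trans (tensor_associativity_assoc X.1 X.2 (hom V X.1 Y.1) (hom V X.2 Y.2)
        (hom V Y.1 Z.1) (hom V Y.2 Z.2) _).symm ?_
      simp only [tensorHom_comp_tensorHom_assoc, Iso.hom_inv_id_assoc]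
      rfl)

/-- The representable `V`-functor `C(X, -) : C ⟶ V`. -/
def corepr (X : C) : EnrichedFunctor V C V :=
  ofAct (fun Y => hom V X Y) (fun Y Z => eComp V X Y Z)
    (fun Y => by
      have := e_comp_id V X Y
      rwa [Iso.inv_comp_eq, Category.comp_id] at this)
    (fun Y Z W => by rw [← e_assoc V X Y Z W])

/-- The representable presheaf `C(-, X) : Cᵒᵖ ⟶ V`. -/
def yonedaObj (X : C) : EnrichedFunctor V Cᵒᵖ V := corepr (op X)

end Functors

end Base

section FunctorCategory

variable {V : Type u} [Category.{v} V] [MonoidalCategory V] [SymmetricCategory V]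
  [MonoidalClosed V]
variable {C : Type w₁} {D : Type w} [EnrichedCategory V C] [EnrichedCategory V D]

/-- The family `f_X : W ⟶ D(F X, G X)` is `V`-natural in `X`. -/
def IsNat (F G : EnrichedFunctor V C D) {W : V} (f : ∀ X, W ⟶ hom V (F.obj X) (G.obj X)) : Prop :=
  ∀ X Y : C, (F.map X Y ⊗ₘ f Y) ≫ eComp V (F.obj X) (F.obj Y) (G.obj Y) =
    (β_ (hom V X Y) W).hom ≫ (f X ⊗ₘ G.map X Y) ≫ eComp V (F.obj X) (G.obj X) (G.obj Y)

lemma comp_aux₁ {X Y Z T : D} {U₁ U₂ U₃ : V} (a : U₁ ⟶ hom V X Y) (b : U₂ ⟶ hom V Y Z)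
    (c : U₃ ⟶ hom V Z T) :
    (a ⊗ₘ ((b ⊗ₘ c) ≫ eComp V Y Z T)) ≫ eComp V X Y T =
      (α_ _ _ _).inv ≫ (((a ⊗ₘ b) ≫ eComp V X Y Z) ⊗ₘ c) ≫ eComp V X Z T := by
  have h1 : (a ⊗ₘ ((b ⊗ₘ c) ≫ eComp V Y Z T)) =
      (a ⊗ₘ (b ⊗ₘ c)) ≫ (_ ◁ eComp V Y Z T) := by
    rw [← id_tensorHom, tensorHom_comp_tensorHom, Category.comp_id]
  have h2 : (((a ⊗ₘ b) ≫ eComp V X Y Z) ⊗ₘ c) =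
      ((a ⊗ₘ b) ⊗ₘ c) ≫ (eComp V X Y Z ▷ _) := by
    rw [← tensorHom_id, tensorHom_comp_tensorHom, Category.comp_id]
  rw [h1, h2, Category.assoc, Category.assoc, ← e_assoc, associator_inv_naturality_assoc]

lemma IsNat.comp {F G H : EnrichedFunctor V C D} {W₁ W₂ : V}
    {f : ∀ X, W₁ ⟶ hom V (F.obj X) (G.obj X)} {g : ∀ X, W₂ ⟶ hom V (G.obj X) (H.obj X)}
    (hf : IsNat F G f) (hg : IsNat G H g) :
    IsNat F H (fun X => (f X ⊗ₘ g X) ≫ eComp V (F.obj X) (G.obj X) (H.obj X)) := by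
  intro X Y
  have e1 : ∀ {U₁ U₂ U₃ U₄ : V} (p : U₁ ⟶ U₂) (q : U₂ ⟶ U₃) (c : W₂ ⟶ U₄),
      ((p ≫ q) ⊗ₘ c) = p ▷ W₂ ≫ (q ⊗ₘ c) := by
    intros; rw [← tensorHom_id, tensorHom_comp_tensorHom, Category.id_comp]
  have e2 : ∀ {U₁ U₂ U₃ U₄ : V} (p : U₁ ⟶ U₂) (q : U₂ ⟶ U₃) (c : W₁ ⟶ U₄),
      (c ⊗ₘ (p ≫ q)) = W₁ ◁ p ≫ (c ⊗ₘ q) := by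
    intros; rw [← id_tensorHom, tensorHom_comp_tensorHom, Category.id_comp]
  have e3 : (((f X ⊗ₘ G.map X Y) ≫ eComp V (F.obj X) (G.obj X) (G.obj Y)) ⊗ₘ g Y) ≫
      eComp V _ _ _ = (α_ _ _ _).hom ≫ (f X ⊗ₘ ((G.map X Y ⊗ₘ g Y) ≫ eComp V _ _ _)) ≫
        eComp V _ _ _ := by
    rw [comp_aux₁, Iso.hom_inv_id_assoc]
  rw [comp_aux₁, hf X Y, e1, Category.assoc, e3, hg X Y, e2, Category.assoc, comp_aux₁,
    BraidedCategory.braiding_tensor_right_hom]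
  simp only [Category.assoc]

lemma isNat_id (F : EnrichedFunctor V C D) : IsNat F F (fun X => eId V (F.obj X)) := by
  intro X Y
  have h1 := e_id_comp V (F.obj X) (F.obj Y)
  have h2 := e_comp_id V (F.obj X) (F.obj Y)
  rw [Iso.inv_comp_eq, Category.comp_id] at h1 h2
  rw [MonoidalCategory.tensorHom_def_assoc, MonoidalCategory.tensorHom_def'_assoc, h1, h2,
    rightUnitor_naturality, leftUnitor_naturality, braiding_leftUnitor_assoc]

end FunctorCategory

section FunctorCategory

variable {V : Type u} [Category.{v} V] [MonoidalCategory V] [SymmetricCategory V]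
  [MonoidalClosed V] [HasLimits V]
variable {C : Type v} {D : Type w} [EnrichedCategory V C] [EnrichedCategory V D]

/-- The object of `V`-natural transformations, the end of `D(F X, G X)`, as an equalizer. -/
def natObj (F G : EnrichedFunctor V C D) : V :=
  equalizer
    (Pi.lift (fun p : C × C => lam ((F.map p.1 p.2 ⊗ₘ
        Pi.π (fun X => hom V (F.obj X) (G.obj X)) p.2) ≫
      eComp V (F.obj p.1) (F.obj p.2) (G.obj p.2))))
    (Pi.lift (fun p : C × C => lam ((β_ _ _).hom ≫
      (Pi.π (fun X => hom V (F.obj X) (G.obj X)) p.1 ⊗ₘ G.map p.1 p.2) ≫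
      eComp V (F.obj p.1) (G.obj p.1) (G.obj p.2))))

/-- The projection of the end to its component at `X`. -/
def natπ (F G : EnrichedFunctor V C D) (X : C) : natObj F G ⟶ hom V (F.obj X) (G.obj X) :=
  equalizer.ι _ _ ≫ Pi.π _ X

lemma natπ_isNat (F G : EnrichedFunctor V C D) : IsNat F G (natπ F G) := by
  intro X Y
  have h := congrArg (· ≫ Pi.π _ (X, Y)) (equalizer.condition
    (Pi.lift (fun p : C × C => lam ((F.map p.1 p.2 ⊗ₘ
        Pi.π (fun X => hom V (F.obj X) (G.obj X)) p.2) ≫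
      eComp V (F.obj p.1) (F.obj p.2) (G.obj p.2))))
    (Pi.lift (fun p : C × C => lam ((β_ _ _).hom ≫
      (Pi.π (fun X => hom V (F.obj X) (G.obj X)) p.1 ⊗ₘ G.map p.1 p.2) ≫
      eComp V (F.obj p.1) (G.obj p.1) (G.obj p.2)))))
  simp only [Category.assoc, Pi.lift_π, lam_natural] at h
  have h' := lam_inj h
  rw [BraidedCategory.braiding_naturality_right_assoc, ← MonoidalCategory.tensorHom_id,
    ← id_tensorHom, tensorHom_comp_tensorHom_assoc, tensorHom_comp_tensorHom_assoc,
    Category.id_comp, Category.id_comp] at h'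
  exact h'

/-- The universal property of the end. -/
def natLift (F G : EnrichedFunctor V C D) {W : V} (f : ∀ X, W ⟶ hom V (F.obj X) (G.obj X))
    (hf : IsNat F G f) : W ⟶ natObj F G :=
  equalizer.lift (Pi.lift f) (by
    apply Pi.hom_ext
    rintro ⟨X, Y⟩
    simp only [Category.assoc, Pi.lift_π, lam_natural]
    congr 1
    rw [BraidedCategory.braiding_naturality_right_assoc, ← MonoidalCategory.tensorHom_id,
      ← id_tensorHom, tensorHom_comp_tensorHom_assoc, tensorHom_comp_tensorHom_assoc,
      Category.id_comp, Category.id_comp, Pi.lift_π, Pi.lift_π]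
    exact hf X Y)

lemma natLift_π (F G : EnrichedFunctor V C D) {W : V}
    (f : ∀ X, W ⟶ hom V (F.obj X) (G.obj X)) (hf : IsNat F G f) (X : C) :
    natLift F G f hf ≫ natπ F G X = f X :=
  (Category.assoc _ _ _).symm.trans
    ((congrArg (· ≫ _) (equalizer.lift_ι _ _)).trans (Pi.lift_π f X))

lemma nat_hom_ext {F G : EnrichedFunctor V C D} {W : V} {f g : W ⟶ natObj F G}
    (h : ∀ X, f ≫ natπ F G X = g ≫ natπ F G X) : f = g := by
  apply equalizer.hom_ext
  apply Pi.hom_ext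
  intro X
  exact (Category.assoc _ _ _).trans ((h X).trans (Category.assoc _ _ _).symm)

/-- The `V`-category `[C, D]` of `V`-functors, with hom-objects the ends of `D(F X, G X)`. -/
instance functorEnriched : EnrichedCategory V (EnrichedFunctor V C D) where
  Hom F G := natObj F G
  id F := natLift F F (fun X => eId V (F.obj X)) (isNat_id F)
  comp F G H := natLift F H _ ((natπ_isNat F G).comp (natπ_isNat G H))
  id_comp F G := by
    apply nat_hom_ext
    intro X
    have h1 := e_id_comp V (F.obj X) (G.obj X)
    simp only [Category.assoc, natLift_π]
    rw [← MonoidalCategory.tensorHom_id, tensorHom_comp_tensorHom_assoc, natLift_π,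
      MonoidalCategory.tensorHom_def'_assoc, ← leftUnitor_inv_naturality_assoc, h1,
      Category.id_comp, Category.comp_id]
  comp_id F G := by
    apply nat_hom_ext
    intro X
    have h1 := e_comp_id V (F.obj X) (G.obj X)
    simp only [Category.assoc, natLift_π]
    rw [← id_tensorHom, tensorHom_comp_tensorHom_assoc, natLift_π,
      MonoidalCategory.tensorHom_def_assoc, ← rightUnitor_inv_naturality_assoc, h1,
      Category.id_comp, Category.comp_id]
  assoc F G H K := by
    apply nat_hom_ext
    intro X
    simp only [Category.assoc, natLift_π]
    rw [← MonoidalCategory.tensorHom_id, tensorHom_comp_tensorHom_assoc, natLift_π,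
      ← id_tensorHom, tensorHom_comp_tensorHom_assoc, natLift_π, Category.id_comp,
      Category.id_comp, comp_aux₁]

end FunctorCategory

section Postcomp

variable {V : Type u} [Category.{v} V] [MonoidalCategory V] [SymmetricCategory V]
  [MonoidalClosed V] [HasLimits V]
variable {C : Type v} {D : Type w₁} {E : Type w₂}
  [EnrichedCategory V C] [EnrichedCategory V D] [EnrichedCategory V E]

lemma nat_eId_π (F : EnrichedFunctor V C D) (X : C) :
    eId V F ≫ natπ F F X = eId V (F.obj X) :=
  natLift_π F F _ (isNat_id F) X

lemma nat_eComp_π (F G H : EnrichedFunctor V C D) (X : C) :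
    eComp V F G H ≫ natπ F H X =
      (natπ F G X ⊗ₘ natπ G H X) ≫ eComp V (F.obj X) (G.obj X) (H.obj X) :=
  natLift_π F H _ ((natπ_isNat F G).comp (natπ_isNat G H)) X

lemma postcomp_isNat (T : EnrichedFunctor V D E) (F G : EnrichedFunctor V C D) :
    IsNat (F.comp V T) (G.comp V T) (fun X => natπ F G X ≫ T.map (F.obj X) (G.obj X)) := by
  intro X Y
  have h := congrArg (· ≫ T.map (F.obj X) (G.obj Y)) (natπ_isNat F G X Y)
  simp only [Category.assoc, T.map_comp, tensorHom_comp_tensorHom_assoc] at h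
  exact h

/-- Post-composition `F ↦ T ∘ F` as a `V`-functor `[C, D] ⟶ [C, E]`. -/
def postcomp (T : EnrichedFunctor V D E) :
    EnrichedFunctor V (EnrichedFunctor V C D) (EnrichedFunctor V C E) where
  obj F := F.comp V T
  map F G := natLift (F.comp V T) (G.comp V T) _ (postcomp_isNat T F G)
  map_id F := by
    apply nat_hom_ext
    intro X
    rw [Category.assoc, natLift_π, nat_eId_π]
    exact (Category.assoc _ _ _).symm.trans
      ((congrArg (· ≫ _) (nat_eId_π F X)).trans (T.map_id _))
  map_comp F G H := by
    apply nat_hom_ext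
    intro X
    rw [Category.assoc, natLift_π, Category.assoc, nat_eComp_π, tensorHom_comp_tensorHom_assoc,
      natLift_π, natLift_π]
    refine (Category.assoc _ _ _).symm.trans ((congrArg (· ≫ _) (nat_eComp_π F G H X)).trans
      ((Category.assoc _ _ _).trans ((congrArg (_ ≫ ·) (T.map_comp _ _ _)).trans ?_)))
    rw [tensorHom_comp_tensorHom_assoc]
    rfl

end Postcomp

section Coend

variable {V : Type u} [Category.{v} V] [MonoidalCategory V] [SymmetricCategory V]
  [MonoidalClosed V]
variable {K : Type v} [EnrichedCategory V K]

/-- The contravariant action `H(l, k) ⊗ K(k, l) ⟶ H(k, k)`. -/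
def lact (H : EnrichedFunctor V (Kᵒᵖ × K) V) (k l : K) :
    H.obj (op l, k) ⊗ hom V k l ⟶ H.obj (op k, k) :=
  H.obj (op l, k) ◁ ((ρ_ (hom V k l)).inv ≫ hom V k l ◁ eId V k) ≫ act H (op l, k) (op k, k)

/-- The covariant action `H(l, k) ⊗ K(k, l) ⟶ H(l, l)`. -/
def ract (H : EnrichedFunctor V (Kᵒᵖ × K) V) (k l : K) :
    H.obj (op l, k) ⊗ hom V k l ⟶ H.obj (op l, l) :=
  H.obj (op l, k) ◁ ((λ_ (hom V k l)).inv ≫ eId V (op l) ▷ hom V k l) ≫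
    act H (op l, k) (op l, l)

variable [HasColimits V]

/-- The coend of a `V`-functor `H : Kᵒᵖ ⊗ K ⟶ V`, as a coequalizer. -/
def coend (H : EnrichedFunctor V (Kᵒᵖ × K) V) : V :=
  coequalizer
    (Sigma.desc (fun p : K × K => lact H p.1 p.2 ≫ Sigma.ι (fun k => H.obj (op k, k)) p.1))
    (Sigma.desc (fun p : K × K => ract H p.1 p.2 ≫ Sigma.ι (fun k => H.obj (op k, k)) p.2))

/-- The coprojection `e_k : H(k, k) ⟶ ∫^k H(k, k)`. -/
def coendι (H : EnrichedFunctor V (Kᵒᵖ × K) V) (k : K) : H.obj (op k, k) ⟶ coend H :=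
  Sigma.ι (fun k => H.obj (op k, k)) k ≫ coequalizer.π _ _

lemma coend_condition (H : EnrichedFunctor V (Kᵒᵖ × K) V) (k l : K) :
    lact H k l ≫ coendι H k = ract H k l ≫ coendι H l := by
  have h := congrArg (Sigma.ι (fun p : K × K => H.obj (op p.2, p.1) ⊗ hom V p.1 p.2) (k, l) ≫ ·)
    (coequalizer.condition
      (Sigma.desc (fun p : K × K => lact H p.1 p.2 ≫ Sigma.ι (fun k => H.obj (op k, k)) p.1))
      (Sigma.desc (fun p : K × K => ract H p.1 p.2 ≫ Sigma.ι (fun k => H.obj (op k, k)) p.2)))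
  simp only [Sigma.ι_desc_assoc, Category.assoc] at h
  exact h

/-- The universal property of the coend. -/
def coendDesc (H : EnrichedFunctor V (Kᵒᵖ × K) V) {Z : V} (φ : ∀ k, H.obj (op k, k) ⟶ Z)
    (hφ : ∀ k l, lact H k l ≫ φ k = ract H k l ≫ φ l) : coend H ⟶ Z :=
  coequalizer.desc (Sigma.desc φ) (by
    apply Sigma.hom_ext
    rintro ⟨k, l⟩
    simp only [Sigma.ι_desc_assoc, Category.assoc, Sigma.ι_desc]
    exact hφ k l)

lemma coendι_desc (H : EnrichedFunctor V (Kᵒᵖ × K) V) {Z : V} (φ : ∀ k, H.obj (op k, k) ⟶ Z)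
    (hφ) (k : K) : coendι H k ≫ coendDesc H φ hφ = φ k :=
  (Category.assoc _ _ _).trans
    ((congrArg (_ ≫ ·) (coequalizer.π_desc _ _)).trans (Sigma.ι_desc φ k))

lemma coend_hom_ext (H : EnrichedFunctor V (Kᵒᵖ × K) V) {Z : V} {f g : coend H ⟶ Z}
    (h : ∀ k, coendι H k ≫ f = coendι H k ≫ g) : f = g := by
  apply coequalizer.hom_ext
  apply Sigma.hom_ext
  intro k
  exact (Category.assoc _ _ _).symm.trans ((h k).trans (Category.assoc _ _ _))

lemma coend_whisker_hom_ext (H : EnrichedFunctor V (Kᵒᵖ × K) V) {W Z : V}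
    {f g : coend H ⊗ W ⟶ Z} (h : ∀ k, coendι H k ▷ W ≫ f = coendι H k ▷ W ≫ g) : f = g := by
  rw [← cancel_epi (β_ W (coend H)).hom]
  apply lam_inj
  apply coend_hom_ext
  intro k
  rw [lam_natural, lam_natural, BraidedCategory.braiding_naturality_right_assoc,
    BraidedCategory.braiding_naturality_right_assoc, h k]

/-- The map `(∫^k H(k, k)) ⊗ W ⟶ ∫^k H'(k, k)` induced by a natural family. -/
def coendMap (H H' : EnrichedFunctor V (Kᵒᵖ × K) V) {W : V}
    (ψ : ∀ l k : K, H.obj (op l, k) ⊗ W ⟶ H'.obj (op l, k))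
    (hl : ∀ k l, lact H k l ▷ W ≫ ψ k k = swapR _ _ _ ≫ ψ l k ▷ hom V k l ≫ lact H' k l)
    (hr : ∀ k l, ract H k l ▷ W ≫ ψ l l = swapR _ _ _ ≫ ψ l k ▷ hom V k l ≫ ract H' k l) :
    coend H ⊗ W ⟶ coend H' :=
  (β_ _ _).hom ≫ W ◁ coendDesc H (fun k => lam ((β_ _ _).hom ≫ ψ k k ≫ coendι H' k))
    (fun k l => by
      rw [lam_natural, lam_natural, BraidedCategory.braiding_naturality_right_assoc,
        BraidedCategory.braiding_naturality_right_assoc, reassoc_of% (hl k l),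
        reassoc_of% (hr k l), coend_condition]) ≫ ev W (coend H')

lemma coendMap_ι (H H' : EnrichedFunctor V (Kᵒᵖ × K) V) {W : V}
    (ψ : ∀ l k : K, H.obj (op l, k) ⊗ W ⟶ H'.obj (op l, k)) (hl hr) (k : K) :
    coendι H k ▷ W ≫ coendMap H H' ψ hl hr = ψ k k ≫ coendι H' k := by
  rw [coendMap, BraidedCategory.braiding_naturality_left_assoc,
    ← MonoidalCategory.whiskerLeft_comp_assoc, coendι_desc, lam_ev,
    SymmetricCategory.symmetry_assoc]

end Coend

section Weighted

variable {V : Type u} [Category.{v} V] [MonoidalCategory V] [SymmetricCategory V]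

lemma swapR_coh₁ (W M K P : V) :
    (α_ W M K).hom ▷ P ≫ swapR W (M ⊗ K) P =
      swapR (W ⊗ M) K P ≫ swapR W M P ▷ K ≫ (α_ (W ⊗ P) M K).hom := by
  simp [swapR, BraidedCategory.braiding_tensor_left_hom]

lemma swapR_coh₂ (W M K P : V) :
    swapR W M K ▷ P ≫ swapR (W ⊗ K) M P ≫ swapR W K P ▷ M =
      swapR (W ⊗ M) K P ≫ swapR W M P ▷ K ≫ swapR (W ⊗ P) M K := by
  have h := congrArg (fun f => (α_ (W ⊗ M) K P).hom ≫ (α_ W M (K ⊗ P)).hom ≫ W ◁ f ≫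
    W ◁ (α_ P K M).inv ≫ (α_ W (P ⊗ K) M).inv ≫ (α_ W P K).inv ▷ M)
    (BraidedCategory.yang_baxter M K P)
  simp [swapR] at h ⊢
  rw [← h]

lemma swapR_coh₃ (W M K P : V) :
    (α_ W M K).hom ▷ P ≫ (α_ W (M ⊗ K) P).hom ≫ W ◁ swapR M K P =
      swapR (W ⊗ M) K P ≫ (α_ W M P).hom ▷ K ≫ (α_ W (M ⊗ P) K).hom := by
  simp [swapR]

lemma swapR_coh₄ (W M K P : V) :
    swapR W M K ▷ P ≫ (α_ (W ⊗ K) M P).hom =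
      swapR (W ⊗ M) K P ≫ (α_ W M P).hom ▷ K ≫ swapR W (M ⊗ P) K := by
  simp only [swapR, BraidedCategory.braiding_tensor_left_hom, comp_whiskerRight, Category.assoc,
    MonoidalCategory.whiskerLeft_comp]
  have h : W ◁ M ◁ (β_ K P).hom ≫ W ◁ M ◁ (β_ P K).hom = 𝟙 _ := by
    simp [← MonoidalCategory.whiskerLeft_comp]
  simp [reassoc_of% h]

lemma swapR_tensorμ (X₁ X₂ Y₁ Y₂ Z₁ Z₂ : V) :
    tensorμ X₁ X₂ Y₁ Y₂ ▷ (Z₁ ⊗ Z₂) ≫ tensorμ (X₁ ⊗ Y₁) (X₂ ⊗ Y₂) Z₁ Z₂ ≫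
        (swapR X₁ Y₁ Z₁ ⊗ₘ swapR X₂ Y₂ Z₂) =
      swapR (X₁ ⊗ X₂) (Y₁ ⊗ Y₂) (Z₁ ⊗ Z₂) ≫ tensorμ X₁ X₂ Z₁ Z₂ ▷ (Y₁ ⊗ Y₂) ≫
        tensorμ (X₁ ⊗ Z₁) (X₂ ⊗ Z₂) Y₁ Y₂ := by
  simp only [swapR, ← tensorHom_comp_tensorHom]
  rw [tensor_associativity_assoc]
  have h : tensorμ X₁ X₂ (Y₁ ⊗ Z₁) (Y₂ ⊗ Z₂) ≫ (X₁ ◁ (β_ Y₁ Z₁).hom ⊗ₘ X₂ ◁ (β_ Y₂ Z₂).hom) =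
    (X₁ ⊗ X₂) ◁ ((β_ Y₁ Z₁).hom ⊗ₘ (β_ Y₂ Z₂).hom) ≫ tensorμ X₁ X₂ (Z₁ ⊗ Y₁) (Z₂ ⊗ Y₂) :=
    (tensorμ_natural_right _ _ _ _).symm
  rw [reassoc_of% h, ← MonoidalCategory.whiskerLeft_comp_assoc, ← braiding_tensorμ,
    MonoidalCategory.whiskerLeft_comp_assoc, Category.assoc, Category.assoc]
  congr 2
  rw [← cancel_mono ((α_ X₁ Z₁ Y₁).hom ⊗ₘ (α_ X₂ Z₂ Y₂).hom)]
  simp only [Category.assoc, tensorHom_comp_tensorHom, Iso.inv_hom_id]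
  rw [tensor_associativity]
  simp

end Weighted

section Integrand

variable {V : Type u} [Category.{v} V] [MonoidalCategory V] [SymmetricCategory V]
  [MonoidalClosed V]

lemma act_functor_comp {D : Type w₁} {E : Type w₂} [EnrichedCategory V D] [EnrichedCategory V E]
    (F : EnrichedFunctor V D E) (G : EnrichedFunctor V E V) (X Y : D) :
    act (F.comp V G) X Y = G.obj (F.obj X) ◁ F.map X Y ≫ act G (F.obj X) (F.obj Y) :=
  (congrArg (· ≫ _) (MonoidalCategory.whiskerLeft_comp _ _ _)).trans (Category.assoc _ _ _)

lemma act_selfTensor (X Y : V × V) : act (selfTensor V) X Y =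
    tensorμ X.1 X.2 (hom V X.1 Y.1) (hom V X.2 Y.2) ≫ (ev X.1 Y.1 ⊗ₘ ev X.2 Y.2) :=
  act_ofAct _ _ _ _ _ _

/-- The pointwise tensor product `(X, Y) ↦ F X ⊗ G Y`. -/
def extTensor {C : Type w₁} {D : Type w₂} [EnrichedCategory V C] [EnrichedCategory V D]
    (F : EnrichedFunctor V C V) (G : EnrichedFunctor V D V) : EnrichedFunctor V (C × D) V :=
  (prodMap F G).comp V (selfTensor V)

lemma act_extTensor {C : Type w₁} {D : Type w₂} [EnrichedCategory V C] [EnrichedCategory V D]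
    (F : EnrichedFunctor V C V) (G : EnrichedFunctor V D V) (X Y : C × D) :
    act (extTensor F G) X Y =
      tensorμ (F.obj X.1) (G.obj X.2) (hom V X.1 Y.1) (hom V X.2 Y.2) ≫
        (act F X.1 Y.1 ⊗ₘ act G X.2 Y.2) := by
  refine (act_functor_comp _ _ _ _).trans ?_
  rw [act_selfTensor]
  refine (tensorμ_natural_right_assoc _ _ _ _ _).trans ?_
  exact congrArg (_ ≫ ·) (tensorHom_comp_tensorHom _ _ _ _)

lemma tensorμ_unit_left {A M E K M' : V} (i : 𝟙_ V ⟶ E) (a : A ⊗ E ⟶ A) (b : M ⊗ K ⟶ M')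
    (hi : A ◁ i ≫ a = (ρ_ A).hom) :
    (A ⊗ M) ◁ ((ρ_ K).inv ≫ K ◁ i) ≫ (A ⊗ M) ◁ (β_ K E).hom ≫ tensorμ A M E K ≫ (a ⊗ₘ b) =
      (α_ A M K).hom ≫ A ◁ b := by
  have h : ((ρ_ K).inv ≫ K ◁ i) ≫ (β_ K E).hom = (λ_ K).inv ≫ (i ⊗ₘ 𝟙 K) := by
    rw [Category.assoc, BraidedCategory.braiding_naturality_right, MonoidalCategory.tensorHom_id,
      rightUnitor_inv_braiding_assoc]
  rw [← MonoidalCategory.whiskerLeft_comp_assoc, h, MonoidalCategory.whiskerLeft_comp_assoc,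
    tensorμ_natural_right_assoc, tensorHom_comp_tensorHom, hi]
  simp only [tensorμ, braiding_tensorUnit_right,
    MonoidalCategory.tensorHom_def]
  monoidal

lemma tensorμ_unit_right {A M E K A' : V} (i : 𝟙_ V ⟶ E) (a : A ⊗ K ⟶ A') (b : M ⊗ E ⟶ M)
    (hi : M ◁ i ≫ b = (ρ_ M).hom) :
    (A ⊗ M) ◁ ((λ_ K).inv ≫ i ▷ K) ≫ (A ⊗ M) ◁ (β_ E K).hom ≫ tensorμ A M K E ≫ (a ⊗ₘ b) =
      swapR A M K ≫ a ▷ M := by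
  have h : ((λ_ K).inv ≫ i ▷ K) ≫ (β_ E K).hom = (ρ_ K).inv ≫ (𝟙 K ⊗ₘ i) := by
    rw [Category.assoc, BraidedCategory.braiding_naturality_left, id_tensorHom,
      leftUnitor_inv_braiding_assoc]
  rw [← MonoidalCategory.whiskerLeft_comp_assoc, h, MonoidalCategory.whiskerLeft_comp_assoc,
    tensorμ_natural_right_assoc, tensorHom_comp_tensorHom, hi]
  simp [tensorμ, swapR, MonoidalCategory.tensorHom_def]

variable {K : Type v} [EnrichedCategory V K]

/-- The `V`-functor `(l, k) ↦ W k ⊗ M l` on `Kᵒᵖ ⊗ K`. -/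
def weighted (W : EnrichedFunctor V K V) (M : EnrichedFunctor V Kᵒᵖ V) :
    EnrichedFunctor V (Kᵒᵖ × K) V :=
  (prodSwap V Kᵒᵖ K).comp V (extTensor W M)

lemma lact_weighted (W : EnrichedFunctor V K V) (M : EnrichedFunctor V Kᵒᵖ V) (k l : K) :
    lact (weighted W M) k l =
      (α_ (W.obj k) (M.obj (op l)) (hom V k l)).hom ≫ W.obj k ◁ act M (op l) (op k) := by
  have h : act (weighted W M) (op l, k) (op k, k) =
      (W.obj k ⊗ M.obj (op l)) ◁ (β_ (hom V k l) (hom V k k)).hom ≫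
      tensorμ (W.obj k) (M.obj (op l)) (hom V k k) (hom V k l) ≫
        (act W k k ⊗ₘ act M (op l) (op k)) := by
    refine (act_functor_comp _ _ _ _).trans ?_
    rw [act_extTensor]
    rfl
  rw [lact, h]
  exact tensorμ_unit_left _ _ _ (act_id W k)

lemma ract_weighted (W : EnrichedFunctor V K V) (M : EnrichedFunctor V Kᵒᵖ V) (k l : K) :
    ract (weighted W M) k l =
      swapR (W.obj k) (M.obj (op l)) (hom V k l) ≫ act W k l ▷ M.obj (op l) := by
  have h : act (weighted W M) (op l, k) (op l, l) =
      (W.obj k ⊗ M.obj (op l)) ◁ (β_ (hom V l l) (hom V k l)).hom ≫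
      tensorμ (W.obj k) (M.obj (op l)) (hom V k l) (hom V l l) ≫
        (act W k l ⊗ₘ act M (op l) (op l)) := by
    refine (act_functor_comp _ _ _ _).trans ?_
    rw [act_extTensor]
    rfl
  rw [ract, h]
  exact tensorμ_unit_right _ _ _ (act_id M (op l))

end Integrand

section Coherence

variable {V : Type u} [Category.{v} V] [MonoidalCategory V] [SymmetricCategory V]

lemma weighted_coh₁ {W W' M M' K P : V} (b : M ⊗ K ⟶ M') (θ : W ⊗ P ⟶ W') :
    ((α_ W M K).hom ≫ W ◁ b) ▷ P ≫ (swapR W M' P ≫ θ ▷ M') =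
      swapR (W ⊗ M) K P ≫ (swapR W M P ≫ θ ▷ M) ▷ K ≫ ((α_ W' M K).hom ≫ W' ◁ b) := by
  have h := swapR_natural (𝟙 W) b (𝟙 P)
  simp only [MonoidalCategory.id_tensorHom, MonoidalCategory.tensorHom_id, id_whiskerRight] at h
  rw [comp_whiskerRight, comp_whiskerRight, Category.assoc, Category.assoc,
    associator_naturality_left_assoc, ← whisker_exchange, reassoc_of% h,
    reassoc_of% (swapR_coh₁ W M K P)]

lemma weighted_coh₂ {W W' W₂ W₂' M K P : V} (a : W ⊗ K ⟶ W₂) (a' : W' ⊗ K ⟶ W₂')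
    (θ : W ⊗ P ⟶ W') (θ₂ : W₂ ⊗ P ⟶ W₂')
    (hθ : a ▷ P ≫ θ₂ = swapR W K P ≫ θ ▷ K ≫ a') :
    (swapR W M K ≫ a ▷ M) ▷ P ≫ (swapR W₂ M P ≫ θ₂ ▷ M) =
      swapR (W ⊗ M) K P ≫ (swapR W M P ≫ θ ▷ M) ▷ K ≫ (swapR W' M K ≫ a' ▷ M) := by
  have h := swapR_natural a (𝟙 M) (𝟙 P)
  have h' := swapR_natural θ (𝟙 M) (𝟙 K)
  simp only [MonoidalCategory.tensorHom_id] at h h'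
  rw [comp_whiskerRight, comp_whiskerRight, Category.assoc, Category.assoc, reassoc_of% h,
    reassoc_of% h', ← comp_whiskerRight, hθ, comp_whiskerRight, comp_whiskerRight,
    reassoc_of% (swapR_coh₂ W M K P)]

lemma weighted_coh₃ {W M M' M₂ M₂' K P : V} (b : M ⊗ K ⟶ M₂) (b' : M' ⊗ K ⟶ M₂')
    (θ : M ⊗ P ⟶ M') (θ₂ : M₂ ⊗ P ⟶ M₂')
    (hθ : b ▷ P ≫ θ₂ = swapR M K P ≫ θ ▷ K ≫ b') :
    ((α_ W M K).hom ≫ W ◁ b) ▷ P ≫ ((α_ W M₂ P).hom ≫ W ◁ θ₂) =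
      swapR (W ⊗ M) K P ≫ ((α_ W M P).hom ≫ W ◁ θ) ▷ K ≫ ((α_ W M' K).hom ≫ W ◁ b') := by
  rw [comp_whiskerRight, comp_whiskerRight, Category.assoc, Category.assoc,
    associator_naturality_middle_assoc, associator_naturality_middle_assoc,
    ← MonoidalCategory.whiskerLeft_comp, hθ, MonoidalCategory.whiskerLeft_comp,
    MonoidalCategory.whiskerLeft_comp, reassoc_of% (swapR_coh₃ W M K P)]

lemma weighted_coh₄ {W W' M M' K P : V} (a : W ⊗ K ⟶ W') (θ : M ⊗ P ⟶ M') :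
    (swapR W M K ≫ a ▷ M) ▷ P ≫ ((α_ W' M P).hom ≫ W' ◁ θ) =
      swapR (W ⊗ M) K P ≫ ((α_ W M P).hom ≫ W ◁ θ) ▷ K ≫ (swapR W M' K ≫ a ▷ M') := by
  have h' := swapR_natural (𝟙 W) θ (𝟙 K)
  simp only [MonoidalCategory.id_tensorHom, MonoidalCategory.tensorHom_id, id_whiskerRight] at h'
  rw [comp_whiskerRight, comp_whiskerRight, Category.assoc, Category.assoc,
    associator_naturality_left_assoc, reassoc_of% h', ← whisker_exchange,
    reassoc_of% (swapR_coh₄ W M K P)]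

end Coherence

section Day

variable {V : Type u} [Category.{v} V] [MonoidalCategory V] [SymmetricCategory V]
  [MonoidalClosed V]
variable {K : Type v} [EnrichedCategory V K] [HasColimits V]

/-- The coprojection `W k ⊗ M k ⟶ ∫^k W k ⊗ M k`. -/
def wι (W : EnrichedFunctor V K V) (M : EnrichedFunctor V Kᵒᵖ V) (k : K) :
    W.obj k ⊗ M.obj (op k) ⟶ coend (weighted W M) :=
  coendι (weighted W M) k

/-- Functoriality of `∫^k W k ⊗ M k` in the weight. -/
def weightedMapLeft {W W' : EnrichedFunctor V K V} (M : EnrichedFunctor V Kᵒᵖ V) {P : V}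
    (θ : ∀ k, W.obj k ⊗ P ⟶ W'.obj k)
    (hθ : ∀ k l, act W k l ▷ P ≫ θ l =
      swapR (W.obj k) (hom V k l) P ≫ θ k ▷ hom V k l ≫ act W' k l) :
    coend (weighted W M) ⊗ P ⟶ coend (weighted W' M) :=
  coendMap (weighted W M) (weighted W' M)
    (fun l k => swapR (W.obj k) (M.obj (op l)) P ≫ θ k ▷ M.obj (op l))
    (fun k l => by
      rw [lact_weighted, lact_weighted]
      exact weighted_coh₁ _ _)
    (fun k l => by
      rw [ract_weighted, ract_weighted]
      exact weighted_coh₂ _ _ _ _ (hθ k l))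

lemma weightedMapLeft_ι {W W' : EnrichedFunctor V K V} (M : EnrichedFunctor V Kᵒᵖ V) {P : V}
    (θ : ∀ k, W.obj k ⊗ P ⟶ W'.obj k) (hθ) (k : K) :
    wι W M k ▷ P ≫ weightedMapLeft M θ hθ =
      (swapR (W.obj k) (M.obj (op k)) P ≫ θ k ▷ M.obj (op k)) ≫ wι W' M k :=
  coendMap_ι _ _ _ _ _ k

/-- Functoriality of `∫^k W k ⊗ M k` in the second argument. -/
def weightedMapRight (W : EnrichedFunctor V K V) {M M' : EnrichedFunctor V Kᵒᵖ V} {P : V}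
    (θ : ∀ k, M.obj (op k) ⊗ P ⟶ M'.obj (op k))
    (hθ : ∀ k l, act M (op l) (op k) ▷ P ≫ θ k =
      swapR (M.obj (op l)) (hom V k l) P ≫ θ l ▷ hom V k l ≫ act M' (op l) (op k)) :
    coend (weighted W M) ⊗ P ⟶ coend (weighted W M') :=
  coendMap (weighted W M) (weighted W M')
    (fun l k => (α_ (W.obj k) (M.obj (op l)) P).hom ≫ W.obj k ◁ θ l)
    (fun k l => by
      rw [lact_weighted, lact_weighted]
      exact weighted_coh₃ _ _ _ _ (hθ k l))
    (fun k l => by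
      rw [ract_weighted, ract_weighted]
      exact weighted_coh₄ _ _)

lemma weightedMapRight_ι (W : EnrichedFunctor V K V) {M M' : EnrichedFunctor V Kᵒᵖ V} {P : V}
    (θ : ∀ k, M.obj (op k) ⊗ P ⟶ M'.obj (op k)) (hθ) (k : K) :
    wι W M k ▷ P ≫ weightedMapRight W θ hθ =
      ((α_ (W.obj k) (M.obj (op k)) P).hom ≫ W.obj k ◁ θ k) ≫ wι W M' k :=
  coendMap_ι _ _ _ _ _ k

end Day

section DayFunctors

variable {V : Type u} [Category.{v} V] [MonoidalCategory V] [SymmetricCategory V]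
  [MonoidalClosed V]
variable {A : Type v} [EnrichedCategory V A] (tA : EnrichedFunctor V (A × A) A)

/-- The covariant `V`-functor `(X, Y) ↦ A(C, X ⊗ Y)`. -/
def dayWeight (C : Aᵒᵖ) : EnrichedFunctor V (A × A) V := tA.comp V (corepr C.unop)

/-- The contravariant `V`-functor `(X, Y) ↦ F X ⊗ G Y`. -/
def dayArg (F G : EnrichedFunctor V Aᵒᵖ V) : EnrichedFunctor V (A × A)ᵒᵖ V :=
  (opProd V A A).comp V (extTensor F G)

/-- The integrand `((X', Y'), (X, Y)) ↦ A(C, X ⊗ Y) ⊗ (F X' ⊗ G Y')` of the Day tensor. -/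
def dayIntegrand (F G : EnrichedFunctor V Aᵒᵖ V) (C : Aᵒᵖ) :
    EnrichedFunctor V ((A × A)ᵒᵖ × (A × A)) V :=
  weighted (dayWeight tA C) (dayArg F G)

lemma act_dayWeight (C : Aᵒᵖ) (k l : A × A) : act (dayWeight tA C) k l =
    hom V C.unop (tA.obj k) ◁ tA.map k l ≫ eComp V C.unop (tA.obj k) (tA.obj l) := by
  refine (act_functor_comp _ _ _ _).trans ?_
  exact congrArg (_ ≫ ·) (act_ofAct _ _ _ _ _ _)

lemma act_dayArg (F G : EnrichedFunctor V Aᵒᵖ V) (k l : A × A) :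
    act (dayArg F G) (op l) (op k) =
      tensorμ (F.obj (op l.1)) (G.obj (op l.2)) (hom V k.1 l.1) (hom V k.2 l.2) ≫
        (act F (op l.1) (op k.1) ⊗ₘ act G (op l.2) (op k.2)) := by
  refine (act_functor_comp _ _ _ _).trans ?_
  refine (congrArg (· ≫ _) (MonoidalCategory.whiskerLeft_id _ _)).trans ?_
  refine (Category.id_comp _).trans ?_
  exact act_extTensor _ _ _ _

/-- Precomposition `A(C, X ⊗ Y) ⊗ A(C', C) ⟶ A(C', X ⊗ Y)`. -/
def dayPre (C C' : Aᵒᵖ) (k : A × A) :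
    (dayWeight tA C).obj k ⊗ hom V C C' ⟶ (dayWeight tA C').obj k :=
  (β_ (hom V C.unop (tA.obj k)) (hom V C'.unop C.unop)).hom ≫
    eComp V C'.unop C.unop (tA.obj k)

lemma pre_natural {C C' X Y : A} {N : V} (t : N ⟶ hom V X Y) :
    (hom V C X ◁ t ≫ eComp V C X Y) ▷ hom V C' C ≫
        (β_ (hom V C Y) (hom V C' C)).hom ≫ eComp V C' C Y =
      swapR (hom V C X) N (hom V C' C) ≫
        ((β_ (hom V C X) (hom V C' C)).hom ≫ eComp V C' C X) ▷ N ≫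
          (hom V C' X ◁ t ≫ eComp V C' X Y) := by
  have h : swapR (hom V C X) N (hom V C' C) ≫ (β_ (hom V C X) (hom V C' C)).hom ▷ N =
      (β_ (hom V C X ⊗ N) (hom V C' C)).hom ≫ (α_ _ _ _).inv := by
    simp [swapR, BraidedCategory.braiding_tensor_left_hom]
  rw [BraidedCategory.braiding_naturality_left_assoc, MonoidalCategory.whiskerLeft_comp_assoc,
    ← e_assoc, associator_inv_naturality_right_assoc, whisker_exchange_assoc, comp_whiskerRight,
    Category.assoc, reassoc_of% h]

lemma dayPre_natural (C C' : Aᵒᵖ) (k l : A × A) :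
    act (dayWeight tA C) k l ▷ hom V C C' ≫ dayPre tA C C' l =
      swapR ((dayWeight tA C).obj k) (hom V k l) (hom V C C') ≫
        dayPre tA C C' k ▷ hom V k l ≫ act (dayWeight tA C') k l := by
  rw [act_dayWeight, act_dayWeight]
  exact pre_natural _

end DayFunctors

section Coherence

variable {V : Type u} [Category.{v} V] [MonoidalCategory V] [SymmetricCategory V]

lemma swapR_unit {X Y P : V} {i : 𝟙_ V ⟶ P} {θ : X ⊗ P ⟶ X} (h : X ◁ i ≫ θ = (ρ_ X).hom) :
    (X ⊗ Y) ◁ i ≫ swapR X Y P ≫ θ ▷ Y = (ρ_ (X ⊗ Y)).hom := by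
  have h' := swapR_natural (𝟙 X) (𝟙 Y) i
  simp only [MonoidalCategory.id_tensorHom, MonoidalCategory.tensorHom_id, id_whiskerRight] at h'
  rw [reassoc_of% h', ← comp_whiskerRight, h]
  simp [swapR]

lemma assoc_unit {X Y P : V} {i : 𝟙_ V ⟶ P} {θ : Y ⊗ P ⟶ Y} (h : Y ◁ i ≫ θ = (ρ_ Y).hom) :
    (X ⊗ Y) ◁ i ≫ (α_ X Y P).hom ≫ X ◁ θ = (ρ_ (X ⊗ Y)).hom := by
  rw [associator_naturality_right_assoc, ← MonoidalCategory.whiskerLeft_comp, h]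
  simp

lemma swapR_comp {X X' X'' Y P P' P'' : V} {c : P ⊗ P' ⟶ P''} {θ : X ⊗ P ⟶ X'}
    {θ' : X' ⊗ P' ⟶ X''} {θ'' : X ⊗ P'' ⟶ X''}
    (h : X ◁ c ≫ θ'' = (α_ X P P').inv ≫ θ ▷ P' ≫ θ') :
    (X ⊗ Y) ◁ c ≫ swapR X Y P'' ≫ θ'' ▷ Y =
      (α_ (X ⊗ Y) P P').inv ≫ (swapR X Y P ≫ θ ▷ Y) ▷ P' ≫ swapR X' Y P' ≫ θ' ▷ Y := by
  have h' := swapR_natural (𝟙 X) (𝟙 Y) c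
  have h₂ := swapR_natural θ (𝟙 Y) (𝟙 P')
  simp only [MonoidalCategory.id_tensorHom, MonoidalCategory.tensorHom_id, id_whiskerRight] at h' h₂
  rw [reassoc_of% h', ← comp_whiskerRight, h, comp_whiskerRight, comp_whiskerRight,
    comp_whiskerRight, Category.assoc, reassoc_of% h₂]
  simp [swapR, BraidedCategory.braiding_tensor_right_hom]

lemma assoc_comp {X Y Y' Y'' P P' P'' : V} {c : P ⊗ P' ⟶ P''} {θ : Y ⊗ P ⟶ Y'}
    {θ' : Y' ⊗ P' ⟶ Y''} {θ'' : Y ⊗ P'' ⟶ Y''}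
    (h : Y ◁ c ≫ θ'' = (α_ Y P P').inv ≫ θ ▷ P' ≫ θ') :
    (X ⊗ Y) ◁ c ≫ (α_ X Y P'').hom ≫ X ◁ θ'' =
      (α_ (X ⊗ Y) P P').inv ≫ ((α_ X Y P).hom ≫ X ◁ θ) ▷ P' ≫ (α_ X Y' P').hom ≫ X ◁ θ' := by
  rw [associator_naturality_right_assoc, ← MonoidalCategory.whiskerLeft_comp, h]
  simp

lemma swapR_assoc_exchange {X X' Y Y' P Q : V} (θ : X ⊗ P ⟶ X') (φ : Y ⊗ Q ⟶ Y') :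
    (swapR X Y P ≫ θ ▷ Y) ▷ Q ≫ (α_ X' Y Q).hom ≫ X' ◁ φ =
      swapR (X ⊗ Y) P Q ≫ ((α_ X Y Q).hom ≫ X ◁ φ) ▷ P ≫ swapR X Y' P ≫ θ ▷ Y' :=
  weighted_coh₄ θ φ

end Coherence

section WeightedMaps

variable {V : Type u} [Category.{v} V] [MonoidalCategory V] [SymmetricCategory V]
  [MonoidalClosed V]
variable {K : Type v} [EnrichedCategory V K] [HasColimits V]

lemma w_hom_ext {W : EnrichedFunctor V K V} {M : EnrichedFunctor V Kᵒᵖ V} {P Z : V}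
    {f g : coend (weighted W M) ⊗ P ⟶ Z} (h : ∀ k, wι W M k ▷ P ≫ f = wι W M k ▷ P ≫ g) : f = g :=
  coend_whisker_hom_ext _ h

lemma w_hom_ext₂ {W : EnrichedFunctor V K V} {M : EnrichedFunctor V Kᵒᵖ V} {P P' Z : V}
    {f g : (coend (weighted W M) ⊗ P) ⊗ P' ⟶ Z}
    (h : ∀ k, wι W M k ▷ P ▷ P' ≫ f = wι W M k ▷ P ▷ P' ≫ g) : f = g := by
  rw [← cancel_epi (α_ _ P P').inv]
  apply w_hom_ext
  intro k
  rw [associator_inv_naturality_left_assoc, associator_inv_naturality_left_assoc, h k]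

lemma weightedMapLeft_unit {W : EnrichedFunctor V K V} (M : EnrichedFunctor V Kᵒᵖ V) {P : V}
    (i : 𝟙_ V ⟶ P) (θ : ∀ k, W.obj k ⊗ P ⟶ W.obj k) (hθ)
    (h : ∀ k, W.obj k ◁ i ≫ θ k = (ρ_ _).hom) :
    coend (weighted W M) ◁ i ≫ weightedMapLeft M θ hθ = (ρ_ _).hom := by
  apply w_hom_ext
  intro k
  rw [← whisker_exchange_assoc, weightedMapLeft_ι, rightUnitor_naturality, ← Category.assoc]
  exact congrArg (· ≫ _) (swapR_unit (h k))

lemma weightedMapRight_unit (W : EnrichedFunctor V K V) {M : EnrichedFunctor V Kᵒᵖ V} {P : V}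
    (i : 𝟙_ V ⟶ P) (θ : ∀ k, M.obj (op k) ⊗ P ⟶ M.obj (op k)) (hθ)
    (h : ∀ k, M.obj (op k) ◁ i ≫ θ k = (ρ_ _).hom) :
    coend (weighted W M) ◁ i ≫ weightedMapRight W θ hθ = (ρ_ _).hom := by
  apply w_hom_ext
  intro k
  rw [← whisker_exchange_assoc, weightedMapRight_ι, rightUnitor_naturality, ← Category.assoc]
  exact congrArg (· ≫ _) (assoc_unit (h k))

lemma weightedMapLeft_comp {W W' W'' : EnrichedFunctor V K V} (M : EnrichedFunctor V Kᵒᵖ V)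
    {P P' P'' : V} (c : P ⊗ P' ⟶ P'') (θ : ∀ k, W.obj k ⊗ P ⟶ W'.obj k)
    (θ' : ∀ k, W'.obj k ⊗ P' ⟶ W''.obj k) (θ'' : ∀ k, W.obj k ⊗ P'' ⟶ W''.obj k) (hθ hθ' hθ'')
    (h : ∀ k, W.obj k ◁ c ≫ θ'' k = (α_ _ P P').inv ≫ θ k ▷ P' ≫ θ' k) :
    coend (weighted W M) ◁ c ≫ weightedMapLeft M θ'' hθ'' =
      (α_ _ P P').inv ≫ weightedMapLeft M θ hθ ▷ P' ≫ weightedMapLeft M θ' hθ' := by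
  apply w_hom_ext
  intro k
  rw [← whisker_exchange_assoc, weightedMapLeft_ι, associator_inv_naturality_left_assoc,
    ← comp_whiskerRight_assoc, weightedMapLeft_ι, comp_whiskerRight_assoc, weightedMapLeft_ι]
  have e := congrArg (· ≫ wι W'' M k) (swapR_comp (Y := M.obj (op k)) (h k))
  simp only [Category.assoc] at e ⊢
  exact e

lemma weightedMapRight_comp (W : EnrichedFunctor V K V) {M M' M'' : EnrichedFunctor V Kᵒᵖ V}
    {P P' P'' : V} (c : P ⊗ P' ⟶ P'') (θ : ∀ k, M.obj (op k) ⊗ P ⟶ M'.obj (op k))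
    (θ' : ∀ k, M'.obj (op k) ⊗ P' ⟶ M''.obj (op k))
    (θ'' : ∀ k, M.obj (op k) ⊗ P'' ⟶ M''.obj (op k)) (hθ hθ' hθ'')
    (h : ∀ k, M.obj (op k) ◁ c ≫ θ'' k = (α_ _ P P').inv ≫ θ k ▷ P' ≫ θ' k) :
    coend (weighted W M) ◁ c ≫ weightedMapRight W θ'' hθ'' =
      (α_ _ P P').inv ≫ weightedMapRight W θ hθ ▷ P' ≫ weightedMapRight W θ' hθ' := by
  apply w_hom_ext
  intro k
  rw [← whisker_exchange_assoc, weightedMapRight_ι, associator_inv_naturality_left_assoc,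
    ← comp_whiskerRight_assoc, weightedMapRight_ι, comp_whiskerRight_assoc, weightedMapRight_ι]
  have e := congrArg (· ≫ wι W M'' k) (assoc_comp (X := W.obj k) (h k))
  simp only [Category.assoc] at e ⊢
  exact e

lemma weightedMap_exchange {W W' : EnrichedFunctor V K V} {M M' : EnrichedFunctor V Kᵒᵖ V}
    {P Q : V} (θ : ∀ k, W.obj k ⊗ P ⟶ W'.obj k) (φ : ∀ k, M.obj (op k) ⊗ Q ⟶ M'.obj (op k))
    (hθ hφ) :
    weightedMapLeft M θ hθ ▷ Q ≫ weightedMapRight W' φ hφ =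
      swapR _ P Q ≫ weightedMapRight W φ hφ ▷ P ≫ weightedMapLeft M' θ hθ := by
  apply w_hom_ext₂
  intro k
  have e := congrArg (· ≫ wι W' M' k) (swapR_assoc_exchange (θ k) (φ k))
  have e' := swapR_natural (wι W M k) (𝟙 P) (𝟙 Q)
  simp only [MonoidalCategory.tensorHom_id] at e'
  rw [← comp_whiskerRight_assoc, weightedMapLeft_ι, comp_whiskerRight_assoc, weightedMapRight_ι,
    reassoc_of% e', ← comp_whiskerRight_assoc, weightedMapRight_ι,
    comp_whiskerRight _ (wι W M' k), Category.assoc (_ ▷ P) (wι W M' k ▷ P), weightedMapLeft_ι]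
  simp only [Category.assoc] at e ⊢
  exact e

end WeightedMaps

section Coherence

variable {V : Type u} [Category.{v} V] [MonoidalCategory V] [SymmetricCategory V]

lemma tensorμ_exchange {X Y P P' Q Q' X₁ X₂ X₃ Y₁ Y₂ Y₃ : V}
    {a : X ⊗ P ⟶ X₁} {b : X₁ ⊗ Q ⟶ X₃} {a' : X ⊗ Q ⟶ X₂} {b' : X₂ ⊗ P ⟶ X₃}
    {c : Y ⊗ P' ⟶ Y₁} {d : Y₁ ⊗ Q' ⟶ Y₃} {c' : Y ⊗ Q' ⟶ Y₂} {d' : Y₂ ⊗ P' ⟶ Y₃}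
    (h : a ▷ Q ≫ b = swapR X P Q ≫ a' ▷ P ≫ b')
    (h' : c ▷ Q' ≫ d = swapR Y P' Q' ≫ c' ▷ P' ≫ d') :
    (tensorμ X Y P P' ≫ (a ⊗ₘ c)) ▷ (Q ⊗ Q') ≫ tensorμ X₁ Y₁ Q Q' ≫ (b ⊗ₘ d) =
      swapR (X ⊗ Y) (P ⊗ P') (Q ⊗ Q') ≫ (tensorμ X Y Q Q' ≫ (a' ⊗ₘ c')) ▷ (P ⊗ P') ≫
        tensorμ X₂ Y₂ P P' ≫ (b' ⊗ₘ d') := by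
  rw [comp_whiskerRight_assoc, tensorμ_natural_left_assoc, tensorHom_comp_tensorHom, h, h',
    comp_whiskerRight_assoc, tensorμ_natural_left_assoc, tensorHom_comp_tensorHom,
    ← tensorHom_comp_tensorHom, reassoc_of% (swapR_tensorμ X Y P P' Q Q')]

lemma tensorμ_unit {X Y P Q : V} {i : 𝟙_ V ⟶ P} {j : 𝟙_ V ⟶ Q} {a : X ⊗ P ⟶ X} {b : Y ⊗ Q ⟶ Y}
    (h : X ◁ i ≫ a = (ρ_ X).hom) (h' : Y ◁ j ≫ b = (ρ_ Y).hom) :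
    (X ⊗ Y) ◁ ((λ_ (𝟙_ V)).inv ≫ (i ⊗ₘ j)) ≫ tensorμ X Y P Q ≫ (a ⊗ₘ b) = (ρ_ (X ⊗ Y)).hom := by
  rw [MonoidalCategory.whiskerLeft_comp_assoc, tensorμ_natural_right_assoc,
    tensorHom_comp_tensorHom, h, h', tensor_right_unitality]

lemma tensorμ_comp {X Y P P' P'' Q Q' Q'' X₁ X₂ Y₁ Y₂ : V}
    {c : P ⊗ P' ⟶ P''} {d : Q ⊗ Q' ⟶ Q''}
    {a : X ⊗ P ⟶ X₁} {a' : X₁ ⊗ P' ⟶ X₂} {a'' : X ⊗ P'' ⟶ X₂}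
    {b : Y ⊗ Q ⟶ Y₁} {b' : Y₁ ⊗ Q' ⟶ Y₂} {b'' : Y ⊗ Q'' ⟶ Y₂}
    (h : X ◁ c ≫ a'' = (α_ X P P').inv ≫ a ▷ P' ≫ a')
    (h' : Y ◁ d ≫ b'' = (α_ Y Q Q').inv ≫ b ▷ Q' ≫ b') :
    (X ⊗ Y) ◁ (tensorμ P Q P' Q' ≫ (c ⊗ₘ d)) ≫ tensorμ X Y P'' Q'' ≫ (a'' ⊗ₘ b'') =
      (α_ _ (P ⊗ Q) (P' ⊗ Q')).inv ≫ (tensorμ X Y P Q ≫ (a ⊗ₘ b)) ▷ (P' ⊗ Q') ≫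
        tensorμ X₁ Y₁ P' Q' ≫ (a' ⊗ₘ b') := by
  rw [MonoidalCategory.whiskerLeft_comp_assoc, tensorμ_natural_right_assoc,
    tensorHom_comp_tensorHom, h, h', Iso.eq_inv_comp, comp_whiskerRight_assoc,
    tensorμ_natural_left_assoc, ← tensorHom_comp_tensorHom, ← tensor_associativity_assoc,
    tensorHom_comp_tensorHom_assoc, Iso.hom_inv_id, Iso.hom_inv_id]
  simp

end Coherence

section DayTensor

variable {V : Type u} [Category.{v} V] [MonoidalCategory V] [SymmetricCategory V]
  [MonoidalClosed V]

lemma ev_pair {X Y Z U₁ U₂ : V} (a : U₁ ⟶ hom V X Y) (b : U₂ ⟶ hom V Y Z) :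
    X ◁ ((a ⊗ₘ b) ≫ eComp V X Y Z) ≫ ev X Z =
      (α_ X U₁ U₂).inv ≫ (X ◁ a ≫ ev X Y) ▷ U₂ ≫ Y ◁ b ≫ ev Y Z := by
  rw [MonoidalCategory.whiskerLeft_comp_assoc, ev_comp, MonoidalCategory.tensorHom_def,
    MonoidalCategory.whiskerLeft_comp_assoc, associator_inv_naturality_right_assoc,
    whisker_exchange_assoc, associator_inv_naturality_middle_assoc, comp_whiskerRight_assoc]

lemma isNat_act {C : Type w} [EnrichedCategory V C] {F G : EnrichedFunctor V C V} {P : V}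
    {f : ∀ X, P ⟶ hom V (F.obj X) (G.obj X)} :
    IsNat F G f ↔ ∀ X Y, act F X Y ▷ P ≫ F.obj Y ◁ f Y ≫ ev (F.obj Y) (G.obj Y) =
      swapR (F.obj X) (hom V X Y) P ≫ (F.obj X ◁ f X ≫ ev (F.obj X) (G.obj X)) ▷ hom V X Y ≫
        act G X Y := by
  have h : ∀ X Y, ((F.map X Y ⊗ₘ f Y) ≫ eComp V (F.obj X) (F.obj Y) (G.obj Y) =
      (β_ (hom V X Y) P).hom ≫ (f X ⊗ₘ G.map X Y) ≫ eComp V (F.obj X) (G.obj X) (G.obj Y)) ↔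
      (act F X Y ▷ P ≫ F.obj Y ◁ f Y ≫ ev (F.obj Y) (G.obj Y) =
      swapR (F.obj X) (hom V X Y) P ≫ (F.obj X ◁ f X ≫ ev (F.obj X) (G.obj X)) ▷ hom V X Y ≫
        act G X Y) := by
    intro X Y
    rw [swapR, Category.assoc, Category.assoc]
    refine Iff.trans ?_ (Iso.inv_comp_eq _)
    have e1 := ev_pair (F.map X Y) (f Y)
    have e2 := ev_pair (f X) (G.map X Y)
    have e3 : F.obj X ◁ ((β_ (hom V X Y) P).hom ≫ (f X ⊗ₘ G.map X Y) ≫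
        eComp V (F.obj X) (G.obj X) (G.obj Y)) ≫ ev (F.obj X) (G.obj Y) =
        F.obj X ◁ (β_ (hom V X Y) P).hom ≫ (α_ (F.obj X) P (hom V X Y)).inv ≫
          (F.obj X ◁ f X ≫ ev (F.obj X) (G.obj X)) ▷ hom V X Y ≫ act G X Y :=
      (MonoidalCategory.whiskerLeft_comp_assoc _ _ _ _).trans (congrArg (_ ≫ ·) e2)
    constructor
    · intro h
      exact e1.symm.trans ((congrArg (fun m => F.obj X ◁ m ≫ ev (F.obj X) (G.obj Y)) h).trans e3)
    · intro h
      apply self_hom_ext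
      exact e1.trans (h.trans e3.symm)
  exact forall₂_congr h

variable {A : Type v} [EnrichedCategory V A] (tA : EnrichedFunctor V (A × A) A)

/-- Evaluation `F X ⊗ [C, V](F, G) ⟶ G X`. -/
def evN [HasLimits V] {C : Type v} [EnrichedCategory V C] (F G : EnrichedFunctor V C V) (X : C) :
    F.obj X ⊗ hom V F G ⟶ G.obj X :=
  F.obj X ◁ natπ F G X ≫ ev (F.obj X) (G.obj X)

lemma evN_natural [HasLimits V] {C : Type v} [EnrichedCategory V C]
    (F G : EnrichedFunctor V C V) (X Y : C) :
    act F X Y ▷ hom V F G ≫ evN F G Y =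
      swapR (F.obj X) (hom V X Y) (hom V F G) ≫ evN F G X ▷ hom V X Y ≫ act G X Y :=
  isNat_act.1 (natπ_isNat F G) X Y

lemma act_yonedaObj (X : A) (C C' : Aᵒᵖ) : act (yonedaObj X) C C' =
    (β_ (hom V C.unop X) (hom V C'.unop C.unop)).hom ≫ eComp V C'.unop C.unop X :=
  lam_ev (eComp V (op X) C C')

lemma dayPre_id (C : Aᵒᵖ) (k : A × A) :
    (dayWeight tA C).obj k ◁ eId V C ≫ dayPre tA C C k = (ρ_ _).hom := by
  have h := act_id (yonedaObj (V := V) (tA.obj k)) C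
  rw [act_yonedaObj] at h
  exact h

lemma dayPre_comp (C C' C'' : Aᵒᵖ) (k : A × A) :
    (dayWeight tA C).obj k ◁ eComp V C C' C'' ≫ dayPre tA C C'' k =
      (α_ _ (hom V C C') (hom V C' C'')).inv ≫ dayPre tA C C' k ▷ hom V C' C'' ≫
        dayPre tA C' C'' k := by
  have h := act_comp (yonedaObj (V := V) (tA.obj k)) C C' C''
  rw [act_yonedaObj, act_yonedaObj, act_yonedaObj] at h
  exact h

variable [HasColimits V]

/-- The Day tensor `(F ⊗ G)(C) = ∫^{(X, Y)} A(C, X ⊗ Y) ⊗ (F X ⊗ G Y)` of two presheaves. -/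
def dayObj (F G : EnrichedFunctor V Aᵒᵖ V) : EnrichedFunctor V Aᵒᵖ V :=
  ofAct (fun C => coend (dayIntegrand tA F G C))
    (fun C C' => weightedMapLeft (dayArg F G) (dayPre tA C C') (dayPre_natural tA C C'))
    (fun C => by
      exact weightedMapLeft_unit (dayArg F G) (eId V C) (dayPre tA C C) _
        (fun k => dayPre_id tA C k))
    (fun C C' C'' => by
      exact weightedMapLeft_comp (dayArg F G) (eComp V C C' C'') (dayPre tA C C')
        (dayPre tA C' C'') (dayPre tA C C'') _ _ _ (fun k => dayPre_comp tA C C' C'' k))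

lemma act_dayObj (F G : EnrichedFunctor V Aᵒᵖ V) (C C' : Aᵒᵖ) :
    act (dayObj tA F G) C C' =
      weightedMapLeft (dayArg F G) (dayPre tA C C') (dayPre_natural tA C C') :=
  act_ofAct _ _ _ _ _ _

variable [HasLimits V]

/-- The map `(F X ⊗ G Y) ⊗ ([Aᵒᵖ, V](F, F') ⊗ [Aᵒᵖ, V](G, G')) ⟶ F' X ⊗ G' Y`. -/
def dayArgMap (F F' G G' : EnrichedFunctor V Aᵒᵖ V) (k : A × A) :
    (dayArg F G).obj (op k) ⊗ (hom V F F' ⊗ hom V G G') ⟶ (dayArg F' G').obj (op k) :=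
  tensorμ (F.obj (op k.1)) (G.obj (op k.2)) (hom V F F') (hom V G G') ≫
    (evN F F' (op k.1) ⊗ₘ evN G G' (op k.2))

lemma dayArgMap_natural (F F' G G' : EnrichedFunctor V Aᵒᵖ V) (k l : A × A) :
    act (dayArg F G) (op l) (op k) ▷ (hom V F F' ⊗ hom V G G') ≫ dayArgMap F F' G G' k =
      swapR ((dayArg F G).obj (op l)) (hom V k l) (hom V F F' ⊗ hom V G G') ≫
        dayArgMap F F' G G' l ▷ hom V k l ≫ act (dayArg F' G') (op l) (op k) := by
  rw [act_dayArg, act_dayArg]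
  exact tensorμ_exchange (evN_natural F F' (op l.1) (op k.1))
    (evN_natural G G' (op l.2) (op k.2))

lemma evN_id (F : EnrichedFunctor V Aᵒᵖ V) (X : Aᵒᵖ) :
    F.obj X ◁ eId V F ≫ evN F F X = (ρ_ _).hom := by
  rw [evN, ← MonoidalCategory.whiskerLeft_comp_assoc, nat_eId_π, ev_id]

lemma evN_comp (F G H : EnrichedFunctor V Aᵒᵖ V) (X : Aᵒᵖ) :
    F.obj X ◁ eComp V F G H ≫ evN F H X =
      (α_ _ (hom V F G) (hom V G H)).inv ≫ evN F G X ▷ hom V G H ≫ evN G H X := by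
  rw [evN, ← MonoidalCategory.whiskerLeft_comp_assoc, nat_eComp_π]
  exact ev_pair _ _

/-- The map `(F ⊗ G)(C) ⊗ ([Aᵒᵖ, V](F, F') ⊗ [Aᵒᵖ, V](G, G')) ⟶ (F' ⊗ G')(C)`. -/
def dayMapAt (F F' G G' : EnrichedFunctor V Aᵒᵖ V) (C : Aᵒᵖ) :
    (dayObj tA F G).obj C ⊗ (hom V F F' ⊗ hom V G G') ⟶ (dayObj tA F' G').obj C :=
  weightedMapRight (dayWeight tA C) (dayArgMap F F' G G') (dayArgMap_natural F F' G G')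

/-- The Day tensor as a `V`-functor `[Aᵒᵖ, V] ⊗ [Aᵒᵖ, V] ⟶ [Aᵒᵖ, V]`. -/
def dayTensor : EnrichedFunctor V (EnrichedFunctor V Aᵒᵖ V × EnrichedFunctor V Aᵒᵖ V)
    (EnrichedFunctor V Aᵒᵖ V) where
  obj P := dayObj tA P.1 P.2
  map P Q := natLift (dayObj tA P.1 P.2) (dayObj tA Q.1 Q.2)
    (fun C => lam (dayMapAt tA P.1 Q.1 P.2 Q.2 C)) (by
      rw [isNat_act]
      intro C C'
      rw [lam_ev, lam_ev, act_dayObj, act_dayObj]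
      exact weightedMap_exchange _ _ _ _)
  map_id P := by
    apply nat_hom_ext
    intro C
    rw [Category.assoc, natLift_π, nat_eId_π]
    apply self_hom_ext
    rw [MonoidalCategory.whiskerLeft_comp_assoc, lam_ev, ev_id]
    exact weightedMapRight_unit _ (eId V P) _ _
      (fun k => tensorμ_unit (evN_id P.1 (op k.1)) (evN_id P.2 (op k.2)))
  map_comp P Q R := by
    apply nat_hom_ext
    intro C
    rw [Category.assoc, natLift_π, Category.assoc, nat_eComp_π, tensorHom_comp_tensorHom_assoc,
      natLift_π, natLift_π]
    apply self_hom_ext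
    rw [MonoidalCategory.whiskerLeft_comp_assoc, lam_ev, ev_pair, lam_ev, lam_ev]
    exact weightedMapRight_comp _ (eComp V P Q R) (dayArgMap P.1 Q.1 P.2 Q.2)
      (dayArgMap Q.1 R.1 Q.2 R.2) _ _ _ _
      (fun k => tensorμ_comp (evN_comp P.1 Q.1 R.1 (op k.1)) (evN_comp P.2 Q.2 R.2 (op k.2)))

end DayTensor

section MonoidalVCategories

variable {V : Type u} [Category.{v} V] [MonoidalCategory V] [SymmetricCategory V]
variable {C : Type w₁} {D : Type w₂} {E : Type w₃}
  [EnrichedCategory V C] [EnrichedCategory V D] [EnrichedCategory V E]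

variable (V C D E) in
/-- The associativity `V`-functor `(C ⊗ D) ⊗ E ⟶ C ⊗ (D ⊗ E)`. -/
@[simps]
def prodAssoc : EnrichedFunctor V ((C × D) × E) (C × (D × E)) where
  obj X := (X.1.1, (X.1.2, X.2))
  map X Y := (α_ (hom V X.1.1 Y.1.1) (hom V X.1.2 Y.1.2) (hom V X.2 Y.2)).hom
  map_id X := by
    rw [prod_eId, prod_eId, prod_eId, prod_eId]
    simp only [MonoidalCategory.tensorHom_def]
    monoidal
  map_comp X Y Z := by
    have h := associator_monoidal (hom V X.1.1 Y.1.1) (hom V X.1.2 Y.1.2) (hom V X.2 Y.2)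
      (hom V Y.1.1 Z.1.1) (hom V Y.1.2 Z.1.2) (hom V Y.2 Z.2)
    rw [prod_eComp, prod_eComp, prod_eComp, prod_eComp]
    have h1 : ∀ {P Q R U U' : V} (m : P ⟶ Q) (c₁ : Q ⟶ U) (c₂ : R ⟶ U'),
        ((m ≫ c₁) ⊗ₘ c₂) = m ▷ R ≫ (c₁ ⊗ₘ c₂) := by
      intros; rw [← MonoidalCategory.tensorHom_id, tensorHom_comp_tensorHom, Category.id_comp]
    have h2 : ∀ {P Q R U U' : V} (m : P ⟶ Q) (c₁ : R ⟶ U) (c₂ : Q ⟶ U'),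
        (c₁ ⊗ₘ (m ≫ c₂)) = R ◁ m ≫ (c₁ ⊗ₘ c₂) := by
      intros; rw [← id_tensorHom, tensorHom_comp_tensorHom, Category.id_comp]
    rw [h1, h2, Category.assoc, Category.assoc, associator_naturality]
    have h3 := congrArg (· ≫ (eComp V X.1.1 Y.1.1 Z.1.1 ⊗ₘ
      (eComp V X.1.2 Y.1.2 Z.1.2 ⊗ₘ eComp V X.2 Y.2 Z.2))) h
    simp only [Category.assoc] at h3
    exact h3

lemma insert_id {P Q : V} (e : 𝟙_ V ⟶ P) (f : 𝟙_ V ⟶ Q) :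
    f ≫ (λ_ Q).inv ≫ e ▷ Q = (λ_ (𝟙_ V)).inv ≫ (e ⊗ₘ f) := by
  rw [leftUnitor_inv_naturality_assoc, MonoidalCategory.tensorHom_def']

lemma insert_comp {P Q Q' Q'' : V} (e : 𝟙_ V ⟶ P) (c : P ⊗ P ⟶ P) (d : Q ⊗ Q' ⟶ Q'')
    (h : e ▷ P ≫ c = (λ_ P).hom) :
    d ≫ (λ_ Q'').inv ≫ e ▷ Q'' =
      ((λ_ Q).inv ≫ e ▷ Q ⊗ₘ (λ_ Q').inv ≫ e ▷ Q') ≫ tensorμ P Q P Q' ≫ (c ⊗ₘ d) := by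
  have h3 : (e ⊗ₘ e) ≫ c = (λ_ (𝟙_ V)).hom ≫ e := by
    rw [MonoidalCategory.tensorHom_def', Category.assoc, h, leftUnitor_naturality]
  have h4 := tensorμ_natural e (𝟙 Q) e (𝟙 Q')
  rw [MonoidalCategory.tensorHom_id, MonoidalCategory.tensorHom_id, id_tensorHom_id] at h4
  have h5 := leftUnitor_monoidal Q Q'
  have h6 : tensorμ (𝟙_ V) Q (𝟙_ V) Q' ≫ (λ_ (𝟙_ V)).hom ▷ (Q ⊗ Q') =
      ((λ_ Q).hom ⊗ₘ (λ_ Q').hom) ≫ (λ_ (Q ⊗ Q')).inv := by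
    rw [h5]; simp
  rw [← tensorHom_comp_tensorHom, Category.assoc, reassoc_of% h4,
    tensorHom_comp_tensorHom, h3, Category.id_comp,
    MonoidalCategory.tensorHom_def (_ ≫ e) d, comp_whiskerRight_assoc, reassoc_of% h6, tensorHom_comp_tensorHom_assoc, Iso.inv_hom_id,
    Iso.inv_hom_id, id_tensorHom_id, Category.id_comp, ← whisker_exchange,
    leftUnitor_inv_naturality_assoc]

/-- The `V`-functor `(I, -) : C ⟶ D ⊗ C`. -/
@[simps]
def insertLeft (I : D) : EnrichedFunctor V C (D × C) where
  obj X := (I, X)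
  map X Y := (λ_ (hom V X Y)).inv ≫ eId V I ▷ hom V X Y
  map_id X := insert_id _ _
  map_comp X Y Z := insert_comp _ _ _ (by
    have h1 := e_id_comp V I I
    rwa [Iso.inv_comp_eq, Category.comp_id] at h1)

/-- The `V`-functor `(-, I) : C ⟶ C ⊗ D`. -/
def insertRight (I : D) : EnrichedFunctor V C (C × D) :=
  (insertLeft (V := V) I).comp V (prodSwap V D C)

variable (V) in
/-- A map `X ⟶ Y` in (the underlying category of) a `V`-category. -/
abbrev Mor (X Y : C) := 𝟙_ V ⟶ hom V X Y

/-- Composition `g ∘ f` of maps in a `V`-category. -/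
def mcomp {X Y Z : C} (f : Mor V X Y) (g : Mor V Y Z) : Mor V X Z :=
  (λ_ (𝟙_ V)).inv ≫ (f ⊗ₘ g) ≫ eComp V X Y Z

/-- The map `F f : F X ⟶ F Y` for a map `f : X ⟶ Y` in a `V`-category. -/
def mmap (F : EnrichedFunctor V C D) {X Y : C} (f : Mor V X Y) : Mor V (F.obj X) (F.obj Y) :=
  f ≫ F.map X Y

/-- The map `f ⊗ g : X ⊗ Y ⟶ X' ⊗ Y'` for maps `f : X ⟶ X'` and `g : Y ⟶ Y'`. -/
def mtensor (tensor : EnrichedFunctor V (C × C) C) {X X' Y Y' : C} (f : Mor V X X')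
    (g : Mor V Y Y') : Mor V (tensor.obj (X, Y)) (tensor.obj (X', Y')) :=
  (λ_ (𝟙_ V)).inv ≫ (f ⊗ₘ g) ≫ tensor.map (X, Y) (X', Y')

/-- A map in a `V`-category is an isomorphism. -/
def MIsIso {X Y : C} (f : Mor V X Y) : Prop :=
  ∃ g : Mor V Y X, mcomp f g = eId V X ∧ mcomp g f = eId V Y

/-- The structure maps of a symmetric monoidal `V`-category with the given tensor product
(a `V`-functor `C ⊗ C ⟶ C`) and tensor unit. -/
structure MonoidalData (tensor : EnrichedFunctor V (C × C) C) (unit : C) where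
  assoc (X Y Z : C) :
    Mor V (tensor.obj (tensor.obj (X, Y), Z)) (tensor.obj (X, tensor.obj (Y, Z)))
  leftUnitor (X : C) : Mor V (tensor.obj (unit, X)) X
  rightUnitor (X : C) : Mor V (tensor.obj (X, unit)) X
  braiding (X Y : C) : Mor V (tensor.obj (X, Y)) (tensor.obj (Y, X))

variable [MonoidalClosed V]

/-- The structure maps are `V`-natural isomorphisms that satisfy the coherence axioms of a
symmetric monoidal category. -/
structure IsSymmetricMonoidal {tensor : EnrichedFunctor V (C × C) C} {unit : C}
    (S : MonoidalData tensor unit) : Prop where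
  assoc_iso (X Y Z : C) : MIsIso (S.assoc X Y Z)
  leftUnitor_iso (X : C) : MIsIso (S.leftUnitor X)
  rightUnitor_iso (X : C) : MIsIso (S.rightUnitor X)
  assoc_nat : IsNat ((prodMap tensor (EnrichedFunctor.id V C)).comp V tensor)
    ((prodAssoc V C C C).comp V ((prodMap (EnrichedFunctor.id V C) tensor).comp V tensor))
    (fun X => S.assoc X.1.1 X.1.2 X.2)
  leftUnitor_nat : IsNat ((insertLeft unit).comp V tensor) (EnrichedFunctor.id V C) S.leftUnitor
  rightUnitor_nat :
    IsNat ((insertRight unit).comp V tensor) (EnrichedFunctor.id V C) S.rightUnitor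
  braiding_nat : IsNat tensor ((prodSwap V C C).comp V tensor) (fun X => S.braiding X.1 X.2)
  pentagon (W X Y Z : C) :
    mcomp (mtensor tensor (S.assoc W X Y) (eId V Z))
        (mcomp (S.assoc W (tensor.obj (X, Y)) Z) (mtensor tensor (eId V W) (S.assoc X Y Z))) =
      mcomp (S.assoc (tensor.obj (W, X)) Y Z) (S.assoc W X (tensor.obj (Y, Z)))
  triangle (X Y : C) :
    mcomp (S.assoc X unit Y) (mtensor tensor (eId V X) (S.leftUnitor Y)) =
      mtensor tensor (S.rightUnitor X) (eId V Y)
  hexagon (X Y Z : C) :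
    mcomp (S.assoc X Y Z) (mcomp (S.braiding X (tensor.obj (Y, Z))) (S.assoc Y Z X)) =
      mcomp (mtensor tensor (S.braiding X Y) (eId V Z))
        (mcomp (S.assoc Y X Z) (mtensor tensor (eId V Y) (S.braiding X Z)))
  symmetry (X Y : C) : mcomp (S.braiding X Y) (S.braiding Y X) = eId V (tensor.obj (X, Y))

/-- A `V`-monad structure on a `V`-functor `T : C ⟶ C`. -/
structure EnrichedMonad (T : EnrichedFunctor V C C) where
  η (X : C) : Mor V X (T.obj X)
  μ (X : C) : Mor V (T.obj (T.obj X)) (T.obj X)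
  η_nat : IsNat (EnrichedFunctor.id V C) T η
  μ_nat : IsNat (T.comp V T) T μ
  left_unit (X : C) : mcomp (η (T.obj X)) (μ X) = eId V (T.obj X)
  right_unit (X : C) : mcomp (mmap T (η X)) (μ X) = eId V (T.obj X)
  assoc (X : C) : mcomp (mmap T (μ X)) (μ X) = mcomp (μ (T.obj X)) (μ X)

/-- A strong `V`-monad: a `V`-monad with a `V`-natural strength `X ⊗ T Y ⟶ T (X ⊗ Y)` compatible
with the unit, the multiplication, the left unitor and the associator. -/
structure StrongMonad {tensor : EnrichedFunctor V (C × C) C} {unit : C}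
    (S : MonoidalData tensor unit) (T : EnrichedFunctor V C C) extends EnrichedMonad T where
  strength (X Y : C) : Mor V (tensor.obj (X, T.obj Y)) (T.obj (tensor.obj (X, Y)))
  strength_nat : IsNat ((prodMap (EnrichedFunctor.id V C) T).comp V tensor) (tensor.comp V T)
    (fun X => strength X.1 X.2)
  strength_unit (X Y : C) :
    mcomp (mtensor tensor (eId V X) (η Y)) (strength X Y) = η (tensor.obj (X, Y))
  strength_leftUnitor (X : C) :
    mcomp (strength unit X) (mmap T (S.leftUnitor X)) = S.leftUnitor (T.obj X)
  strength_mul (X Y : C) :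
    mcomp (strength X (T.obj Y)) (mcomp (mmap T (strength X Y)) (μ (tensor.obj (X, Y)))) =
      mcomp (mtensor tensor (eId V X) (μ Y)) (strength X Y)
  strength_assoc (X Y Z : C) :
    mcomp (strength (tensor.obj (X, Y)) Z) (mmap T (S.assoc X Y Z)) =
      mcomp (S.assoc X Y (T.obj Z))
        (mcomp (mtensor tensor (eId V X) (strength Y Z)) (strength X (tensor.obj (Y, Z))))

/-- The costrength `T X ⊗ Y ⟶ T (X ⊗ Y)` obtained from the strength by the braiding. -/
def StrongMonad.costrength {tensor : EnrichedFunctor V (C × C) C} {unit : C}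
    {S : MonoidalData tensor unit} {T : EnrichedFunctor V C C} (M : StrongMonad S T) (X Y : C) :
    Mor V (tensor.obj (T.obj X, Y)) (T.obj (tensor.obj (X, Y))) :=
  mcomp (S.braiding (T.obj X) Y) (mcomp (M.strength Y X) (mmap T (S.braiding Y X)))

/-- A strong `V`-monad is commutative if the two maps `T X ⊗ T Y ⟶ T (X ⊗ Y)` agree. -/
def StrongMonad.IsCommutative {tensor : EnrichedFunctor V (C × C) C} {unit : C}
    {S : MonoidalData tensor unit} {T : EnrichedFunctor V C C} (M : StrongMonad S T) : Prop :=
  ∀ X Y : C,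
    mcomp (M.costrength X (T.obj Y))
        (mcomp (mmap T (M.strength X Y)) (M.μ (tensor.obj (X, Y)))) =
      mcomp (M.strength (T.obj X) Y)
        (mcomp (mmap T (M.costrength X Y)) (M.μ (tensor.obj (X, Y))))

/-- The map of the `V`-category `V` given by a morphism of `V`. -/
def name {X Y : V} (f : X ⟶ Y) : Mor V X Y := lam ((ρ_ X).hom ≫ f)

/-- The morphism of `V` given by a map of the `V`-category `V`. -/
def unname {X Y : V} (f : Mor V X Y) : X ⟶ Y := (ρ_ X).inv ≫ X ◁ f ≫ ev X Y

lemma unname_name {X Y : V} (f : X ⟶ Y) : unname (name f) = f := by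
  rw [unname, name, lam_ev, Iso.inv_hom_id_assoc]

lemma name_unname {X Y : V} (f : Mor V X Y) : name (unname f) = f := by
  apply self_hom_ext
  rw [name, lam_ev, unname, Iso.hom_inv_id_assoc]

/-- The action of a `V`-functor `T : V ⟶ V` on the morphisms of `V`. -/
def onHom (T : EnrichedFunctor V V V) {X Y : V} (f : X ⟶ Y) : T.obj X ⟶ T.obj Y :=
  unname (mmap T (name f))

variable (V) in
/-- The symmetric monoidal structure of `V` as a `V`-category. -/
def selfData : MonoidalData (selfTensor V) (𝟙_ V) where
  assoc X Y Z := name (α_ X Y Z).hom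
  leftUnitor X := name (λ_ X).hom
  rightUnitor X := name (ρ_ X).hom
  braiding X Y := name (β_ X Y).hom

end MonoidalVCategories

section DayData

variable {V : Type u} [Category.{v} V] [MonoidalCategory V] [SymmetricCategory V]
  [MonoidalClosed V]
variable {A : Type v} [EnrichedCategory V A]

/-- The component `F X ⟶ G X` of a map of presheaves. -/
def component [HasLimits V] {F G : EnrichedFunctor V Aᵒᵖ V} (φ : Mor V F G) (X : Aᵒᵖ) :
    F.obj X ⟶ G.obj X :=
  unname (φ ≫ natπ F G X)

/-- The map `F Y ⟶ F X` for a presheaf `F` and a map `X ⟶ Y` in `A`. -/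
def restrict (F : EnrichedFunctor V Aᵒᵖ V) {X Y : A} (f : Mor V X Y) :
    F.obj (op Y) ⟶ F.obj (op X) :=
  unname (f ≫ F.map (op Y) (op X))

variable [HasLimits V] [HasColimits V] (tensor : EnrichedFunctor V (A × A) A)

/-- The coprojection `A(C, X ⊗ Y) ⊗ (F X ⊗ G Y) ⟶ (F ⊗ G)(C)` of the Day tensor. -/
def dayCoproj (F G : EnrichedFunctor V Aᵒᵖ V) (C : Aᵒᵖ) (X Y : A) :
    hom V C.unop (tensor.obj (X, Y)) ⊗ (F.obj (op X) ⊗ G.obj (op Y)) ⟶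
      ((dayTensor tensor).obj (F, G)).obj C :=
  coendι (dayIntegrand tensor F G C) (X, Y)

/-- The universal map `F X ⊗ G Y ⟶ (F ⊗ G)(X ⊗ Y)`, the coprojection at the identity. -/
def dayι (F G : EnrichedFunctor V Aᵒᵖ V) (X Y : A) :
    F.obj (op X) ⊗ G.obj (op Y) ⟶
      ((dayTensor tensor).obj (F, G)).obj (op (tensor.obj (X, Y))) :=
  (λ_ _).inv ≫ eId V (tensor.obj (X, Y)) ▷ _ ≫
    dayCoproj tensor F G (op (tensor.obj (X, Y))) X Y

variable {tensor} {unit : A}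

/-- The structure maps of the Day tensor, with unit `A(-, I)`, are the canonical ones, induced by
those of `V` and of `A`. By the universal property of the coends these equations determine them. -/
structure IsDayData (S : MonoidalData tensor unit)
    (D : MonoidalData (dayTensor tensor) (yonedaObj unit)) : Prop where
  assoc (F G H : EnrichedFunctor V Aᵒᵖ V) (X Y Z : A) :
    dayι tensor F G X Y ▷ H.obj (op Z) ≫
        dayι tensor ((dayTensor tensor).obj (F, G)) H (tensor.obj (X, Y)) Z ≫
          component (D.assoc F G H) (op (tensor.obj (tensor.obj (X, Y), Z))) =
      (α_ (F.obj (op X)) (G.obj (op Y)) (H.obj (op Z))).hom ≫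
        F.obj (op X) ◁ dayι tensor G H Y Z ≫
          dayι tensor F ((dayTensor tensor).obj (G, H)) X (tensor.obj (Y, Z)) ≫
            restrict ((dayTensor tensor).obj (F, (dayTensor tensor).obj (G, H))) (S.assoc X Y Z)
  leftUnitor (F : EnrichedFunctor V Aᵒᵖ V) (X : A) :
    eId V unit ▷ F.obj (op X) ≫ dayι tensor (yonedaObj unit) F unit X ≫
        component (D.leftUnitor F) (op (tensor.obj (unit, X))) =
      (λ_ (F.obj (op X))).hom ≫ restrict F (S.leftUnitor X)
  rightUnitor (F : EnrichedFunctor V Aᵒᵖ V) (X : A) :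
    F.obj (op X) ◁ eId V unit ≫ dayι tensor F (yonedaObj unit) X unit ≫
        component (D.rightUnitor F) (op (tensor.obj (X, unit))) =
      (ρ_ (F.obj (op X))).hom ≫ restrict F (S.rightUnitor X)
  braiding (F G : EnrichedFunctor V Aᵒᵖ V) (X Y : A) :
    dayι tensor F G X Y ≫ component (D.braiding F G) (op (tensor.obj (X, Y))) =
      (β_ (F.obj (op X)) (G.obj (op Y))).hom ≫ dayι tensor G F Y X ≫
        restrict ((dayTensor tensor).obj (G, F)) (S.braiding X Y)

/-- `ξ : ∫^k T H(k, k) ⟶ T ∫^k H(k, k)` is the canonical map. -/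
def IsCanonical {K : Type v} [EnrichedCategory V K] (T : EnrichedFunctor V V V)
    (H : EnrichedFunctor V (Kᵒᵖ × K) V) (ξ : coend (H.comp V T) ⟶ T.obj (coend H)) : Prop :=
  ∀ k : K, coendι (H.comp V T) k ≫ ξ = onHom T (coendι H k)

/-- The map `∫ t : ∫ A(C, X ⊗ Y) ⊗ (F X ⊗ T G Y) ⟶ ∫ T (A(C, X ⊗ Y) ⊗ (F X ⊗ G Y))` induced by the
strength `(A(C, X ⊗ Y) ⊗ F X) ⊗ T G Y ⟶ T ((A(C, X ⊗ Y) ⊗ F X) ⊗ G Y)` of `T`. -/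
def IsCoendStrength {T : EnrichedFunctor V V V} (M : StrongMonad (selfData V) T)
    (F G : EnrichedFunctor V Aᵒᵖ V) (C : Aᵒᵖ)
    (τ : coend (dayIntegrand tensor F (G.comp V T) C) ⟶
      coend ((dayIntegrand tensor F G C).comp V T)) : Prop :=
  ∀ X Y : A,
    coendι (dayIntegrand tensor F (G.comp V T) C) (X, Y) ≫ τ =
      (α_ (hom V C.unop (tensor.obj (X, Y))) (F.obj (op X)) (T.obj (G.obj (op Y)))).inv ≫
        unname (M.strength (hom V C.unop (tensor.obj (X, Y)) ⊗ F.obj (op X)) (G.obj (op Y))) ≫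
          onHom T (α_ (hom V C.unop (tensor.obj (X, Y))) (F.obj (op X)) (G.obj (op Y))).hom ≫
            coendι ((dayIntegrand tensor F G C).comp V T) (X, Y)

end DayData

end DayMonad

end

open DayMonad

set_option linter.unusedSectionVars false

noncomputable section

/-! A `V`-functor into `V` is studied through its action `F X ⊗ D(X, Y) ⟶ F Y`, and maps may carry a
parameter object `P`. Hom-objects then become parameters, and enriched statements become equations
between morphisms of `V`.

The Day tensor is controlled by the maps `dayι : F X ⊗ G Y ⟶ (F ⊗ G)(X ⊗ Y)`, the coprojections at
identities. By a Yoneda argument the coprojection at any `C` is `dayι` followed by the action of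
`A(C, X ⊗ Y)` (`dayι_act`). Hence `V`-natural maps `(F ⊗ G) ⊗ P ⟶ K` correspond to `V`-natural
families `(F X ⊗ G Y) ⊗ P ⟶ K (X ⊗ Y)` (`day_natural_ext`, `dayDescR`). The braiding, associator,
left unitor and strength on presheaves are all built in this way from such families.

The laws are checked on generators. The identity of `I` generates `A(-, I)`, and tensors of
generators generate a Day tensor (`generates_yoneda`, `Generates.day`). On a tensor of generalized
elements, a structure map of the Day tensor acts by the structure map of `V` on the parameters and
by restriction along the structure map of `A` on the indices. `Carries` records such two-part
descriptions and is stable under composition, tensor and `T`. Each coherence axiom therefore splits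
into the same axiom in `V` and the same axiom in `A` (`Generates.mor_ext_of_carries`).
`V`-naturality is tested on generators as well (`isNat_of_generates`). The associator is invertible
because associator followed by braiding, performed three times, is the identity
(`assoc_braiding_cycle`).

The unit and multiplication on presheaves are pointwise. The strength is determined by `t` followed
by `T (dayι)`, and its axioms and commutativity reduce by the same splitting to those of `T`. The
map `ξ` exists because applying `T`, with the hom-object as parameter, to the coend relation shows
that the maps `T e_k` satisfy the relation for `T H`; it is unique because coprojections are jointly
epic. To identify the strength with `∫ t` followed by `ξ`, the weight `A(C, X ⊗ Y)` must pass
through `t` as if it were a mere parameter of `T`. It does, because a strength on `V` is forced by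
the enrichment: `t_{X,Y}` is `T` acting on the braiding `Y ⊗ X ⟶ X ⊗ Y` with `X` as parameter
(`str_eq`). -/

namespace DayMonad

/-! ### Actions of functors into `V` on generalized elements of hom-objects -/

section Action

variable {V : Type u} [Category.{v} V] [MonoidalCategory V] [MonoidalClosed V]
variable {D : Type w} [EnrichedCategory V D]

/-- The action of a `V`-functor to `V` on a generalized element of a hom-object. -/
def pact (F : EnrichedFunctor V D V) {X Y : D} {P : V} (t : P ⟶ hom V X Y) :
    F.obj X ⊗ P ⟶ F.obj Y :=
  F.obj X ◁ t ≫ act F X Y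

lemma pact_id (F : EnrichedFunctor V D V) (X Y : D) : pact F (𝟙 (hom V X Y)) = act F X Y := by
  simp [pact]

lemma whiskerLeft_pact (F : EnrichedFunctor V D V) {X Y : D} {P Q : V} (s : Q ⟶ P)
    (t : P ⟶ hom V X Y) : F.obj X ◁ s ≫ pact F t = pact F (s ≫ t) := by
  simp [pact]

lemma pact_eId (F : EnrichedFunctor V D V) (X : D) : pact F (eId V X) = (ρ_ _).hom :=
  act_id F X

lemma pact_comp (F : EnrichedFunctor V D V) {X Y Z : D} {P Q : V} (s : P ⟶ hom V X Y)
    (t : Q ⟶ hom V Y Z) :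
    pact F ((s ⊗ₘ t) ≫ eComp V X Y Z) = (α_ _ P Q).inv ≫ pact F s ▷ Q ≫ pact F t := by
  rw [pact, MonoidalCategory.whiskerLeft_comp_assoc, act_comp, pact, pact,
    MonoidalCategory.tensorHom_def, MonoidalCategory.whiskerLeft_comp_assoc,
    associator_inv_naturality_right_assoc, associator_inv_naturality_middle_assoc,
    whisker_exchange_assoc, comp_whiskerRight_assoc]

lemma pact_pact (F : EnrichedFunctor V D V) {X Y Z : D} {P Q : V} (s : P ⟶ hom V X Y)
    (t : Q ⟶ hom V Y Z) :
    pact F s ▷ Q ≫ pact F t = (α_ _ P Q).hom ≫ pact F ((s ⊗ₘ t) ≫ eComp V X Y Z) := by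
  rw [pact_comp, Iso.hom_inv_id_assoc]

/-- Naturality of a family of maps between `V`-functors to `V`, in terms of the actions. -/
def IsNatural (F G : EnrichedFunctor V D V) (b : ∀ X, F.obj X ⟶ G.obj X) : Prop :=
  ∀ X Y, act F X Y ≫ b Y = b X ▷ hom V X Y ≫ act G X Y

lemma IsNatural.pact {F G : EnrichedFunctor V D V} {b : ∀ X, F.obj X ⟶ G.obj X}
    (hb : IsNatural F G b) {X Y : D} {P : V} (t : P ⟶ hom V X Y) :
    pact F t ≫ b Y = b X ▷ P ≫ pact G t := by
  rw [DayMonad.pact, DayMonad.pact, Category.assoc, hb, whisker_exchange_assoc]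

lemma IsNatural.comp {F G H : EnrichedFunctor V D V} {b : ∀ X, F.obj X ⟶ G.obj X}
    {c : ∀ X, G.obj X ⟶ H.obj X} (hb : IsNatural F G b) (hc : IsNatural G H c) :
    IsNatural F H (fun X => b X ≫ c X) := by
  intro X Y
  rw [← Category.assoc, hb, Category.assoc, hc, comp_whiskerRight_assoc]

lemma isNatural_id (F : EnrichedFunctor V D V) : IsNatural F F (fun X => 𝟙 (F.obj X)) := by
  intro X Y
  simp

lemma IsNatural.inv {F G : EnrichedFunctor V D V} {b : ∀ X, F.obj X ⟶ G.obj X}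
    (hb : IsNatural F G b) {c : ∀ X, G.obj X ⟶ F.obj X} (h₁ : ∀ X, b X ≫ c X = 𝟙 _)
    (h₂ : ∀ X, c X ≫ b X = 𝟙 _) : IsNatural G F c := by
  intro X Y
  have h := hb X Y
  calc act G X Y ≫ c Y = (c X ≫ b X) ▷ _ ≫ act G X Y ≫ c Y := by rw [h₂]; simp
    _ = c X ▷ _ ≫ (act F X Y ≫ b Y) ≫ c Y := by rw [h]; simp
    _ = _ := by rw [Category.assoc, h₁, Category.comp_id]

lemma act_comp' {C : Type w₁} [EnrichedCategory V C] (J : EnrichedFunctor V C D)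
    (F : EnrichedFunctor V D V) (X Y : C) : act (J.comp V F) X Y = pact F (J.map X Y) :=
  (congrArg (· ≫ _) (MonoidalCategory.whiskerLeft_comp _ _ _)).trans (Category.assoc _ _ _)

lemma pact_functor_comp {C : Type w₁} [EnrichedCategory V C] (J : EnrichedFunctor V C D)
    (F : EnrichedFunctor V D V) {X Y : C} {P : V} (t : P ⟶ hom V X Y) :
    pact (J.comp V F) t = pact F (t ≫ J.map X Y) := by
  rw [pact, act_comp']
  exact whiskerLeft_pact F t (J.map X Y)

lemma IsNatural.precomp {C : Type w₁} [EnrichedCategory V C] {F G : EnrichedFunctor V D V}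
    {b : ∀ X, F.obj X ⟶ G.obj X} (hb : IsNatural F G b) (J : EnrichedFunctor V C D) :
    IsNatural (J.comp V F) (J.comp V G) (fun X => b (J.obj X)) := by
  intro X Y
  rw [act_comp', act_comp']
  exact hb.pact _

end Action

/-! ### Morphisms of `V` as unit elements of the internal hom -/

section Unname

variable {V : Type u} [Category.{v} V] [MonoidalCategory V] [SymmetricCategory V]
  [MonoidalClosed V]

lemma ev_unname {X Y : V} (f : Mor V X Y) : X ◁ f ≫ ev X Y = (ρ_ X).hom ≫ unname f := by
  simp [unname]

lemma unname_inj {X Y : V} {f g : Mor V X Y} (h : unname f = unname g) : f = g := by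
  rw [← name_unname f, h, name_unname]

lemma unname_mcomp {X Y Z : V} (f : Mor V X Y) (g : Mor V Y Z) :
    unname (mcomp f g) = unname f ≫ unname g := by
  have h := ev_pair f g
  rw [unname, mcomp, MonoidalCategory.whiskerLeft_comp_assoc, h, ev_unname, ev_unname]
  simp [unname]

lemma unname_eId (X : V) : unname (eId V X) = 𝟙 X := by
  rw [unname, ev_id, Iso.inv_hom_id]

lemma pact_eq_ev {D : Type w} [EnrichedCategory V D] (F : EnrichedFunctor V D V) {X Y : D} {P : V}
    (t : P ⟶ hom V X Y) : pact F t = F.obj X ◁ (t ≫ F.map X Y) ≫ ev (F.obj X) (F.obj Y) := by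
  rw [MonoidalCategory.whiskerLeft_comp_assoc]
  rfl

lemma unname_map {D : Type w} [EnrichedCategory V D] (F : EnrichedFunctor V D V) {X Y : D}
    (t : Mor V X Y) : unname (t ≫ F.map X Y) = (ρ_ _).inv ≫ pact F t := by
  rw [pact_eq_ev]
  rfl

end Unname

/-! ### Functors `V ⟶ V` acting on parametrized morphisms -/

section MapAct

variable {V : Type u} [Category.{v} V] [MonoidalCategory V] [SymmetricCategory V]
  [MonoidalClosed V]
variable (T : EnrichedFunctor V V V)

/-- The action of a `V`-functor `T : V ⟶ V` on a parametrized map `X ⊗ P ⟶ Y`. -/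
def mapAct {X P Y : V} (h : X ⊗ P ⟶ Y) : T.obj X ⊗ P ⟶ T.obj Y :=
  pact T (lam h)

lemma pact_eq_mapAct {X Y P : V} (t : P ⟶ hom V X Y) :
    pact T t = mapAct T (X ◁ t ≫ ev X Y) := by
  rw [mapAct]
  congr 1
  apply self_hom_ext
  rw [lam_ev]

lemma mapAct_whiskerLeft {X P Q Y : V} (s : Q ⟶ P) (h : X ⊗ P ⟶ Y) :
    mapAct T (X ◁ s ≫ h) = T.obj X ◁ s ≫ mapAct T h := by
  rw [mapAct, mapAct, whiskerLeft_pact, lam_natural]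

/-- Parametrized maps compose by tensoring their parameters, and this composition is the one of the
internal hom; so the claim is functoriality of `T` on transposes. -/
lemma mapAct_comp {X P Q Y Z : V} (h : X ⊗ P ⟶ Y) (k : Y ⊗ Q ⟶ Z) :
    mapAct T ((α_ X P Q).inv ≫ h ▷ Q ≫ k) =
      (α_ (T.obj X) P Q).inv ≫ mapAct T h ▷ Q ≫ mapAct T k := by
  rw [mapAct, mapAct, mapAct, ← pact_comp]
  congr 1
  apply self_hom_ext
  rw [ev_pair, lam_ev, lam_ev, lam_ev]

/-- A trivial parameter turns the parametrized action into the ordinary one, so facts about `onHom`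
are read off from facts about `mapAct`. -/
lemma mapAct_rightUnitor {X Y : V} (f : X ⟶ Y) :
    mapAct T ((ρ_ X).hom ≫ f) = (ρ_ (T.obj X)).hom ≫ onHom T f := by
  rw [onHom, unname, Iso.hom_inv_id_assoc, mmap, MonoidalCategory.whiskerLeft_comp_assoc]
  rfl

/-- The case of `mapAct_comp` in which the second parameter is the unit object; the unitors cancel.
-/
lemma mapAct_post {X P Y Z : V} (h : X ⊗ P ⟶ Y) (f : Y ⟶ Z) :
    mapAct T (h ≫ f) = mapAct T h ≫ onHom T f := by
  have e := mapAct_comp T h ((ρ_ Y).hom ≫ f)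
  rw [mapAct_rightUnitor, rightUnitor_naturality_assoc, rightUnitor_naturality_assoc,
    rightUnitor_tensor_hom, rightUnitor_tensor_hom, Category.assoc, Category.assoc,
    Iso.inv_hom_id_assoc, Iso.inv_hom_id_assoc, mapAct_whiskerLeft] at e
  exact (cancel_epi _).1 e

/-- The case of `mapAct_comp` in which the first parameter is the unit object. -/
lemma mapAct_pre {X X' P Y : V} (f : X ⟶ X') (h : X' ⊗ P ⟶ Y) :
    mapAct T (f ▷ P ≫ h) = onHom T f ▷ P ≫ mapAct T h := by
  have e := mapAct_comp T ((ρ_ X).hom ≫ f) h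
  rw [mapAct_rightUnitor, comp_whiskerRight_assoc, comp_whiskerRight_assoc,
    triangle_assoc_comp_right_assoc, triangle_assoc_comp_right_assoc, mapAct_whiskerLeft] at e
  exact (cancel_epi _).1 e

lemma onHom_eq {X Y : V} (f : X ⟶ Y) : onHom T f = (ρ_ _).inv ≫ mapAct T ((ρ_ X).hom ≫ f) := by
  rw [mapAct_rightUnitor, Iso.inv_hom_id_assoc]

lemma onHom_comp {X Y Z : V} (f : X ⟶ Y) (g : Y ⟶ Z) :
    onHom T (f ≫ g) = onHom T f ≫ onHom T g := by
  rw [onHom_eq, ← Category.assoc (ρ_ X).hom, mapAct_post, ← Category.assoc, ← onHom_eq]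

lemma onHom_id (X : V) : onHom T (𝟙 X) = 𝟙 (T.obj X) := by
  have h : lam ((ρ_ X).hom) = eId V X := self_hom_ext (by rw [lam_ev, ev_id])
  rw [onHom_eq, Category.comp_id, mapAct, h, pact_eId, Iso.inv_hom_id]

variable {D : Type w} [EnrichedCategory V D]

lemma pact_comp_mapAct (F : EnrichedFunctor V D V) {X Y : D} {P : V} (t : P ⟶ hom V X Y) :
    pact (F.comp V T) t = mapAct T (pact F t) := by
  rw [pact_functor_comp, pact_eq_mapAct, MonoidalCategory.whiskerLeft_comp_assoc]
  rfl

lemma act_comp_mapAct (F : EnrichedFunctor V D V) (X Y : D) :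
    act (F.comp V T) X Y = mapAct T (act F X Y) := by
  rw [← pact_id, pact_comp_mapAct, pact_id]

variable {T}

lemma IsNatural.onHom {F G : EnrichedFunctor V D V} {b : ∀ X, F.obj X ⟶ G.obj X}
    (hb : IsNatural F G b) :
    IsNatural (F.comp V T) (G.comp V T) (fun X => DayMonad.onHom T (b X)) := by
  intro X Y
  rw [act_comp_mapAct, act_comp_mapAct]
  exact (mapAct_post T _ _).symm.trans ((congrArg _ (hb X Y)).trans (mapAct_pre T _ _))

end MapAct

/-! ### `V`-naturality expressed through actions -/

section Self

variable {V : Type u} [Category.{v} V] [MonoidalCategory V] [SymmetricCategory V]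
  [MonoidalClosed V]
variable {D : Type w} [EnrichedCategory V D]

/-- For a family with parameter `𝟙_ V`, exchanging the parameter with the hom-object amounts to a
unitor, which cancels and leaves a parameter-free square. -/
lemma isNat_iff_isNatural {F G : EnrichedFunctor V D V} {θ : ∀ X, Mor V (F.obj X) (G.obj X)} :
    IsNat F G θ ↔ IsNatural F G (fun X => unname (θ X)) := by
  rw [isNat_act]
  refine forall₂_congr fun X Y => ?_
  rw [ev_unname, ev_unname, rightUnitor_naturality_assoc]
  have h : swapR (F.obj X) (hom V X Y) (𝟙_ V) ≫ (ρ_ (F.obj X)).hom ▷ hom V X Y =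
      (ρ_ (F.obj X ⊗ hom V X Y)).hom := by
    simp [swapR]
  rw [comp_whiskerRight_assoc, reassoc_of% h]
  exact cancel_epi _

lemma pact_self {X Y P : V} (t : P ⟶ hom V X Y) :
    pact (EnrichedFunctor.id V V) t = X ◁ t ≫ ev X Y := by
  have h : act (EnrichedFunctor.id V V) X Y = ev X Y :=
    (congrArg (· ≫ _) (MonoidalCategory.whiskerLeft_id _ _)).trans (Category.id_comp _)
  exact congrArg (_ ≫ ·) h

lemma pact_selfTensor {X Y : V × V} {P Q : V} (s : P ⟶ hom V X.1 Y.1) (t : Q ⟶ hom V X.2 Y.2) :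
    pact (selfTensor V) (X := X) (Y := Y) (s ⊗ₘ t) =
      tensorμ X.1 X.2 P Q ≫ ((X.1 ◁ s ≫ ev X.1 Y.1) ⊗ₘ (X.2 ◁ t ≫ ev X.2 Y.2)) := by
  rw [pact, act_selfTensor, ← tensorHom_comp_tensorHom]
  exact tensorμ_natural_right_assoc _ _ _ _ _

lemma pact_extTensor {C : Type w₁} {D : Type w₂} [EnrichedCategory V C] [EnrichedCategory V D]
    (F : EnrichedFunctor V C V) (G : EnrichedFunctor V D V) {X Y : C × D} {P Q : V}
    (s : P ⟶ hom V X.1 Y.1) (t : Q ⟶ hom V X.2 Y.2) :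
    pact (extTensor F G) (X := X) (Y := Y) (s ⊗ₘ t) =
      tensorμ (F.obj X.1) (G.obj X.2) P Q ≫ (pact F s ⊗ₘ pact G t) := by
  rw [pact, act_extTensor, pact, pact, ← tensorHom_comp_tensorHom]
  exact tensorμ_natural_right_assoc _ _ _ _ _

end Self

/-! ### The strong monad `T` in terms of morphisms of `V` -/

section Strength

variable {V : Type u} [Category.{v} V] [MonoidalCategory V] [SymmetricCategory V]
  [MonoidalClosed V]
variable {T : EnrichedFunctor V V V} (M : StrongMonad (selfData V) T)

/-- The strength `X ⊗ T Y ⟶ T (X ⊗ Y)` as a map of `V`. -/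
def str (X Y : V) : X ⊗ T.obj Y ⟶ T.obj (X ⊗ Y) :=
  unname (M.strength X Y)

/-- `V`-naturality of the strength, applied to the transposes of `x` and `y`. Keeping the parameters
makes this stronger than naturality for morphisms of `V`; that extra strength is what yields
`str_eq`. -/
lemma str_natural {X X' Y Y' P Q : V} (x : X ⊗ P ⟶ X') (y : Y ⊗ Q ⟶ Y') :
    tensorμ X (T.obj Y) P Q ≫ (x ⊗ₘ mapAct T y) ≫ str M X' Y' =
      str M X Y ▷ (P ⊗ Q) ≫ mapAct T (tensorμ X Y P Q ≫ (x ⊗ₘ y)) := by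
  have h := (isNat_iff_isNatural.1 M.strength_nat).pact (X := (X, Y)) (Y := (X', Y'))
    (lam x ⊗ₘ lam y)
  rw [pact_functor_comp, pact_comp_mapAct] at h
  have h1 : (lam x ⊗ₘ lam y) ≫ (prodMap (EnrichedFunctor.id V V) T).map (X, Y) (X', Y') =
      lam x ⊗ₘ (lam y ≫ T.map Y Y') := by
    refine (tensorHom_comp_tensorHom _ _ _ _).trans ?_
    congr 1
    exact Category.comp_id _
  have h2 := pact_selfTensor (X := (X, T.obj Y)) (Y := (X', T.obj Y')) (lam x) (lam y ≫ T.map Y Y')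
  have h3 := pact_selfTensor (X := (X, Y)) (Y := (X', Y')) (lam x) (lam y)
  dsimp only at h2 h3
  rw [lam_ev] at h2
  rw [lam_ev, lam_ev] at h3
  have h4 : T.obj Y ◁ (lam y ≫ T.map Y Y') ≫ ev (T.obj Y) (T.obj Y') = mapAct T y := by
    rw [MonoidalCategory.whiskerLeft_comp_assoc]; rfl
  rw [h4] at h2
  refine (Category.assoc _ _ _).symm.trans ((congrArg (· ≫ _) h2.symm).trans ?_)
  refine (congrArg (· ≫ _) (congrArg (pact (selfTensor V)) h1.symm)).trans ?_
  refine h.trans ?_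
  exact congrArg (fun z => _ ≫ mapAct T z) h3

lemma str_leftUnitor (X : V) : str M (𝟙_ V) X ≫ onHom T (λ_ X).hom = (λ_ (T.obj X)).hom := by
  have h := congrArg unname (M.strength_leftUnitor X)
  rw [unname_mcomp] at h
  exact h.trans (unname_name _)

/-- A strength is forced by the enrichment. The unitor `𝟙_ V ⊗ X ⟶ X`, read as a map out of the unit
object with parameter `X`, reduces `t_{X,Y}` by naturality to `t_{I,Y}`, and the left unitor axiom
determines the latter. -/
lemma str_eq (X Y : V) : str M X Y = (β_ X (T.obj Y)).hom ≫ mapAct T (β_ Y X).hom := by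
  have h := str_natural M (λ_ X).hom (ρ_ Y).hom
  have h1 : mapAct T (ρ_ Y).hom = (ρ_ (T.obj Y)).hom := by
    have := mapAct_rightUnitor T (𝟙 Y)
    rwa [onHom_id, Category.comp_id, Category.comp_id] at this
  -- With units in the outer places, the middle-four interchange is just the braiding of `Z` with
  -- `X`.
  have h2 : ∀ Z : V, tensorμ (𝟙_ V) Z X (𝟙_ V) ≫ ((λ_ X).hom ⊗ₘ (ρ_ Z).hom) =
      (λ_ Z).hom ▷ _ ≫ Z ◁ (ρ_ X).hom ≫ (β_ Z X).hom := by
    intro Z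
    simp only [tensorμ, MonoidalCategory.tensorHom_def]
    monoidal
  have h3 : str M (𝟙_ V) Y = (λ_ _).hom ≫ onHom T (λ_ Y).inv := by
    rw [← str_leftUnitor M, Category.assoc, ← onHom_comp, Iso.hom_inv_id, onHom_id,
      Category.comp_id]
  rw [h1, h2, h3, comp_whiskerRight_assoc, ← mapAct_pre, inv_hom_whiskerRight_assoc,
    mapAct_whiskerLeft, reassoc_of% (h2 (T.obj Y))] at h
  have h := (cancel_epi _).1 ((cancel_epi _).1 h)
  rw [← h, SymmetricCategory.symmetry_assoc]

lemma unname_mmap {X Y : V} (f : Mor V X Y) : unname (mmap T f) = onHom T (unname f) := by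
  rw [onHom, name_unname]

lemma unname_mtensor {X X' Y Y' : V} (f : Mor V X X') (g : Mor V Y Y') :
    unname (mtensor (selfTensor V) f g) = unname f ⊗ₘ unname g := by
  have h := pact_selfTensor (X := (X, Y)) (Y := (X', Y')) f g
  dsimp only at h
  rw [ev_unname, ev_unname, ← tensorHom_comp_tensorHom] at h
  have h2 : (ρ_ (X ⊗ Y)).inv ≫ (X ⊗ Y) ◁ (λ_ (𝟙_ V)).inv ≫ tensorμ X Y (𝟙_ V) (𝟙_ V) ≫
      ((ρ_ X).hom ⊗ₘ (ρ_ Y).hom) = 𝟙 _ := by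
    rw [Iso.inv_comp_eq, Category.comp_id]
    exact (tensor_right_unitality X Y).symm
  have h3 : unname (mtensor (selfTensor V) f g) = (ρ_ (X ⊗ Y)).inv ≫
      (X ⊗ Y) ◁ (λ_ (𝟙_ V)).inv ≫ pact (selfTensor V) (X := (X, Y)) (Y := (X', Y')) (f ⊗ₘ g) := by
    rw [mtensor, ← Category.assoc]
    refine (unname_map (selfTensor V) (X := (X, Y)) (Y := (X', Y')) _).trans ?_
    rw [← whiskerLeft_pact]
    rfl
  rw [h] at h3
  exact h3.trans ((congrArg (· ≫ (unname f ⊗ₘ unname g)) h2).trans (Category.id_comp _) |>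
    Eq.trans (by simp only [Category.assoc]; rfl))

lemma unname_selfAssoc (X Y Z : V) : unname ((selfData V).assoc X Y Z) = (α_ X Y Z).hom :=
  unname_name _

lemma unname_selfBraiding (X Y : V) : unname ((selfData V).braiding X Y) = (β_ X Y).hom :=
  unname_name _

lemma str_assoc (X Y Z : V) : str M (X ⊗ Y) Z ≫ onHom T (α_ X Y Z).hom =
    (α_ X Y (T.obj Z)).hom ≫ X ◁ str M Y Z ≫ str M X (Y ⊗ Z) := by
  have h := congrArg unname (M.strength_assoc X Y Z)
  simp only [unname_mcomp, unname_mmap, unname_mtensor, unname_eId, unname_selfAssoc] at h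
  rw [id_tensorHom] at h
  exact h

/-- The unit of the monad as a map of `V`. -/
def unitMap (X : V) : X ⟶ T.obj X := unname (M.η X)

/-- The multiplication of the monad as a map of `V`. -/
def mulMap (X : V) : T.obj (T.obj X) ⟶ T.obj X := unname (M.μ X)

lemma unitMap_natural {X P Y : V} (h : X ⊗ P ⟶ Y) :
    h ≫ unitMap M Y = unitMap M X ▷ P ≫ mapAct T h := by
  have e := (isNat_iff_isNatural.1 M.η_nat).pact (lam h)
  rw [pact_self, lam_ev] at e
  exact e

lemma mulMap_natural {X P Y : V} (h : X ⊗ P ⟶ Y) :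
    mapAct T (mapAct T h) ≫ mulMap M Y = mulMap M X ▷ P ≫ mapAct T h := by
  have e := (isNat_iff_isNatural.1 M.μ_nat).pact (lam h)
  rw [pact_comp_mapAct] at e
  exact e

lemma unitMap_mulMap (X : V) : unitMap M (T.obj X) ≫ mulMap M X = 𝟙 _ := by
  have h := congrArg unname (M.left_unit X)
  rwa [unname_mcomp, unname_eId] at h

lemma onHom_unitMap_mulMap (X : V) : onHom T (unitMap M X) ≫ mulMap M X = 𝟙 _ := by
  have h := congrArg unname (M.right_unit X)
  rwa [unname_mcomp, unname_eId, unname_mmap] at h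

lemma onHom_mulMap_mulMap (X : V) :
    onHom T (mulMap M X) ≫ mulMap M X = mulMap M (T.obj X) ≫ mulMap M X := by
  have h := congrArg unname (M.assoc X)
  rwa [unname_mcomp, unname_mcomp, unname_mmap] at h

lemma str_unit (X Y : V) : X ◁ unitMap M Y ≫ str M X Y = unitMap M (X ⊗ Y) := by
  have h := congrArg unname (M.strength_unit X Y)
  rw [unname_mcomp, unname_mtensor, unname_eId, id_tensorHom] at h
  exact h

lemma str_mul (X Y : V) : str M X (T.obj Y) ≫ onHom T (str M X Y) ≫ mulMap M (X ⊗ Y) =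
    X ◁ mulMap M Y ≫ str M X Y := by
  have h := congrArg unname (M.strength_mul X Y)
  rw [unname_mcomp, unname_mcomp, unname_mcomp, unname_mtensor, unname_eId, id_tensorHom,
    unname_mmap] at h
  exact h

/-- The costrength as a map of `V`. -/
def costr (X Y : V) : T.obj X ⊗ Y ⟶ T.obj (X ⊗ Y) :=
  (β_ (T.obj X) Y).hom ≫ str M Y X ≫ onHom T (β_ Y X).hom

lemma unname_costrength (X Y : V) : unname (M.costrength X Y) = costr M X Y := by
  rw [StrongMonad.costrength, unname_mcomp, unname_mcomp, unname_mmap, unname_selfBraiding,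
    unname_selfBraiding]
  rfl

lemma str_comm (hM : M.IsCommutative) (X Y : V) :
    costr M X (T.obj Y) ≫ onHom T (str M X Y) ≫ mulMap M (X ⊗ Y) =
      str M (T.obj X) Y ≫ onHom T (costr M X Y) ≫ mulMap M (X ⊗ Y) := by
  have h := congrArg unname (hM X Y)
  rw [unname_mcomp, unname_mcomp, unname_mcomp, unname_mcomp, unname_mmap, unname_mmap,
    unname_costrength, unname_costrength] at h
  exact h

/-- The associativity axiom splits the strength at `W ⊗ X` into the strength at `X` followed by the
one at `W`, and `str_eq` turns the latter into `T` acting with `W` as a parameter. This lets the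
weight of a coend pass through the strength. -/
lemma str_weighted (W X Y : V) :
    (α_ W X (T.obj Y)).inv ≫ str M (W ⊗ X) Y ≫ onHom T (α_ W X Y).hom =
      (β_ W (X ⊗ T.obj Y)).hom ≫ str M X Y ▷ W ≫ mapAct T (β_ (X ⊗ Y) W).hom := by
  rw [str_assoc, Iso.inv_hom_id_assoc, str_eq M W, BraidedCategory.braiding_naturality_right_assoc]

end Strength

/-! ### Tensor products of functors into `V`, and naturality of the constraints of `V` -/

section Naturality

variable {V : Type u} [Category.{v} V] [MonoidalCategory V] [SymmetricCategory V]
  [MonoidalClosed V]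
variable {C : Type w₁} {D : Type w₂} {E : Type w₃}
  [EnrichedCategory V C] [EnrichedCategory V D] [EnrichedCategory V E]

/-- The `V`-functor `X ↦ F X ⊗ P`. -/
def tensR (F : EnrichedFunctor V D V) (P : V) : EnrichedFunctor V D V :=
  ofAct (fun X => F.obj X ⊗ P) (fun X Y => swapR (F.obj X) P (hom V X Y) ≫ act F X Y ▷ P)
    (fun X => swapR_unit (act_id F X)) (fun X Y Z => swapR_comp (act_comp F X Y Z))

/-- The `V`-functor `X ↦ P ⊗ F X`. -/
def tensL (P : V) (F : EnrichedFunctor V D V) : EnrichedFunctor V D V :=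
  ofAct (fun X => P ⊗ F.obj X) (fun X Y => (α_ P (F.obj X) (hom V X Y)).hom ≫ P ◁ act F X Y)
    (fun X => assoc_unit (act_id F X))
    (fun X Y Z => by
      exact (assoc_comp (X := P) (act_comp F X Y Z)))

lemma act_tensR (F : EnrichedFunctor V D V) (P : V) (X Y : D) :
    act (tensR F P) X Y = swapR (F.obj X) P (hom V X Y) ≫ act F X Y ▷ P :=
  act_ofAct _ _ _ _ _ _

lemma act_tensL (F : EnrichedFunctor V D V) (P : V) (X Y : D) :
    act (tensL P F) X Y = (α_ P (F.obj X) (hom V X Y)).hom ≫ P ◁ act F X Y :=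
  act_ofAct _ _ _ _ _ _

lemma swapR_naturality_left {X X' : V} (f : X ⟶ X') (Y Z : V) :
    f ▷ Y ▷ Z ≫ swapR X' Y Z = swapR X Y Z ≫ f ▷ Z ▷ Y := by
  have h := swapR_natural f (𝟙 Y) (𝟙 Z)
  simpa only [MonoidalCategory.tensorHom_id] using h

lemma swapR_naturality_middle (X : V) {Y Y' : V} (f : Y ⟶ Y') (Z : V) :
    (X ◁ f) ▷ Z ≫ swapR X Y' Z = swapR X Y Z ≫ (X ⊗ Z) ◁ f := by
  have h := swapR_natural (𝟙 X) f (𝟙 Z)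
  simpa only [MonoidalCategory.tensorHom_id, MonoidalCategory.id_tensorHom, id_whiskerRight] using h

lemma swapR_naturality_right (X Y : V) {Z Z' : V} (f : Z ⟶ Z') :
    (X ⊗ Y) ◁ f ≫ swapR X Y Z' = swapR X Y Z ≫ (X ◁ f) ▷ Y := by
  have h := swapR_natural (𝟙 X) (𝟙 Y) f
  simpa only [MonoidalCategory.tensorHom_id, MonoidalCategory.id_tensorHom, id_whiskerRight] using h

lemma swapR_swapR (X Y Z : V) : swapR X Y Z ≫ swapR X Z Y = 𝟙 _ := by
  simp only [swapR, Category.assoc, Iso.inv_hom_id_assoc]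
  rw [← MonoidalCategory.whiskerLeft_comp_assoc, SymmetricCategory.symmetry]
  simp

lemma pact_tensR (F : EnrichedFunctor V D V) (P : V) {X Y : D} {Q : V} (t : Q ⟶ hom V X Y) :
    pact (tensR F P) t = swapR (F.obj X) P Q ≫ pact F t ▷ P := by
  rw [pact, act_tensR, pact, comp_whiskerRight, ← reassoc_of% (swapR_naturality_right (F.obj X) P t)]
  rfl

lemma IsNatural.whiskerRight {F G : EnrichedFunctor V D V} {b : ∀ X, F.obj X ⟶ G.obj X}
    (hb : IsNatural F G b) (P : V) : IsNatural (tensR F P) (tensR G P) (fun X => b X ▷ P) := by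
  intro X Y
  rw [act_tensR, act_tensR]
  change (swapR (F.obj X) P (hom V X Y) ≫ act F X Y ▷ P) ≫ b Y ▷ P =
    b X ▷ P ▷ hom V X Y ≫ swapR (G.obj X) P (hom V X Y) ≫ act G X Y ▷ P
  rw [Category.assoc, ← comp_whiskerRight, hb, comp_whiskerRight,
    reassoc_of% (swapR_naturality_left (b X) P (hom V X Y))]

lemma isNatural_tensR_whiskerLeft (F : EnrichedFunctor V D V) {P Q : V} (f : P ⟶ Q) :
    IsNatural (tensR F P) (tensR F Q) (fun X => F.obj X ◁ f) := by
  intro X Y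
  rw [act_tensR, act_tensR]
  change (swapR (F.obj X) P (hom V X Y) ≫ act F X Y ▷ P) ≫ F.obj Y ◁ f =
    (F.obj X ◁ f) ▷ hom V X Y ≫ swapR (F.obj X) Q (hom V X Y) ≫ act F X Y ▷ Q
  rw [Category.assoc, ← whisker_exchange,
    reassoc_of% (swapR_naturality_middle (F.obj X) f (hom V X Y))]

lemma isNatural_associator_inv (F : EnrichedFunctor V D V) (P Q : V) :
    IsNatural (tensR F (P ⊗ Q)) (tensR (tensR F P) Q) (fun X => (α_ (F.obj X) P Q).inv) := by
  intro X Y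
  rw [act_tensR, act_tensR, act_tensR]
  change (swapR (F.obj X) (P ⊗ Q) (hom V X Y) ≫ act F X Y ▷ (P ⊗ Q)) ≫ (α_ (F.obj Y) P Q).inv =
    (α_ (F.obj X) P Q).inv ▷ hom V X Y ≫ swapR (F.obj X ⊗ P) Q (hom V X Y) ≫
      (swapR (F.obj X) P (hom V X Y) ≫ act F X Y ▷ P) ▷ Q
  rw [Category.assoc, associator_inv_naturality_left, comp_whiskerRight]
  have h : swapR (F.obj X) (P ⊗ Q) (hom V X Y) ≫ (α_ _ P Q).inv =
      (α_ _ P Q).inv ▷ _ ≫ swapR (F.obj X ⊗ P) Q (hom V X Y) ≫ swapR _ _ _ ▷ Q := by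
    simp [swapR, BraidedCategory.braiding_tensor_left_hom]
  rw [reassoc_of% h]

lemma isNatural_rightUnitor_inv (F : EnrichedFunctor V D V) :
    IsNatural F (tensR F (𝟙_ V)) (fun X => (ρ_ (F.obj X)).inv) := by
  intro X Y
  rw [act_tensR]
  change act F X Y ≫ (ρ_ (F.obj Y)).inv =
    (ρ_ (F.obj X)).inv ▷ hom V X Y ≫ swapR (F.obj X) (𝟙_ V) (hom V X Y) ≫ act F X Y ▷ (𝟙_ V)
  rw [rightUnitor_inv_naturality, ← Category.assoc]
  congr 1
  simp [swapR]

lemma isNatural_rightUnitor (F : EnrichedFunctor V D V) :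
    IsNatural (tensR F (𝟙_ V)) F (fun X => (ρ_ (F.obj X)).hom) :=
  (isNatural_rightUnitor_inv F).inv (fun _ => Iso.inv_hom_id _) (fun _ => Iso.hom_inv_id _)

lemma isNatural_insert (F : EnrichedFunctor V D V) {P : V} (i : 𝟙_ V ⟶ P) :
    IsNatural F (tensL P F) (fun X => (λ_ (F.obj X)).inv ≫ i ▷ F.obj X) := by
  intro X Y
  rw [act_tensL]
  change act F X Y ≫ (λ_ (F.obj Y)).inv ≫ i ▷ F.obj Y =
    ((λ_ (F.obj X)).inv ≫ i ▷ F.obj X) ▷ hom V X Y ≫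
      (α_ P (F.obj X) (hom V X Y)).hom ≫ P ◁ act F X Y
  rw [leftUnitor_inv_naturality_assoc, whisker_exchange]
  simp

lemma isNatural_braiding (F : EnrichedFunctor V D V) (P : V) :
    IsNatural (tensR F P) (tensL P F) (fun X => (β_ (F.obj X) P).hom) := by
  intro X Y
  rw [act_tensR, act_tensL]
  change (swapR (F.obj X) P (hom V X Y) ≫ act F X Y ▷ P) ≫ (β_ (F.obj Y) P).hom =
    (β_ (F.obj X) P).hom ▷ hom V X Y ≫ (α_ P (F.obj X) (hom V X Y)).hom ≫ P ◁ act F X Y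
  have h : F.obj X ◁ (β_ P (hom V X Y)).hom ≫ F.obj X ◁ (β_ (hom V X Y) P).hom = 𝟙 _ := by
    rw [← MonoidalCategory.whiskerLeft_comp, SymmetricCategory.symmetry,
      MonoidalCategory.whiskerLeft_id]
  rw [Category.assoc, BraidedCategory.braiding_naturality_left, ← Category.assoc, ← Category.assoc]
  congr 1
  simp [swapR, reassoc_of% h]

lemma IsNatural.tensor {F F' : EnrichedFunctor V C V} {G G' : EnrichedFunctor V D V}
    {a : ∀ X, F.obj X ⟶ F'.obj X} {b : ∀ X, G.obj X ⟶ G'.obj X} (ha : IsNatural F F' a)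
    (hb : IsNatural G G' b) :
    IsNatural (extTensor F G) (extTensor F' G') (fun X => a X.1 ⊗ₘ b X.2) := by
  intro X Y
  rw [act_extTensor, act_extTensor]
  change (tensorμ (F.obj X.1) (G.obj X.2) (hom V X.1 Y.1) (hom V X.2 Y.2) ≫
    (act F X.1 Y.1 ⊗ₘ act G X.2 Y.2)) ≫ (a Y.1 ⊗ₘ b Y.2) =
      (a X.1 ⊗ₘ b X.2) ▷ (hom V X.1 Y.1 ⊗ hom V X.2 Y.2) ≫
        tensorμ (F'.obj X.1) (G'.obj X.2) (hom V X.1 Y.1) (hom V X.2 Y.2) ≫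
          (act F' X.1 Y.1 ⊗ₘ act G' X.2 Y.2)
  rw [Category.assoc, tensorHom_comp_tensorHom, ha, hb, ← tensorHom_comp_tensorHom,
    tensorμ_natural_left_assoc]

lemma act_prodMap_extTensor {C' : Type w₃} {D' : Type w₄} [EnrichedCategory V C']
    [EnrichedCategory V D'] (J : EnrichedFunctor V C' C) (K : EnrichedFunctor V D' D)
    (F : EnrichedFunctor V C V) (G : EnrichedFunctor V D V) (X Y : C' × D') :
    act ((prodMap J K).comp V (extTensor F G)) X Y =
      act (extTensor (J.comp V F) (K.comp V G)) X Y := by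
  rw [act_comp', act_extTensor, act_comp', act_comp']
  exact pact_extTensor _ _ _ _

/-- The action on a product is built from `tensorμ`, so the content is the compatibility of
`tensorμ` with associators, `associator_monoidal`. -/
lemma isNatural_assoc (F : EnrichedFunctor V C V) (G : EnrichedFunctor V D V)
    (H : EnrichedFunctor V E V) :
    IsNatural (extTensor (extTensor F G) H)
      ((prodAssoc V C D E).comp V (extTensor F (extTensor G H)))
      (fun X => (α_ (F.obj X.1.1) (G.obj X.1.2) (H.obj X.2)).hom) := by
  rintro ⟨⟨X₁, X₂⟩, X₃⟩ ⟨⟨Y₁, Y₂⟩, Y₃⟩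
  rw [act_comp', act_extTensor, act_extTensor, pact, act_extTensor, act_extTensor]
  change (tensorμ (F.obj X₁ ⊗ G.obj X₂) (H.obj X₃) (hom V X₁ Y₁ ⊗ hom V X₂ Y₂) (hom V X₃ Y₃) ≫
    (tensorμ (F.obj X₁) (G.obj X₂) (hom V X₁ Y₁) (hom V X₂ Y₂) ≫
      (act F X₁ Y₁ ⊗ₘ act G X₂ Y₂) ⊗ₘ act H X₃ Y₃)) ≫ (α_ (F.obj Y₁) (G.obj Y₂) (H.obj Y₃)).hom =
    (α_ (F.obj X₁) (G.obj X₂) (H.obj X₃)).hom ▷ ((hom V X₁ Y₁ ⊗ hom V X₂ Y₂) ⊗ hom V X₃ Y₃) ≫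
      (F.obj X₁ ⊗ G.obj X₂ ⊗ H.obj X₃) ◁ (α_ (hom V X₁ Y₁) (hom V X₂ Y₂) (hom V X₃ Y₃)).hom ≫
        tensorμ (F.obj X₁) (G.obj X₂ ⊗ H.obj X₃) (hom V X₁ Y₁) (hom V X₂ Y₂ ⊗ hom V X₃ Y₃) ≫
          (act F X₁ Y₁ ⊗ₘ tensorμ (G.obj X₂) (H.obj X₃) (hom V X₂ Y₂) (hom V X₃ Y₃) ≫
            (act G X₂ Y₂ ⊗ₘ act H X₃ Y₃))
  have h := associator_monoidal (F.obj X₁) (G.obj X₂) (H.obj X₃) (hom V X₁ Y₁) (hom V X₂ Y₂)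
    (hom V X₃ Y₃)
  have h1 : ∀ {P Q R U U' : V} (m : P ⟶ Q) (c₁ : Q ⟶ U) (c₂ : R ⟶ U'),
      ((m ≫ c₁) ⊗ₘ c₂) = m ▷ R ≫ (c₁ ⊗ₘ c₂) := by
    intros; rw [← MonoidalCategory.tensorHom_id, tensorHom_comp_tensorHom, Category.id_comp]
  have h2 : ∀ {P Q R U U' : V} (m : P ⟶ Q) (c₁ : R ⟶ U) (c₂ : Q ⟶ U'),
      (c₁ ⊗ₘ (m ≫ c₂)) = R ◁ m ≫ (c₁ ⊗ₘ c₂) := by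
    intros; rw [← id_tensorHom, tensorHom_comp_tensorHom, Category.id_comp]
  rw [h1, h2, Category.assoc, Category.assoc, associator_naturality, reassoc_of% h,
    MonoidalCategory.tensorHom_def_assoc]

/-- Rests on the compatibility of `tensorμ` with the braiding, `tensorμ_braiding`, which uses
symmetry. -/
lemma isNatural_swap (F : EnrichedFunctor V C V) (G : EnrichedFunctor V D V) :
    IsNatural (extTensor F G) ((prodSwap V C D).comp V (extTensor G F))
      (fun X => (β_ (F.obj X.1) (G.obj X.2)).hom) := by
  intro X Y
  rw [act_comp', act_extTensor, pact, act_extTensor]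
  change (tensorμ (F.obj X.1) (G.obj X.2) (hom V X.1 Y.1) (hom V X.2 Y.2) ≫
    (act F X.1 Y.1 ⊗ₘ act G X.2 Y.2)) ≫ (β_ (F.obj Y.1) (G.obj Y.2)).hom =
      (β_ (F.obj X.1) (G.obj X.2)).hom ▷ (hom V X.1 Y.1 ⊗ hom V X.2 Y.2) ≫
        (G.obj X.2 ⊗ F.obj X.1) ◁ (β_ (hom V X.1 Y.1) (hom V X.2 Y.2)).hom ≫
        tensorμ (G.obj X.2) (F.obj X.1) (hom V X.2 Y.2) (hom V X.1 Y.1) ≫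
          (act G X.2 Y.2 ⊗ₘ act F X.1 Y.1)
  rw [Category.assoc, BraidedCategory.braiding_naturality, reassoc_of% (tensorμ_braiding),
    MonoidalCategory.tensorHom_def_assoc]

end Naturality

/-! ### Functors of two variables through their partial actions -/

section Partial

variable {V : Type u} [Category.{v} V] [MonoidalCategory V] [SymmetricCategory V]
variable {C : Type w₁} {D : Type w₂} [EnrichedCategory V C] [EnrichedCategory V D]

lemma insertRight_map (d : D) (X Y : C) :
    (insertRight (V := V) (C := C) d).map X Y = (ρ_ (hom V X Y)).inv ≫ hom V X Y ◁ eId V d := by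
  change ((λ_ (hom V X Y)).inv ≫ eId V d ▷ hom V X Y) ≫ (β_ (hom V d d) (hom V X Y)).hom = _
  rw [Category.assoc, BraidedCategory.braiding_naturality_left, leftUnitor_inv_braiding_assoc]

lemma comp_eId {X Y : C} {P : V} (t : P ⟶ hom V X Y) :
    (t ⊗ₘ eId V Y) ≫ eComp V X Y Y = (ρ_ P).hom ≫ t := by
  have h := e_comp_id V X Y
  rw [Iso.inv_comp_eq, Category.comp_id] at h
  rw [MonoidalCategory.tensorHom_def_assoc, h, rightUnitor_naturality]

lemma eId_comp {X Y : C} {P : V} (t : P ⟶ hom V X Y) :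
    (eId V X ⊗ₘ t) ≫ eComp V X X Y = (λ_ P).hom ≫ t := by
  have h := e_id_comp V X Y
  rw [Iso.inv_comp_eq, Category.comp_id] at h
  rw [MonoidalCategory.tensorHom_def'_assoc, h, leftUnitor_naturality]

/-- In a product a pair `(f, g)` is `(f, 1)` followed by `(1, g)`. Stated for the universal pair,
this makes the composite an identity. -/
lemma insertRight_insertLeft_comp (c c' : C) (d d' : D) :
    ((insertRight d).map c c' ⊗ₘ (insertLeft c').map d d') ≫
      eComp V ((c, d) : C × D) (c', d) (c', d') = 𝟙 _ := by
  rw [insertRight_map, prod_eComp]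
  change ((ρ_ (hom V c c')).inv ≫ hom V c c' ◁ eId V d ⊗ₘ
    (λ_ (hom V d d')).inv ≫ eId V c' ▷ hom V d d') ≫
      tensorμ (hom V c c') (hom V d d) (hom V c' c') (hom V d d') ≫
        (eComp V c c' c' ⊗ₘ eComp V d d d') = 𝟙 (hom V c c' ⊗ hom V d d')
  rw [← id_tensorHom, ← MonoidalCategory.tensorHom_id, ← tensorHom_comp_tensorHom, Category.assoc,
    tensorμ_natural_assoc, tensorHom_comp_tensorHom, comp_eId, eId_comp, Category.comp_id,
    Category.comp_id]
  simp only [tensorμ, MonoidalCategory.tensorHom_def, braiding_tensorUnit_right]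
  monoidal

/-- The factorization of `(f, g)` in the other order. The arguments arrive as `g`, `f`, hence the
braiding. -/
lemma insertLeft_insertRight_comp (c c' : C) (d d' : D) :
    ((insertLeft c).map d d' ⊗ₘ (insertRight d').map c c') ≫
      eComp V ((c, d) : C × D) (c, d') (c', d') = (β_ (hom V d d') (hom V c c')).hom := by
  rw [insertRight_map, prod_eComp]
  change ((λ_ (hom V d d')).inv ≫ eId V c ▷ hom V d d' ⊗ₘ
    (ρ_ (hom V c c')).inv ≫ hom V c c' ◁ eId V d') ≫
      tensorμ (hom V c c) (hom V d d') (hom V c c') (hom V d' d') ≫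
        (eComp V c c c' ⊗ₘ eComp V d d' d') = (β_ (hom V d d') (hom V c c')).hom
  rw [← id_tensorHom, ← MonoidalCategory.tensorHom_id, ← tensorHom_comp_tensorHom, Category.assoc,
    tensorμ_natural_assoc, tensorHom_comp_tensorHom, comp_eId, eId_comp, Category.comp_id,
    Category.comp_id]
  simp only [tensorμ, MonoidalCategory.tensorHom_def]
  monoidal

variable [MonoidalClosed V]

/-- The action of a `V`-functor `C ⊗ D ⟶ V` in the first variable. -/
def actFst (N : EnrichedFunctor V (C × D) V) (c c' : C) (d : D) :
    N.obj (c, d) ⊗ hom V c c' ⟶ N.obj (c', d) :=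
  pact N (X := (c, d)) (Y := (c', d)) ((insertRight d).map c c')

/-- The action of a `V`-functor `C ⊗ D ⟶ V` in the second variable. -/
def actSnd (N : EnrichedFunctor V (C × D) V) (c : C) (d d' : D) :
    N.obj (c, d) ⊗ hom V d d' ⟶ N.obj (c, d') :=
  pact N (X := (c, d)) (Y := (c, d')) ((insertLeft c).map d d')

lemma act_insertRight (N : EnrichedFunctor V (C × D) V) (c c' : C) (d : D) :
    act ((insertRight d).comp V N) c c' = actFst N c c' d :=
  act_comp' _ _ _ _

lemma act_insertLeft (N : EnrichedFunctor V (C × D) V) (c : C) (d d' : D) :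
    act ((insertLeft c).comp V N) d d' = actSnd N c d d' :=
  act_comp' _ _ _ _

lemma actFst_extTensor (F : EnrichedFunctor V C V) (G : EnrichedFunctor V D V) (d : D)
    (X Y : C) :
    actFst (extTensor F G) X Y d = swapR (F.obj X) (G.obj d) (hom V X Y) ≫ act F X Y ▷ G.obj d := by
  have h := tensorμ_unit_right (A := F.obj X) (M := G.obj d) (eId V d) (act F X Y) (act G d d)
    (act_id G d)
  rw [← h, ← MonoidalCategory.whiskerLeft_comp_assoc]
  exact congrArg (_ ≫ ·) (act_extTensor F G (X, d) (Y, d))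

lemma actSnd_extTensor (F : EnrichedFunctor V C V) (G : EnrichedFunctor V D V) (c : C)
    (X Y : D) :
    actSnd (extTensor F G) c X Y =
      (α_ (F.obj c) (G.obj X) (hom V X Y)).hom ≫ F.obj c ◁ act G X Y := by
  have h := tensorμ_unit_left (A := F.obj c) (M := G.obj X) (eId V c) (act F c c) (act G X Y)
    (act_id F c)
  have h2 : (λ_ (hom V X Y)).inv ≫ eId V c ▷ hom V X Y = ((ρ_ (hom V X Y)).inv ≫
      hom V X Y ◁ eId V c) ≫ (β_ (hom V X Y) (hom V c c)).hom := by
    rw [Category.assoc, BraidedCategory.braiding_naturality_right, rightUnitor_inv_braiding_assoc]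
  rw [← h, ← MonoidalCategory.whiskerLeft_comp_assoc, ← h2]
  exact congrArg (_ ≫ ·) (act_extTensor F G (c, X) (c, Y))

lemma act_insertRight_extTensor (F : EnrichedFunctor V C V) (G : EnrichedFunctor V D V) (d : D)
    (X Y : C) :
    act ((insertRight d).comp V (extTensor F G)) X Y = act (tensR F (G.obj d)) X Y :=
  (act_insertRight _ _ _ _).trans ((actFst_extTensor _ _ _ _ _).trans (act_tensR _ _ _ _).symm)

lemma act_insertLeft_extTensor (F : EnrichedFunctor V C V) (G : EnrichedFunctor V D V) (c : C)
    (X Y : D) :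
    act ((insertLeft c).comp V (extTensor F G)) X Y = act (tensL (F.obj c) G) X Y :=
  (act_insertLeft _ _ _ _).trans ((actSnd_extTensor _ _ _ _ _).trans (act_tensL _ _ _ _).symm)

lemma act_eq_partial (N : EnrichedFunctor V (C × D) V) (c c' : C) (d d' : D) :
    act N (c, d) (c', d') = (α_ (N.obj (c, d)) (hom V c c') (hom V d d')).inv ≫
      actFst N c c' d ▷ hom V d d' ≫ actSnd N c' d d' := by
  refine (pact_id N _ _).symm.trans ?_
  refine (congrArg (pact N) (insertRight_insertLeft_comp c c' d d').symm).trans ?_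
  exact pact_comp N _ _

/-- Both orders of acting compute the action of the pair, by the two factorizations of a morphism of
the product; therefore the partial actions commute up to exchange of parameters. -/
lemma actSnd_actFst (N : EnrichedFunctor V (C × D) V) (c c' : C) (d d' : D) :
    actSnd N c d d' ▷ hom V c c' ≫ actFst N c c' d' =
      swapR (N.obj (c, d)) (hom V d d') (hom V c c') ≫ actFst N c c' d ▷ hom V d d' ≫
        actSnd N c' d d' := by
  have h1 := act_eq_partial N c c' d d'
  rw [Iso.eq_inv_comp] at h1
  have h2 : actSnd N c d d' ▷ hom V c c' ≫ actFst N c c' d' =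
      (α_ _ _ _).hom ≫ N.obj (c, d) ◁ (β_ (hom V d d') (hom V c c')).hom ≫
        act N (c, d) (c', d') := by
    refine (pact_pact N (X := (c, d)) (Y := (c, d')) (Z := (c', d')) _ _).trans ?_
    exact congrArg (fun z => _ ≫ pact N z) (insertLeft_insertRight_comp c c' d d')
  rw [h2, ← h1]
  simp only [swapR, Category.assoc]
  exact congrArg (fun z => _ ≫ _ ≫ z) (Iso.inv_hom_id_assoc _ _).symm

/-- The joint action is the composite of the partial ones by `act_eq_partial`, so naturality may be
checked one variable at a time. -/
lemma isNatural_of_partial {N L : EnrichedFunctor V (C × D) V} {b : ∀ X, N.obj X ⟶ L.obj X}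
    (h₁ : ∀ c c' d, actFst N c c' d ≫ b (c', d) = b (c, d) ▷ hom V c c' ≫ actFst L c c' d)
    (h₂ : ∀ c d d', actSnd N c d d' ≫ b (c, d') = b (c, d) ▷ hom V d d' ≫ actSnd L c d d') :
    IsNatural N L b := by
  rintro ⟨c, d⟩ ⟨c', d'⟩
  rw [act_eq_partial, act_eq_partial]
  change ((α_ (N.obj (c, d)) (hom V c c') (hom V d d')).inv ≫
    actFst N c c' d ▷ hom V d d' ≫ actSnd N c' d d') ≫ b (c', d') =
      b (c, d) ▷ (hom V c c' ⊗ hom V d d') ≫ (α_ (L.obj (c, d)) (hom V c c') (hom V d d')).inv ≫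
    actFst L c c' d ▷ hom V d d' ≫ actSnd L c' d d'
  rw [Category.assoc, Category.assoc, h₂, ← comp_whiskerRight_assoc, h₁,
    comp_whiskerRight_assoc, associator_inv_naturality_left_assoc]

lemma isNatural_actSnd (L : EnrichedFunctor V (C × D) V) (d d' : D) :
    IsNatural (tensR ((insertRight d).comp V L) (hom V d d')) ((insertRight d').comp V L)
      (fun c => actSnd L c d d') := by
  intro c c'
  rw [act_tensR, act_insertRight, act_insertRight]
  exact (Category.assoc _ _ _).trans (actSnd_actFst L c c' d d').symm

end Partial

/-! ### Naturality of the strength, unit and multiplication along functors into `V` -/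

section Strength

variable {V : Type u} [Category.{v} V] [MonoidalCategory V] [SymmetricCategory V]
  [MonoidalClosed V]
variable {T : EnrichedFunctor V V V} (M : StrongMonad (selfData V) T)
variable {C : Type w₁} {D : Type w₂} [EnrichedCategory V C] [EnrichedCategory V D]

lemma isNatural_str (F : EnrichedFunctor V C V) (G : EnrichedFunctor V D V) :
    IsNatural (extTensor F (G.comp V T)) ((extTensor F G).comp V T)
      (fun X => str M (F.obj X.1) (G.obj X.2)) := by
  intro X Y
  rw [act_extTensor, act_comp_mapAct, act_comp_mapAct, act_extTensor]
  exact (Category.assoc _ _ _).trans (str_natural M _ _)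

lemma isNatural_unitMap (F : EnrichedFunctor V C V) :
    IsNatural F (F.comp V T) (fun X => unitMap M (F.obj X)) := by
  intro X Y
  rw [act_comp_mapAct]
  exact unitMap_natural M _

lemma isNatural_mulMap (F : EnrichedFunctor V C V) :
    IsNatural ((F.comp V T).comp V T) (F.comp V T) (fun X => mulMap M (F.obj X)) := by
  intro X Y
  rw [act_comp_mapAct, act_comp_mapAct]
  exact mulMap_natural M _

end Strength

/-! ### Maps of presheaves, their components, and restriction along maps of `A` -/

section Presheaves

variable {V : Type u} [Category.{v} V] [MonoidalCategory V] [SymmetricCategory V]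
  [MonoidalClosed V] [HasLimits V]
variable {A : Type v} [EnrichedCategory V A] {C : Type w} [EnrichedCategory V C]

/-- Evaluation at `X` as a `V`-functor `[Aᵒᵖ, V] ⟶ V`. -/
@[simps]
def evalF (X : Aᵒᵖ) : EnrichedFunctor V (EnrichedFunctor V Aᵒᵖ V) V where
  obj F := F.obj X
  map F G := natπ F G X
  map_id F := nat_eId_π F X
  map_comp F G H := nat_eComp_π F G H X

/-- The component `F X ⊗ P ⟶ G X` of a generalized element of `[Aᵒᵖ, V](F, G)`. -/
def pcomp {F G : EnrichedFunctor V Aᵒᵖ V} {P : V} (t : P ⟶ hom V F G) (X : Aᵒᵖ) :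
    F.obj X ⊗ P ⟶ G.obj X :=
  pact (evalF X) t

lemma component_eq {F G : EnrichedFunctor V Aᵒᵖ V} (φ : Mor V F G) (X : Aᵒᵖ) :
    component φ X = (ρ_ _).inv ≫ pcomp φ X :=
  unname_map (evalF X) φ

lemma pcomp_mor {F G : EnrichedFunctor V Aᵒᵖ V} (φ : Mor V F G) (X : Aᵒᵖ) :
    pcomp φ X = (ρ_ _).hom ≫ component φ X := by
  rw [component_eq, Iso.hom_inv_id_assoc]

/-- Every generalized element of `[Aᵒᵖ, V](F, G)` is a reparametrization of the universal one, whose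
naturality is the defining property of the end. -/
lemma isNatural_pcomp {F G : EnrichedFunctor V Aᵒᵖ V} {P : V} (t : P ⟶ hom V F G) :
    IsNatural (tensR F P) G (fun X => pcomp t X) := by
  intro X Y
  have h := evN_natural F G X Y
  rw [act_tensR]
  change (swapR (F.obj X) P (hom V X Y) ≫ act F X Y ▷ P) ≫ F.obj Y ◁ t ≫ evN F G Y =
    (F.obj X ◁ t ≫ evN F G X) ▷ hom V X Y ≫ act G X Y
  have h2 : swapR (F.obj X) (hom V F G) (hom V X Y) ≫ act F X Y ▷ hom V F G ≫ evN F G Y =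
      evN F G X ▷ hom V X Y ≫ act G X Y := by
    rw [h, reassoc_of% (swapR_swapR (F.obj X) (hom V F G) (hom V X Y))]
  rw [comp_whiskerRight_assoc, ← h2, reassoc_of% (swapR_naturality_middle (F.obj X) t (hom V X Y)),
    whisker_exchange_assoc, Category.assoc]

lemma isNatural_component {F G : EnrichedFunctor V Aᵒᵖ V} (φ : Mor V F G) :
    IsNatural F G (component φ) := by
  have h := (isNatural_rightUnitor_inv F).comp (isNatural_pcomp φ)
  have e : component φ = fun X => (ρ_ (F.obj X)).inv ≫ pcomp φ X :=
    funext fun X => component_eq φ X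
  rw [e]
  exact h

lemma mor_ext {F G : EnrichedFunctor V Aᵒᵖ V} {φ ψ : Mor V F G}
    (h : ∀ X, component φ X = component ψ X) : φ = ψ :=
  nat_hom_ext fun X => unname_inj (h X)

lemma component_mcomp {F G H : EnrichedFunctor V Aᵒᵖ V} (φ : Mor V F G) (ψ : Mor V G H)
    (X : Aᵒᵖ) : component (mcomp φ ψ) X = component φ X ≫ component ψ X := by
  rw [component, component, component, ← unname_mcomp, mcomp, Category.assoc, Category.assoc,
    nat_eComp_π, tensorHom_comp_tensorHom_assoc]
  rfl

lemma component_eId (F : EnrichedFunctor V Aᵒᵖ V) (X : Aᵒᵖ) :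
    component (eId V F) X = 𝟙 (F.obj X) := by
  rw [component, nat_eId_π, unname_eId]

/-- The map of presheaves with the given natural components. -/
def morOf {F G : EnrichedFunctor V Aᵒᵖ V} (b : ∀ X, F.obj X ⟶ G.obj X) (hb : IsNatural F G b) :
    Mor V F G :=
  natLift F G (fun X => name (b X)) (isNat_iff_isNatural.2 (by
    simpa only [unname_name] using hb))

lemma component_morOf {F G : EnrichedFunctor V Aᵒᵖ V} (b : ∀ X, F.obj X ⟶ G.obj X)
    (hb : IsNatural F G b) (X : Aᵒᵖ) : component (morOf b hb) X = b X := by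
  rw [component, morOf, natLift_π, unname_name]

/-- The projections of the end are jointly monic and respect composition, so a square in `[Aᵒᵖ, V]`
commutes once it commutes at every object. -/
lemma isNat_iff_eval {Φ Ψ : EnrichedFunctor V C (EnrichedFunctor V Aᵒᵖ V)}
    {θ : ∀ c, Mor V (Φ.obj c) (Ψ.obj c)} :
    IsNat Φ Ψ θ ↔ ∀ X, IsNatural (Φ.comp V (evalF X)) (Ψ.comp V (evalF X))
      (fun c => component (θ c) X) := by
  have h : ∀ X, IsNatural (Φ.comp V (evalF X)) (Ψ.comp V (evalF X))
      (fun c => component (θ c) X) ↔ IsNat (Φ.comp V (evalF X)) (Ψ.comp V (evalF X))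
        (fun c => θ c ≫ natπ _ _ X) := fun X => isNat_iff_isNatural.symm
  have e : ∀ c d, ((Φ.map c d ⊗ₘ θ d) ≫ eComp V _ _ _ =
      (β_ (hom V c d) (𝟙_ V)).hom ≫ (θ c ⊗ₘ Ψ.map c d) ≫ eComp V _ _ _) ↔
      ∀ X, ((Φ.comp V (evalF X)).map c d ⊗ₘ (θ d ≫ natπ _ _ X)) ≫ eComp V _ _ _ =
      (β_ (hom V c d) (𝟙_ V)).hom ≫ ((θ c ≫ natπ _ _ X) ⊗ₘ (Ψ.comp V (evalF X)).map c d) ≫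
        eComp V _ _ _ := by
    intro c d
    have e1 : ∀ X, ((Φ.map c d ⊗ₘ θ d) ≫ eComp V _ _ _) ≫ natπ (Φ.obj c) (Ψ.obj d) X =
        ((Φ.comp V (evalF X)).map c d ⊗ₘ (θ d ≫ natπ _ _ X)) ≫ eComp V _ _ _ := fun X => by
      rw [Category.assoc, nat_eComp_π, tensorHom_comp_tensorHom_assoc]
      rfl
    have e2 : ∀ X, ((β_ (hom V c d) (𝟙_ V)).hom ≫ (θ c ⊗ₘ Ψ.map c d) ≫ eComp V _ _ _) ≫
        natπ (Φ.obj c) (Ψ.obj d) X =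
        (β_ (hom V c d) (𝟙_ V)).hom ≫ ((θ c ≫ natπ _ _ X) ⊗ₘ (Ψ.comp V (evalF X)).map c d) ≫
        eComp V _ _ _ := fun X => by
      rw [Category.assoc, Category.assoc, nat_eComp_π, tensorHom_comp_tensorHom_assoc]
      rfl
    constructor
    · intro h X
      rw [← e1, h, e2]
    · intro h
      apply nat_hom_ext
      intro X
      exact (e1 X).trans ((h X).trans (e2 X).symm)
  simp only [h]
  constructor
  · intro k X c d
    exact (e c d).1 (k c d) X
  · intro k c d
    exact (e c d).2 (fun X => k X c d)

section Restrict

lemma restrict_eq (F : EnrichedFunctor V Aᵒᵖ V) {X Y : A} (f : Mor V X Y) :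
    restrict F f = (ρ_ _).inv ≫ pact F (X := op Y) (Y := op X) f :=
  unname_map F (X := op Y) (Y := op X) f

lemma pact_restrict (F : EnrichedFunctor V Aᵒᵖ V) {X Y : A} (f : Mor V X Y) :
    pact F (X := op Y) (Y := op X) f = (ρ_ _).hom ≫ restrict F f := by
  rw [restrict_eq, Iso.hom_inv_id_assoc]

lemma restrict_eId (F : EnrichedFunctor V Aᵒᵖ V) (X : A) : restrict F (eId V X) = 𝟙 _ := by
  rw [restrict_eq]
  exact (congrArg (_ ≫ ·) (pact_eId F (op X))).trans (Iso.inv_hom_id _)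

lemma restrict_component {F G : EnrichedFunctor V Aᵒᵖ V} (φ : Mor V F G) {X Y : A}
    (f : Mor V X Y) :
    restrict F f ≫ component φ (op X) = component φ (op Y) ≫ restrict G f := by
  rw [restrict_eq, restrict_eq, Category.assoc, (isNatural_component φ).pact,
    rightUnitor_inv_naturality_assoc]

/-- Precomposition with a map, followed by the action of a hom-object. -/
lemma restrict_act (F : EnrichedFunctor V Aᵒᵖ V) {X Y Z : A} {P : V} (f : Mor V Y Z)
    (t : P ⟶ hom V X Y) :
    restrict F f ▷ P ≫ pact F (X := op Y) (Y := op X) t =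
      pact F (X := op Z) (Y := op X) ((ρ_ P).inv ≫ (t ⊗ₘ f) ≫ eComp V X Y Z) := by
  have h := pact_pact F (X := op Z) (Y := op Y) (Z := op X) f t
  rw [restrict_eq, comp_whiskerRight_assoc]
  refine (congrArg (_ ≫ ·) h).trans ?_
  rw [tensorHom_eComp_op_eq, ← Category.assoc]
  have h2 : (ρ_ (F.obj (op Z))).inv ▷ P ≫ (α_ (F.obj (op Z)) (𝟙_ V) P).hom =
      F.obj (op Z) ◁ (λ_ P).inv := by simp
  rw [h2]
  refine (whiskerLeft_pact F (X := op Z) (Y := op X) _ _).trans ?_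
  rw [leftUnitor_inv_braiding_assoc]

lemma act_restrict (F : EnrichedFunctor V Aᵒᵖ V) {X Y Z : A} {P : V} (f : Mor V X Y)
    (t : P ⟶ hom V Y Z) :
    pact F (X := op Z) (Y := op Y) t ≫ restrict F f =
      pact F (X := op Z) (Y := op X) ((λ_ P).inv ≫ (f ⊗ₘ t) ≫ eComp V X Y Z) := by
  have h := pact_pact F (X := op Z) (Y := op Y) (Z := op X) t f
  rw [restrict_eq, rightUnitor_inv_naturality_assoc]
  refine (congrArg (_ ≫ ·) h).trans ?_
  rw [tensorHom_eComp_op_eq, ← Category.assoc]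
  have h2 : (ρ_ (F.obj (op Z) ⊗ P)).inv ≫ (α_ (F.obj (op Z)) P (𝟙_ V)).hom =
      F.obj (op Z) ◁ (ρ_ P).inv := by simp
  rw [h2]
  refine (whiskerLeft_pact F (X := op Z) (Y := op X) _ _).trans ?_
  rw [rightUnitor_inv_braiding_assoc]

lemma restrict_mcomp (F : EnrichedFunctor V Aᵒᵖ V) {X Y Z : A} (f : Mor V X Y) (g : Mor V Y Z) :
    restrict F (mcomp f g) = restrict F g ≫ restrict F f := by
  rw [restrict_eq F g, Category.assoc, act_restrict, restrict_eq]
  rfl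

/-- Restriction along a `V`-natural family of maps is natural. -/
lemma restrict_natural (F : EnrichedFunctor V Aᵒᵖ V) {Φ Ψ : EnrichedFunctor V C A}
    {θ : ∀ c, Mor V (Φ.obj c) (Ψ.obj c)} (h : IsNat Φ Ψ θ) (c d : C) :
    pact F (X := op (Ψ.obj d)) (Y := op (Ψ.obj c)) (Ψ.map c d) ≫ restrict F (θ c) =
      restrict F (θ d) ▷ hom V c d ≫
        pact F (X := op (Φ.obj d)) (Y := op (Φ.obj c)) (Φ.map c d) := by
  rw [restrict_act, act_restrict, h c d, rightUnitor_inv_braiding_assoc]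

lemma restrict_comp (F : EnrichedFunctor V Aᵒᵖ V) (T : EnrichedFunctor V V V) {X Y : A}
    (f : Mor V X Y) : restrict (F.comp V T) f = onHom T (restrict F f) := by
  rw [restrict_eq, pact_comp_mapAct, pact_restrict, mapAct_rightUnitor]
  exact Iso.inv_hom_id_assoc _ _

/-- The universal transformation `F ⊗ [Aᵒᵖ, V](F, G) ⟶ G` is natural in the object of `A`. Its
naturality square at `f`, read with the presheaf as the variable, is this claim. -/
lemma isNatural_restrict {X Y : A} (f : Mor V X Y) :
    IsNatural (evalF (V := V) (op Y)) (evalF (op X)) (fun F => restrict F f) := by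
  intro F G
  have h := isNatural_pcomp (𝟙 (hom V F G))
  have e : ∀ Z, pcomp (𝟙 (hom V F G)) Z = evN F G Z := fun Z => pact_id _ _ _
  have k := h.pact (X := op Y) (Y := op X) f
  rw [pact_tensR, e, e, pact_restrict, pact_restrict] at k
  change evN F G (op Y) ≫ restrict G f = restrict F f ▷ hom V F G ≫ evN F G (op X)
  have h3 : swapR (F.obj (op Y)) (hom V F G) (𝟙_ V) ≫ (ρ_ (F.obj (op Y))).hom ▷ hom V F G =
      (ρ_ (F.obj (op Y) ⊗ hom V F G)).hom := by
    simp [swapR]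
  have k' : (swapR (F.obj (op Y)) (hom V F G) (𝟙_ V) ≫
      ((ρ_ _).hom ≫ restrict F f) ▷ hom V F G) ≫ evN F G (op X) =
      evN F G (op Y) ▷ (𝟙_ V) ≫ (ρ_ _).hom ≫ restrict G f := k
  rw [rightUnitor_naturality_assoc, Category.assoc, comp_whiskerRight_assoc,
    reassoc_of% h3] at k'
  exact ((cancel_epi _).1 k').symm

end Restrict

section Postcomp

variable {T : EnrichedFunctor V V V}

lemma act_postcomp_evalF (F G : EnrichedFunctor V Aᵒᵖ V) (X : Aᵒᵖ) :
    act ((postcomp T).comp V (evalF X)) F G = mapAct T (act (evalF X) F G) := by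
  rw [act_comp', ← act_comp_mapAct, act_comp', pact_eq_ev, pact_eq_ev]
  have h : (postcomp T).map F G ≫ natπ _ _ X = natπ F G X ≫ T.map _ _ :=
    natLift_π _ _ _ (postcomp_isNat T F G) X
  exact congrArg (fun z => _ ◁ z ≫ ev _ _) h

lemma component_mmap_postcomp {F G : EnrichedFunctor V Aᵒᵖ V} (φ : Mor V F G) (X : Aᵒᵖ) :
    component (mmap (postcomp T) φ) X = onHom T (component φ X) := by
  have h : mmap (postcomp T) φ ≫ natπ _ _ X = mmap T (φ ≫ natπ F G X) := by
    rw [mmap, mmap, Category.assoc, Category.assoc]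
    exact congrArg (φ ≫ ·) (natLift_π _ _ _ (postcomp_isNat T F G) X)
  rw [component, h]
  exact unname_mmap _

end Postcomp

end Presheaves

/-! ### The universal maps `dayι` of the Day tensor -/

section Day

variable {V : Type u} [Category.{v} V] [MonoidalCategory V] [SymmetricCategory V]

/-- Bookkeeping between two conventions: the coend relation has the weight on the left, while
actions place the hom-object on the right. -/
lemma dayE_coherence {M K W L N Z : V} (m : K ⟶ L) (e : W ⊗ L ⟶ N) (c : N ⊗ M ⟶ Z) :
    (β_ (M ⊗ K) W).hom ≫ (α_ W M K).inv ≫ swapR W M K ≫ (W ◁ m ≫ e) ▷ M ≫ c =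
      (α_ M K W).hom ≫ M ◁ (m ▷ W ≫ (β_ L W).hom ≫ e) ≫ (β_ M N).hom ≫ c := by
  have h : (β_ (M ⊗ K) W).hom ≫ (α_ W M K).inv ≫ swapR W M K =
      (α_ M K W).hom ≫ M ◁ (β_ K W).hom ≫ (β_ M (W ⊗ K)).hom := by
    simp [swapR, BraidedCategory.braiding_tensor_left_hom, BraidedCategory.braiding_tensor_right_hom]
  rw [reassoc_of% h, BraidedCategory.braiding_naturality_left_assoc,
    ← BraidedCategory.braiding_naturality_right_assoc M (W ◁ m ≫ e),
    ← MonoidalCategory.whiskerLeft_comp_assoc]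

section OpTensor

variable {A : Type w} [EnrichedCategory V A] (tA : EnrichedFunctor V (A × A) A)

/-- The tensor product of `A` as a `V`-functor `Aᵒᵖ ⊗ Aᵒᵖ ⟶ Aᵒᵖ`. -/
@[simps]
def opTensor : EnrichedFunctor V (Aᵒᵖ × Aᵒᵖ) Aᵒᵖ where
  obj X := op (tA.obj (X.1.unop, X.2.unop))
  map X Y := tA.map (Y.1.unop, Y.2.unop) (X.1.unop, X.2.unop)
  map_id X := tA.map_id (X.1.unop, X.2.unop)
  map_comp X Y Z := by
    have h : eComp V X Y Z = (β_ (hom V X Y) (hom V Y Z)).hom ≫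
        eComp V (Z.1.unop, Z.2.unop) (Y.1.unop, Y.2.unop) (X.1.unop, X.2.unop) := by
      rw [prod_eComp, eComp_op_eq, eComp_op_eq, ← tensorHom_comp_tensorHom]
      refine (Category.assoc _ _ _).symm.trans ((congrArg (· ≫ _) (braiding_tensorμ (hom V X.1 Y.1)
        (hom V X.2 Y.2) (hom V Y.1 Z.1) (hom V Y.2 Z.2)).symm).trans (Category.assoc _ _ _))
    rw [h]
    refine (Category.assoc _ _ _).trans ((congrArg (_ ≫ ·) (tA.map_comp (Z.1.unop, Z.2.unop)
      (Y.1.unop, Y.2.unop) (X.1.unop, X.2.unop))).trans ?_)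
    rw [tensorHom_eComp_op_eq]

/-- The map `A(X', X) ⊗ A(Y', Y) ⟶ A(X' ⊗ Y', X ⊗ Y)`. -/
def opMap (X Y X' Y' : A) : hom V (op X) (op X') ⊗ hom V (op Y) (op Y') ⟶
    hom V (op (tA.obj (X, Y))) (op (tA.obj (X', Y'))) :=
  (opTensor tA).map (op X, op Y) (op X', op Y')

end OpTensor

variable [MonoidalClosed V] [HasLimits V] [HasColimits V]
variable {A : Type v} [EnrichedCategory V A] (tA : EnrichedFunctor V (A × A) A)
variable (F G : EnrichedFunctor V Aᵒᵖ V)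

/-- The action of two `V`-functors on the tensor product of their values. -/
def tact {C : Type w₁} {D : Type w₂} [EnrichedCategory V C] [EnrichedCategory V D]
    (F : EnrichedFunctor V C V) (G : EnrichedFunctor V D V) (X X' : C) (Y Y' : D) :
    (F.obj X ⊗ G.obj Y) ⊗ (hom V X X' ⊗ hom V Y Y') ⟶ F.obj X' ⊗ G.obj Y' :=
  tensorμ (F.obj X) (G.obj Y) (hom V X X') (hom V Y Y') ≫ (act F X X' ⊗ₘ act G Y Y')

lemma act_extTensor_eq_tact {C : Type w₁} {D : Type w₂} [EnrichedCategory V C]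
    [EnrichedCategory V D] (F : EnrichedFunctor V C V) (G : EnrichedFunctor V D V) (X X' : C)
    (Y Y' : D) : act (extTensor F G) (X, Y) (X', Y') = tact F G X X' Y Y' :=
  act_extTensor F G (X, Y) (X', Y')

/-- The map `(F X ⊗ G Y) ⊗ A(C, X ⊗ Y) ⟶ (F ⊗ G)(C)`. -/
def dayE (X Y : A) (C : Aᵒᵖ) :
    (F.obj (op X) ⊗ G.obj (op Y)) ⊗ hom V (op (tA.obj (X, Y))) C ⟶ ((dayTensor tA).obj (F, G)).obj C :=
  (β_ (F.obj (op X) ⊗ G.obj (op Y)) (hom V C.unop (tA.obj (X, Y)))).hom ≫ dayCoproj tA F G C X Y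

/-- The Day tensor of two presheaves. -/
abbrev day : EnrichedFunctor V Aᵒᵖ V := (dayTensor tA).obj (F, G)

/-- The Yoneda step. The presheaf `F ⊗ G` acts by precomposition on the weight, and precomposing the
identity of `X ⊗ Y` with an element of `A(C, X ⊗ Y)` returns that element. So all coprojections are
recovered from `dayι`. -/
lemma dayι_act (X Y : A) (C : Aᵒᵖ) :
    dayι tA F G X Y ▷ hom V (op (tA.obj (X, Y))) C ≫
      act (day tA F G) (op (tA.obj (X, Y))) C = dayE tA F G X Y C := by
  have h := weightedMapLeft_ι (dayArg F G) (dayPre tA (op (tA.obj (X, Y))) C)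
    (dayPre_natural tA (op (tA.obj (X, Y))) C) (X, Y)
  have e : act (day tA F G) (op (tA.obj (X, Y))) C = weightedMapLeft (dayArg F G)
    (dayPre tA (op (tA.obj (X, Y))) C) (dayPre_natural tA (op (tA.obj (X, Y))) C) :=
    act_dayObj _ _ _ _ _
  have h' : dayCoproj tA F G (op (tA.obj (X, Y))) X Y ▷ hom V (op (tA.obj (X, Y))) C ≫
      act (day tA F G) (op (tA.obj (X, Y))) C =
      (swapR (hom V (tA.obj (X, Y)) (tA.obj (X, Y))) (F.obj (op X) ⊗ G.obj (op Y))
        (hom V C.unop (tA.obj (X, Y))) ≫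
      ((β_ (hom V (tA.obj (X, Y)) (tA.obj (X, Y))) (hom V C.unop (tA.obj (X, Y)))).hom ≫
        eComp V C.unop (tA.obj (X, Y)) (tA.obj (X, Y))) ▷ (F.obj (op X) ⊗ G.obj (op Y))) ≫
      dayCoproj tA F G C X Y := by
    rw [e]
    exact h
  rw [dayι, comp_whiskerRight_assoc, comp_whiskerRight_assoc, h']
  -- The unit law of `A`: the identity inserted by `dayι` is absorbed by the precomposition.
  have h2 : eId V (tA.obj (X, Y)) ▷ hom V C.unop (tA.obj (X, Y)) ≫
      (β_ (hom V (tA.obj (X, Y)) (tA.obj (X, Y))) (hom V C.unop (tA.obj (X, Y)))).hom ≫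
        eComp V C.unop (tA.obj (X, Y)) (tA.obj (X, Y)) = (λ_ _).hom := by
    have h := e_comp_id V C.unop (tA.obj (X, Y))
    rw [Iso.inv_comp_eq, Category.comp_id] at h
    rw [BraidedCategory.braiding_naturality_left_assoc, h, braiding_rightUnitor]
  change (λ_ (F.obj (op X) ⊗ G.obj (op Y))).inv ▷ hom V C.unop (tA.obj (X, Y)) ≫
    eId V (tA.obj (X, Y)) ▷ (F.obj (op X) ⊗ G.obj (op Y)) ▷ hom V C.unop (tA.obj (X, Y)) ≫
      (swapR (hom V (tA.obj (X, Y)) (tA.obj (X, Y))) (F.obj (op X) ⊗ G.obj (op Y))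
        (hom V C.unop (tA.obj (X, Y))) ≫
      ((β_ (hom V (tA.obj (X, Y)) (tA.obj (X, Y))) (hom V C.unop (tA.obj (X, Y)))).hom ≫
        eComp V C.unop (tA.obj (X, Y)) (tA.obj (X, Y))) ▷ (F.obj (op X) ⊗ G.obj (op Y))) ≫
      dayCoproj tA F G C X Y =
    (β_ (F.obj (op X) ⊗ G.obj (op Y)) (hom V C.unop (tA.obj (X, Y)))).hom ≫ dayCoproj tA F G C X Y
  rw [Category.assoc, reassoc_of% (swapR_naturality_left (eId V (tA.obj (X, Y)))),
    ← comp_whiskerRight_assoc, h2]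
  simp [swapR]

lemma dayι_pact (X Y : A) {C : Aᵒᵖ} {P : V} (t : P ⟶ hom V (op (tA.obj (X, Y))) C) :
    dayι tA F G X Y ▷ P ≫ pact (day tA F G) t =
      (F.obj (op X) ⊗ G.obj (op Y)) ◁ t ≫ dayE tA F G X Y C := by
  rw [← dayι_act, whisker_exchange_assoc]
  rfl

lemma dayCoproj_condition (C : Aᵒᵖ) (X Y X' Y' : A) :
    (α_ (hom V C.unop (tA.obj (X', Y'))) (F.obj (op X) ⊗ G.obj (op Y)) (hom V X' X ⊗ hom V Y' Y)).hom ≫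
      hom V C.unop (tA.obj (X', Y')) ◁ tact F G (op X) (op X') (op Y) (op Y') ≫
        dayCoproj tA F G C X' Y' =
    swapR (hom V C.unop (tA.obj (X', Y'))) (F.obj (op X) ⊗ G.obj (op Y)) (hom V X' X ⊗ hom V Y' Y) ≫
      (hom V C.unop (tA.obj (X', Y')) ◁ tA.map (X', Y') (X, Y) ≫
        eComp V C.unop (tA.obj (X', Y')) (tA.obj (X, Y))) ▷ (F.obj (op X) ⊗ G.obj (op Y)) ≫
        dayCoproj tA F G C X Y := by
  have h := coend_condition (dayIntegrand tA F G C) (X', Y') (X, Y)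
  have e1 := lact_weighted (dayWeight tA C) (dayArg F G) (X', Y') (X, Y)
  have e2 := ract_weighted (dayWeight tA C) (dayArg F G) (X', Y') (X, Y)
  rw [act_dayArg] at e1
  rw [act_dayWeight] at e2
  rw [tact]
  have h' := (congrArg (· ≫ _) e1).symm.trans (h.trans (congrArg (· ≫ _) e2))
  exact (Category.assoc _ _ _).symm.trans (h'.trans (Category.assoc _ _ _))

/-- The coend relation with the weight moved to the right: acting on `F X ⊗ G Y` by a pair of
morphisms amounts to composing their tensor product into the weight. -/
lemma dayE_natural (C : Aᵒᵖ) (X Y X' Y' : A) :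
    tact F G (op X) (op X') (op Y) (op Y') ▷ hom V (op (tA.obj (X', Y'))) C ≫
      dayE tA F G X' Y' C =
    (α_ _ _ _).hom ≫ (F.obj (op X) ⊗ G.obj (op Y)) ◁
      (opMap tA X Y X' Y' ▷ hom V (op (tA.obj (X', Y'))) C ≫
        eComp V (op (tA.obj (X, Y))) (op (tA.obj (X', Y'))) C) ≫ dayE tA F G X Y C := by
  have h := dayCoproj_condition tA F G C X Y X' Y'
  rw [← Iso.eq_inv_comp] at h
  change tact F G (op X) (op X') (op Y) (op Y') ▷ hom V C.unop (tA.obj (X', Y')) ≫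
      (β_ (F.obj (op X') ⊗ G.obj (op Y')) (hom V C.unop (tA.obj (X', Y')))).hom ≫
        dayCoproj tA F G C X' Y' =
    (α_ (F.obj (op X) ⊗ G.obj (op Y)) (hom V X' X ⊗ hom V Y' Y)
      (hom V C.unop (tA.obj (X', Y')))).hom ≫ (F.obj (op X) ⊗ G.obj (op Y)) ◁
      (tA.map (X', Y') (X, Y) ▷ hom V C.unop (tA.obj (X', Y')) ≫
        (β_ (hom V (tA.obj (X', Y')) (tA.obj (X, Y))) (hom V C.unop (tA.obj (X', Y')))).hom ≫
        eComp V C.unop (tA.obj (X', Y')) (tA.obj (X, Y))) ≫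
      (β_ (F.obj (op X) ⊗ G.obj (op Y)) (hom V C.unop (tA.obj (X, Y)))).hom ≫
        dayCoproj tA F G C X Y
  refine (BraidedCategory.braiding_naturality_left_assoc _ _ _).trans ?_
  refine (congrArg (_ ≫ ·) h).trans ?_
  exact dayE_coherence _ _ _

lemma dayι_eq (X Y : A) : dayι tA F G X Y =
    (ρ_ _).inv ≫ (F.obj (op X) ⊗ G.obj (op Y)) ◁ eId V (op (tA.obj (X, Y))) ≫
      dayE tA F G X Y (op (tA.obj (X, Y))) := by
  rw [← dayι_pact, pact_eId, rightUnitor_naturality, Iso.inv_hom_id_assoc]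

/-- This is `dayE_natural` at `C = X' ⊗ Y'`, with the identity inserted in the weight. -/
lemma isNatural_dayι :
    IsNatural (extTensor F G) ((opTensor tA).comp V (day tA F G))
      (fun X => dayι tA F G X.1.unop X.2.unop) := by
  rintro ⟨⟨X⟩, ⟨Y⟩⟩ ⟨⟨X'⟩, ⟨Y'⟩⟩
  rw [act_comp', act_extTensor_eq_tact]
  change tact F G (op X) (op X') (op Y) (op Y') ≫ dayι tA F G X' Y' =
    dayι tA F G X Y ▷ (hom V (op X) (op X') ⊗ hom V (op Y) (op Y')) ≫
      pact (day tA F G) (opMap tA X Y X' Y')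
  rw [dayι_pact, dayι_eq]
  have h := dayE_natural tA F G (op (tA.obj (X', Y'))) X Y X' Y'
  rw [rightUnitor_inv_naturality_assoc, ← whisker_exchange_assoc]
  refine (congrArg (fun z => _ ≫ _ ≫ z) h).trans ?_
  have h2 : (ρ_ _).inv ≫ _ ◁ eId V (op (tA.obj (X', Y'))) ≫ opMap tA X Y X' Y' ▷ _ ≫
      eComp V (op (tA.obj (X, Y))) (op (tA.obj (X', Y'))) (op (tA.obj (X', Y'))) =
      opMap tA X Y X' Y' := by
    rw [whisker_exchange_assoc, ← rightUnitor_inv_naturality_assoc, e_comp_id, Category.comp_id]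
  rw [associator_naturality_right_assoc, ← MonoidalCategory.whiskerLeft_comp_assoc,
    rightUnitor_tensor_inv, Category.assoc, Iso.inv_hom_id_assoc,
    ← MonoidalCategory.whiskerLeft_comp_assoc, h2]

lemma dayMapAt_natural (F F' G G' : EnrichedFunctor V Aᵒᵖ V) :
    IsNat (dayObj tA F G) (dayObj tA F' G') (fun C => lam (dayMapAt tA F F' G G' C)) := by
  rw [isNat_act]
  intro C C'
  rw [lam_ev, lam_ev, act_dayObj, act_dayObj]
  exact weightedMap_exchange _ _ _ _

/-- The action of presheaf maps on the Day tensor. -/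
def dayAct (F F' G G' : EnrichedFunctor V Aᵒᵖ V) (C : Aᵒᵖ) :
    (day tA F G).obj C ⊗ (hom V F F' ⊗ hom V G G') ⟶ (day tA F' G').obj C :=
  pcomp ((dayTensor tA).map (F, G) (F', G')) C

lemma dayAct_eq (F F' G G' : EnrichedFunctor V Aᵒᵖ V) (C : Aᵒᵖ) :
    dayAct tA F F' G G' C = dayMapAt tA F F' G G' C := by
  have h2 : (dayTensor tA).map (F, G) (F', G') ≫ natπ _ _ C = lam (dayMapAt tA F F' G G' C) :=
    natLift_π (dayObj tA F G) (dayObj tA F' G') _ (dayMapAt_natural tA F F' G G') C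
  have h3 := pact_eq_ev (evalF C) ((dayTensor tA).map (F, G) (F', G'))
  exact h3.trans ((congrArg (fun z => _ ◁ z ≫ ev _ _) h2).trans (lam_ev _))

/-- Presheaf maps act on the factor `F X ⊗ G Y` of the integrand and leave the weight alone, so the
identity inserted by `dayι` survives. -/
lemma dayι_dayAct (F F' G G' : EnrichedFunctor V Aᵒᵖ V) (X Y : A) :
    dayι tA F G X Y ▷ (hom V F F' ⊗ hom V G G') ≫ dayAct tA F F' G G' (op (tA.obj (X, Y))) =
      tensorμ (F.obj (op X)) (G.obj (op Y)) (hom V F F') (hom V G G') ≫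
        (evN F F' (op X) ⊗ₘ evN G G' (op Y)) ≫ dayι tA F' G' X Y := by
  have h4 : dayCoproj tA F G (op (tA.obj (X, Y))) X Y ▷ (hom V F F' ⊗ hom V G G') ≫
      dayAct tA F F' G G' (op (tA.obj (X, Y))) =
      ((α_ (hom V (tA.obj (X, Y)) (tA.obj (X, Y))) (F.obj (op X) ⊗ G.obj (op Y))
        (hom V F F' ⊗ hom V G G')).hom ≫ hom V (tA.obj (X, Y)) (tA.obj (X, Y)) ◁
        (tensorμ (F.obj (op X)) (G.obj (op Y)) (hom V F F') (hom V G G') ≫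
          (evN F F' (op X) ⊗ₘ evN G G' (op Y)))) ≫
        dayCoproj tA F' G' (op (tA.obj (X, Y))) X Y := by
    rw [dayAct_eq]
    exact weightedMapRight_ι (dayWeight tA (op (tA.obj (X, Y)))) (dayArgMap F F' G G')
      (dayArgMap_natural F F' G G') (X, Y)
  rw [dayι, comp_whiskerRight_assoc, comp_whiskerRight_assoc]
  refine (congrArg (fun z => _ ≫ _ ≫ z) h4).trans ?_
  have h : ∀ {M P N Z : V} (θ : M ⊗ P ⟶ N) (g : 𝟙_ V ⊗ N ⟶ Z), (λ_ M).inv ▷ P ≫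
      (α_ (𝟙_ V) M P).hom ≫ 𝟙_ V ◁ θ ≫ g = θ ≫ (λ_ N).inv ≫ g := by
    intros; simp
  rw [Category.assoc, associator_naturality_left_assoc, ← whisker_exchange_assoc, dayι, h,
    Category.assoc]

lemma dayι_dayMap {F G F' G' : EnrichedFunctor V Aᵒᵖ V} {P Q : V} (s : P ⟶ hom V F F')
    (t : Q ⟶ hom V G G') (X Y : A) :
    dayι tA F G X Y ▷ (P ⊗ Q) ≫
      pcomp ((s ⊗ₘ t) ≫ (dayTensor tA).map (F, G) (F', G')) (op (tA.obj (X, Y))) =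
    tensorμ _ _ P Q ≫ (pcomp s (op X) ⊗ₘ pcomp t (op Y)) ≫ dayι tA F' G' X Y := by
  have h1 : pcomp ((s ⊗ₘ t) ≫ (dayTensor tA).map (F, G) (F', G')) (op (tA.obj (X, Y))) =
      (day tA F G).obj (op (tA.obj (X, Y))) ◁ (s ⊗ₘ t) ≫
        dayAct tA F F' G G' (op (tA.obj (X, Y))) :=
    (whiskerLeft_pact (evalF (op (tA.obj (X, Y)))) _ _).symm
  rw [h1]
  refine (whisker_exchange_assoc _ _ _).symm.trans ((congrArg (_ ≫ ·)
    (dayι_dayAct tA F F' G G' X Y)).trans ?_)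
  rw [tensorμ_natural_right_assoc, tensorHom_comp_tensorHom_assoc]
  rfl

/-- The counterpart of `isNatural_dayι` with `X`, `Y` fixed and the two presheaves varying. It makes
`dayι` usable as a generating family for transformations between functors on presheaves. -/
lemma isNatural_dayι_presheaf (X Y : A) :
    IsNatural (extTensor (evalF (V := V) (op X)) (evalF (op Y)))
      ((dayTensor tA).comp V (evalF (op (tA.obj (X, Y)))))
      (fun P => dayι tA P.1 P.2 X Y) := by
  rintro ⟨F, G⟩ ⟨F', G'⟩
  have h := dayι_dayMap tA (𝟙 (hom V F F')) (𝟙 (hom V G G')) X Y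
  rw [act_comp', act_extTensor_eq_tact]
  rw [id_tensorHom_id, Category.id_comp] at h
  refine Eq.trans ?_ h.symm
  rw [tact, pcomp, pcomp, pact_id, pact_id]
  exact Category.assoc _ _ _

lemma dayι_mtensor {F G F' G' : EnrichedFunctor V Aᵒᵖ V} (φ : Mor V F F') (ψ : Mor V G G')
    (X Y : A) : dayι tA F G X Y ≫ component (mtensor (dayTensor tA) φ ψ) (op (tA.obj (X, Y))) =
      (component φ (op X) ⊗ₘ component ψ (op Y)) ≫ dayι tA F' G' X Y := by
  have h := dayι_dayMap tA φ ψ X Y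
  rw [pcomp_mor, pcomp_mor, ← tensorHom_comp_tensorHom, Category.assoc] at h
  have h2 : pcomp (mtensor (dayTensor tA) φ ψ) (op (tA.obj (X, Y))) =
      (day tA F G).obj (op (tA.obj (X, Y))) ◁ (λ_ (𝟙_ V)).inv ≫
        pcomp ((φ ⊗ₘ ψ) ≫ (dayTensor tA).map (F, G) (F', G')) (op (tA.obj (X, Y))) :=
    (whiskerLeft_pact (evalF (op (tA.obj (X, Y)))) _ _).symm
  have h3 := tensor_right_unitality (F.obj (op X)) (G.obj (op Y))
  rw [component_eq, h2, rightUnitor_inv_naturality_assoc]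
  rw [← whisker_exchange_assoc, h, ← reassoc_of% h3, Iso.inv_hom_id_assoc]

section Ext

variable {tA F G}

/-- Since `V` is closed, tensoring with `P` preserves the joint epimorphicity of the coprojections.
-/
lemma day_hom_ext {C : Aᵒᵖ} {P Z : V} {f g : (day tA F G).obj C ⊗ P ⟶ Z}
    (h : ∀ X Y, dayE tA F G X Y C ▷ P ≫ f = dayE tA F G X Y C ▷ P ≫ g) : f = g := by
  apply coend_whisker_hom_ext (dayIntegrand tA F G C)
  rintro ⟨X, Y⟩
  have h' := h X Y
  rw [dayE, comp_whiskerRight_assoc, comp_whiskerRight_assoc] at h'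
  exact (cancel_epi (whiskerRightIso (β_ (F.obj (op X) ⊗ G.obj (op Y))
    (hom V C.unop (tA.obj (X, Y)))) P).hom).1 h'

/-- By `dayι_act` a coprojection is `dayι` followed by an action, and naturality carries that action
over to `K`. Hence a natural map out of `F ⊗ G` is determined by its restriction along the `dayι`,
with any parameter. -/
lemma day_natural_ext {K : EnrichedFunctor V Aᵒᵖ V} {P : V}
    {f g : ∀ C, (day tA F G).obj C ⊗ P ⟶ K.obj C} (hf : IsNatural (tensR (day tA F G) P) K f)
    (hg : IsNatural (tensR (day tA F G) P) K g)
    (h : ∀ X Y, dayι tA F G X Y ▷ P ≫ f (op (tA.obj (X, Y))) =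
      dayι tA F G X Y ▷ P ≫ g (op (tA.obj (X, Y)))) (C : Aᵒᵖ) : f C = g C := by
  apply day_hom_ext
  intro X Y
  have key : ∀ {f : ∀ C, (day tA F G).obj C ⊗ P ⟶ K.obj C},
      IsNatural (tensR (day tA F G) P) K f → dayE tA F G X Y C ▷ P ≫ f C =
        swapR _ _ _ ≫ (dayι tA F G X Y ▷ P ≫ f (op (tA.obj (X, Y)))) ▷ _ ≫
          act K (op (tA.obj (X, Y))) C := by
    intro f hf
    have e := hf (op (tA.obj (X, Y))) C
    rw [act_tensR] at e
    have e' : swapR ((day tA F G).obj (op (tA.obj (X, Y)))) P (hom V (op (tA.obj (X, Y))) C) ≫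
        act (day tA F G) (op (tA.obj (X, Y))) C ▷ P ≫ f C =
        f (op (tA.obj (X, Y))) ▷ hom V (op (tA.obj (X, Y))) C ≫ act K (op (tA.obj (X, Y))) C :=
      (Category.assoc _ _ _).symm.trans e
    rw [← dayι_act, comp_whiskerRight_assoc, comp_whiskerRight_assoc, ← e',
      reassoc_of% (swapR_naturality_left (dayι tA F G X Y)),
      reassoc_of% (swapR_swapR (F.obj (op X) ⊗ G.obj (op Y)))]
  rw [key hf, key hg, h]

end Ext

end Day

/-! ### Natural maps out of a Day tensor, with a parameter -/

section DayDesc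

variable {V : Type u} [Category.{v} V] [MonoidalCategory V] [SymmetricCategory V]
  [MonoidalClosed V]

lemma IsNatural.tensR_act {C : Type w} [EnrichedCategory V C] {N L : EnrichedFunctor V C V} {P : V}
    {b : ∀ X, N.obj X ⊗ P ⟶ L.obj X} (hb : IsNatural (tensR N P) L b) (X Y : C) :
    act N X Y ▷ P ≫ b Y = swapR (N.obj X) (hom V X Y) P ≫ b X ▷ hom V X Y ≫ act L X Y := by
  have h := hb X Y
  rw [act_tensR] at h
  have h' : swapR (N.obj X) P (hom V X Y) ≫ act N X Y ▷ P ≫ b Y =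
      b X ▷ hom V X Y ≫ act L X Y := (Category.assoc _ _ _).symm.trans h
  rw [← h', reassoc_of% (swapR_swapR (N.obj X) (hom V X Y) P)]

/-- The coend relation for a descending family, stripped of functors. Here `h₁` plays the role of
naturality of the family, with `q` as the action on the target, and `h₂` that of functoriality of
the target. What remains is an identity of permutations of `W`, `M`, `H`, `P`. -/
lemma desc_coherence {W W₂ M M' H P K K' Z : V} {m : M ⊗ H ⟶ M'} {b' : M' ⊗ P ⟶ K'}
    {b : M ⊗ P ⟶ K} {q : K ⊗ H ⟶ K'} {r : K' ⊗ W ⟶ Z} {a : W ⊗ H ⟶ W₂} {r₂ : K ⊗ W₂ ⟶ Z}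
    (h₁ : m ▷ P ≫ b' = swapR M H P ≫ b ▷ H ≫ q)
    (h₂ : q ▷ W ≫ r = (α_ K H W).hom ≫ K ◁ ((β_ H W).hom ≫ a) ≫ r₂) :
    ((α_ W M H).hom ≫ W ◁ m) ▷ P ≫ (β_ W M').hom ▷ P ≫ swapR M' W P ≫ b' ▷ W ≫ r =
      (swapR W M H ≫ a ▷ M) ▷ P ≫ (β_ W₂ M).hom ▷ P ≫ swapR M W₂ P ≫ b ▷ W₂ ≫ r₂ := by
  have e₁ : (W ◁ m) ▷ P ≫ (β_ W M').hom ▷ P ≫ swapR M' W P ≫ b' ▷ W ≫ r =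
      (β_ W (M ⊗ H)).hom ▷ P ≫ swapR (M ⊗ H) W P ≫ swapR M H P ▷ W ≫ b ▷ H ▷ W ≫ q ▷ W ≫ r := by
    rw [← comp_whiskerRight_assoc, BraidedCategory.braiding_naturality_right,
      comp_whiskerRight_assoc, reassoc_of% (swapR_naturality_left m W P), ← comp_whiskerRight_assoc,
      h₁, comp_whiskerRight_assoc, comp_whiskerRight_assoc]
  have e₂ : a ▷ M ▷ P ≫ (β_ W₂ M).hom ▷ P ≫ swapR M W₂ P ≫ b ▷ W₂ ≫ r₂ =
      (β_ (W ⊗ H) M).hom ▷ P ≫ swapR M (W ⊗ H) P ≫ b ▷ (W ⊗ H) ≫ K ◁ a ≫ r₂ := by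
    rw [← comp_whiskerRight_assoc, BraidedCategory.braiding_naturality_left,
      comp_whiskerRight_assoc, reassoc_of% (swapR_naturality_middle M a P),
      whisker_exchange_assoc]
  have e₃ : (α_ W M H).hom ▷ P ≫ (β_ W (M ⊗ H)).hom ▷ P ≫ swapR (M ⊗ H) W P ≫ swapR M H P ▷ W ≫
      (α_ (M ⊗ P) H W).hom ≫ (M ⊗ P) ◁ (β_ H W).hom =
      swapR W M H ▷ P ≫ (β_ (W ⊗ H) M).hom ▷ P ≫ swapR M (W ⊗ H) P := by
    have hs : swapR W M H ≫ (β_ (W ⊗ H) M).hom =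
        (β_ W M).hom ▷ H ≫ (α_ M W H).hom := by
      have h : W ◁ (β_ M H).hom ≫ W ◁ (β_ H M).hom = 𝟙 _ := by
        simp [← MonoidalCategory.whiskerLeft_comp]
      simp [swapR, BraidedCategory.braiding_tensor_left_hom, reassoc_of% h]
    -- Yang–Baxter for `W`, `H`, `P`, with one braiding moved to the other side by symmetry.
    have hy : (β_ W H).hom ▷ P ≫ (α_ H W P).hom ≫ H ◁ (β_ W P).hom ≫ (α_ H P W).inv ≫
        (β_ H P).hom ▷ W ≫ (α_ P H W).hom ≫ P ◁ (β_ H W).hom =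
        (α_ W H P).hom ≫ W ◁ (β_ H P).hom ≫ (α_ W P H).inv ≫ (β_ W P).hom ▷ H ≫
          (α_ P W H).hom := by
      have h := BraidedCategory.yang_baxter W H P
      rw [Iso.inv_comp_eq] at h
      rw [reassoc_of% h, ← MonoidalCategory.whiskerLeft_comp, SymmetricCategory.symmetry]
      simp
    have hy' := congrArg (fun z => M ◁ z) hy
    simp only [MonoidalCategory.whiskerLeft_comp] at hy'
    rw [← comp_whiskerRight_assoc (swapR W M H), hs, BraidedCategory.braiding_tensor_right_hom]
    simp only [swapR, comp_whiskerRight, Category.assoc]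
    simp [reassoc_of% hy']
  rw [comp_whiskerRight_assoc, comp_whiskerRight_assoc, e₁, e₂, h₂,
    associator_naturality_left_assoc, MonoidalCategory.whiskerLeft_comp_assoc,
    ← whisker_exchange_assoc, reassoc_of% e₃]

lemma desc_natural_coherence {M P K W H W' Z : V} (b : M ⊗ P ⟶ K) (c : W ⊗ H ⟶ W')
    (r : K ⊗ W' ⟶ Z) :
    swapR (M ⊗ W) P H ≫ ((α_ M W H).hom ≫ M ◁ c) ▷ P ≫ swapR M W' P ≫ b ▷ W' ≫ r =
      (swapR M W P ≫ b ▷ W) ▷ H ≫ (α_ K W H).hom ≫ K ◁ c ≫ r := by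
  have e : swapR (M ⊗ W) P H ≫ (α_ M W H).hom ▷ P ≫ swapR M (W ⊗ H) P =
      swapR M W P ▷ H ≫ (α_ (M ⊗ P) W H).hom := by
    rw [swapR_coh₁ M W H P, reassoc_of% (swapR_swapR (M ⊗ W) P H)]
  rw [comp_whiskerRight_assoc, reassoc_of% (swapR_naturality_middle M c P),
    whisker_exchange_assoc, reassoc_of% e, comp_whiskerRight_assoc,
    associator_naturality_left_assoc]

variable [HasColimits V]

section CoendDesc

variable {K : Type v} [EnrichedCategory V K]

/-- The universal property of `(∫^k H(k, k)) ⊗ W`. -/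
def coendDescR (H : EnrichedFunctor V (Kᵒᵖ × K) V) {W Z : V} (ψ : ∀ k, H.obj (op k, k) ⊗ W ⟶ Z)
    (hψ : ∀ k l, lact H k l ▷ W ≫ ψ k = ract H k l ▷ W ≫ ψ l) : coend H ⊗ W ⟶ Z :=
  (β_ _ _).hom ≫ W ◁ coendDesc H (fun k => lam ((β_ _ _).hom ≫ ψ k))
    (fun k l => by
      rw [lam_natural, lam_natural, BraidedCategory.braiding_naturality_right_assoc,
        BraidedCategory.braiding_naturality_right_assoc, hψ k l]) ≫ ev W Z

lemma coendι_descR (H : EnrichedFunctor V (Kᵒᵖ × K) V) {W Z : V}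
    (ψ : ∀ k, H.obj (op k, k) ⊗ W ⟶ Z) (hψ) (k : K) :
    coendι H k ▷ W ≫ coendDescR H ψ hψ = ψ k := by
  rw [coendDescR, BraidedCategory.braiding_naturality_left_assoc,
    ← MonoidalCategory.whiskerLeft_comp_assoc, coendι_desc, lam_ev,
    SymmetricCategory.symmetry_assoc]

end CoendDesc

variable [HasLimits V]
variable {A : Type v} [EnrichedCategory V A] (tA : EnrichedFunctor V (A × A) A)
variable (F G : EnrichedFunctor V Aᵒᵖ V)

lemma dayE_act (X Y : A) (C C' : Aᵒᵖ) :
    dayE tA F G X Y C ▷ hom V C C' ≫ act (day tA F G) C C' =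
      (α_ (F.obj (op X) ⊗ G.obj (op Y)) (hom V (op (tA.obj (X, Y))) C) (hom V C C')).hom ≫
        (F.obj (op X) ⊗ G.obj (op Y)) ◁ eComp V (op (tA.obj (X, Y))) C C' ≫
          dayE tA F G X Y C' := by
  have h := act_comp (day tA F G) (op (tA.obj (X, Y))) C C'
  rw [← dayι_act, ← dayι_act, whisker_exchange_assoc, h, comp_whiskerRight_assoc,
    associator_inv_naturality_left_assoc, Iso.hom_inv_id_assoc]

variable {tA F G} {K : EnrichedFunctor V Aᵒᵖ V} {P : V}
  (b : ∀ X Y : A, (F.obj (op X) ⊗ G.obj (op Y)) ⊗ P ⟶ K.obj (op (tA.obj (X, Y))))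

/-- Naturality of `b` trades the actions of `F` and `G` for the action of `K` along `f ⊗ g`, and
functoriality of `K` merges this with the weight. That is exactly the relation imposed by the coend.
-/
lemma dayDesc_condition (hb : IsNatural (tensR (extTensor F G) P) ((opTensor tA).comp V K)
      (fun X => b X.1.unop X.2.unop)) (C : Aᵒᵖ) (k l : A × A) :
    lact (dayIntegrand tA F G C) k l ▷ P ≫
      (β_ (hom V C.unop (tA.obj k)) (F.obj (op k.1) ⊗ G.obj (op k.2))).hom ▷ P ≫
        swapR _ _ P ≫ b k.1 k.2 ▷ hom V C.unop (tA.obj k) ≫ act K (op (tA.obj k)) C =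
    ract (dayIntegrand tA F G C) k l ▷ P ≫
      (β_ (hom V C.unop (tA.obj l)) (F.obj (op l.1) ⊗ G.obj (op l.2))).hom ▷ P ≫
        swapR _ _ P ≫ b l.1 l.2 ▷ hom V C.unop (tA.obj l) ≫ act K (op (tA.obj l)) C := by
  have e1 := lact_weighted (dayWeight tA C) (dayArg F G) k l
  have e2 := ract_weighted (dayWeight tA C) (dayArg F G) k l
  rw [act_dayArg] at e1
  rw [act_dayWeight] at e2
  have hb' := hb.tensR_act (op l.1, op l.2) (op k.1, op k.2)
  rw [act_extTensor, act_comp'] at hb'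
  have h1 : (tensorμ (F.obj (op l.1)) (G.obj (op l.2)) (hom V k.1 l.1) (hom V k.2 l.2) ≫
        (act F (op l.1) (op k.1) ⊗ₘ act G (op l.2) (op k.2))) ▷ P ≫ b k.1 k.2 =
      swapR (F.obj (op l.1) ⊗ G.obj (op l.2)) (hom V k.1 l.1 ⊗ hom V k.2 l.2) P ≫
        b l.1 l.2 ▷ (hom V k.1 l.1 ⊗ hom V k.2 l.2) ≫
          pact K (opMap tA l.1 l.2 k.1 k.2) := hb'
  have h2 : pact K (opMap tA l.1 l.2 k.1 k.2) ▷ hom V C.unop (tA.obj k) ≫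
      act K (op (tA.obj k)) C = (α_ (K.obj (op (tA.obj l))) (hom V k.1 l.1 ⊗ hom V k.2 l.2)
        (hom V C.unop (tA.obj k))).hom ≫ K.obj (op (tA.obj l)) ◁
          ((β_ (hom V k.1 l.1 ⊗ hom V k.2 l.2) (hom V C.unop (tA.obj k))).hom ≫
            hom V C.unop (tA.obj k) ◁ tA.map k l ≫ eComp V C.unop (tA.obj k) (tA.obj l)) ≫
        act K (op (tA.obj l)) C := by
    have h := pact_pact K (opMap tA l.1 l.2 k.1 k.2) (𝟙 (hom V (op (tA.obj k)) C))
    rw [pact_id] at h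
    refine h.trans (congrArg (fun z => _ ≫ K.obj (op (tA.obj l)) ◁ z ≫ act K _ _) ?_)
    rw [MonoidalCategory.tensorHom_id]
    exact BraidedCategory.braiding_naturality_left_assoc (tA.map k l) (hom V C.unop (tA.obj k)) _
  refine (congrArg (fun z => z ▷ P ≫ _) e1).trans ?_
  refine Eq.trans ?_ (congrArg (fun z => z ▷ P ≫ _) e2).symm
  exact desc_coherence h1 h2

/-- The universal property of `(F ⊗ G)(C) ⊗ P`. -/
def dayDescR (hb : IsNatural (tensR (extTensor F G) P) ((opTensor tA).comp V K)
      (fun X => b X.1.unop X.2.unop)) (C : Aᵒᵖ) : (day tA F G).obj C ⊗ P ⟶ K.obj C :=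
  coendDescR (dayIntegrand tA F G C) (fun k =>
      (β_ (hom V C.unop (tA.obj k)) (F.obj (op k.1) ⊗ G.obj (op k.2))).hom ▷ P ≫
        swapR _ _ P ≫ b k.1 k.2 ▷ hom V C.unop (tA.obj k) ≫ act K (op (tA.obj k)) C)
    (dayDesc_condition b hb C)

variable (hb : IsNatural (tensR (extTensor F G) P) ((opTensor tA).comp V K)
  (fun X => b X.1.unop X.2.unop))

lemma dayE_descR (X Y : A) (C : Aᵒᵖ) :
    dayE tA F G X Y C ▷ P ≫ dayDescR b hb C =
      swapR (F.obj (op X) ⊗ G.obj (op Y)) (hom V (op (tA.obj (X, Y))) C) P ≫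
        b X Y ▷ hom V (op (tA.obj (X, Y))) C ≫ act K (op (tA.obj (X, Y))) C := by
  have h : dayCoproj tA F G C X Y ▷ P ≫ dayDescR b hb C = _ := coendι_descR _ _ _ (X, Y)
  rw [dayE, comp_whiskerRight_assoc]
  refine (congrArg (fun z => _ ≫ z) h).trans ?_
  have e : (β_ (F.obj (op X) ⊗ G.obj (op Y)) (hom V C.unop (tA.obj (X, Y)))).hom ▷ P ≫
      (β_ (hom V C.unop (tA.obj (X, Y))) (F.obj (op X) ⊗ G.obj (op Y))).hom ▷ P = 𝟙 _ := by
    rw [← comp_whiskerRight, SymmetricCategory.symmetry, id_whiskerRight]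
  exact (reassoc_of% e) _

/-- On coprojections the map is `b` followed by the action of `K`, so naturality in `C` is
associativity of that action. -/
lemma isNatural_dayDescR : IsNatural (tensR (day tA F G) P) K (dayDescR b hb) := by
  intro C C'
  rw [act_tensR]
  change (swapR ((day tA F G).obj C) P (hom V C C') ≫ act (day tA F G) C C' ▷ P) ≫
    dayDescR b hb C' = dayDescR b hb C ▷ hom V C C' ≫ act K C C'
  -- The parameter and the hom-object are merged into one parameter, so that `day_hom_ext` applies.
  rw [← cancel_epi (α_ _ P (hom V C C')).inv]
  apply day_hom_ext
  intro X Y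
  have h := act_comp K (op (tA.obj (X, Y))) C C'
  rw [Iso.eq_inv_comp] at h
  rw [associator_inv_naturality_left_assoc, associator_inv_naturality_left_assoc,
    ← comp_whiskerRight_assoc _ (dayDescR b hb C), dayE_descR, Category.assoc,
    reassoc_of% (swapR_naturality_left (dayE tA F G X Y C)), ← comp_whiskerRight_assoc, dayE_act,
    comp_whiskerRight_assoc, comp_whiskerRight_assoc, dayE_descR, comp_whiskerRight_assoc,
    comp_whiskerRight_assoc, ← h]
  have e := desc_natural_coherence (b X Y) (eComp V (op (tA.obj (X, Y))) C C')
    (act K (op (tA.obj (X, Y))) C')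
  simp only [comp_whiskerRight, Category.assoc] at e
  exact congrArg (fun z => _ ≫ z) e

/-- Here `dayι` is the coprojection at an identity, and identities act trivially on `K`. -/
lemma dayι_descR (X Y : A) :
    dayι tA F G X Y ▷ P ≫ dayDescR b hb (op (tA.obj (X, Y))) = b X Y := by
  have h : ∀ {M W P K : V} (i : 𝟙_ V ⟶ W) (b : M ⊗ P ⟶ K) {Z : V} (r : K ⊗ W ⟶ Z),
      (ρ_ M).inv ▷ P ≫ (M ◁ i) ▷ P ≫ swapR M W P ≫ b ▷ W ≫ r =
        b ≫ (ρ_ K).inv ≫ K ◁ i ≫ r := by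
    intro M W P K i b Z r
    rw [reassoc_of% (swapR_naturality_middle M i P), whisker_exchange_assoc,
      rightUnitor_inv_naturality_assoc]
    simp [swapR]
  rw [dayι_eq, comp_whiskerRight_assoc, comp_whiskerRight_assoc, dayE_descR, h, act_id,
    Iso.inv_hom_id, Category.comp_id]

end DayDesc

/-! ### Reindexing natural families and fixing one variable -/

section Precomp

variable {V : Type u} [Category.{v} V] [MonoidalCategory V] [SymmetricCategory V]
  [MonoidalClosed V]
variable {C : Type w₁} {D : Type w₂} {E : Type w₃}
  [EnrichedCategory V C] [EnrichedCategory V D] [EnrichedCategory V E]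

lemma act_comp_assoc (J : EnrichedFunctor V C D) (L : EnrichedFunctor V D E)
    (F : EnrichedFunctor V E V) (X Y : C) :
    act (J.comp V (L.comp V F)) X Y = act ((J.comp V L).comp V F) X Y := by
  rw [act_comp', act_comp']
  exact pact_functor_comp L F (J.map X Y)

lemma act_comp_tensR (J : EnrichedFunctor V C D) (F : EnrichedFunctor V D V) (P : V) (X Y : C) :
    act (J.comp V (tensR F P)) X Y = act (tensR (J.comp V F) P) X Y := by
  rw [act_comp', pact_tensR, act_tensR, act_comp']
  rfl

lemma IsNatural.precomp_tensR {F G : EnrichedFunctor V D V} {P : V}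
    {b : ∀ X, F.obj X ⊗ P ⟶ G.obj X} (hb : IsNatural (tensR F P) G b)
    (J : EnrichedFunctor V C D) :
    IsNatural (tensR (J.comp V F) P) (J.comp V G) (fun X => b (J.obj X)) :=
  fun X Y => (congrArg (· ≫ b (J.obj Y)) (act_comp_tensR J F P X Y)).symm.trans
    (hb.precomp J X Y)

lemma IsNatural.extTensor_fst {F : EnrichedFunctor V C V} {G : EnrichedFunctor V D V}
    {L : EnrichedFunctor V (C × D) V} {b : ∀ X : C × D, F.obj X.1 ⊗ G.obj X.2 ⟶ L.obj X}
    (hb : IsNatural (extTensor F G) L b) (d : D) :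
    IsNatural (tensR F (G.obj d)) ((insertRight d).comp V L) (fun c => b (c, d)) :=
  fun X Y => (congrArg (· ≫ b (Y, d)) (act_insertRight_extTensor F G d X Y)).symm.trans
    (hb.precomp (insertRight d) X Y)

lemma IsNatural.extTensor_snd {F : EnrichedFunctor V C V} {G : EnrichedFunctor V D V}
    {L : EnrichedFunctor V (C × D) V} {b : ∀ X : C × D, F.obj X.1 ⊗ G.obj X.2 ⟶ L.obj X}
    (hb : IsNatural (extTensor F G) L b) (c : C) :
    IsNatural (tensL (F.obj c) G) ((insertLeft c).comp V L) (fun d => b (c, d)) :=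
  fun X Y => (congrArg (· ≫ b (c, Y)) (act_insertLeft_extTensor F G c X Y)).symm.trans
    (hb.precomp (insertLeft c) X Y)

lemma isNatural_extTensor {F : EnrichedFunctor V C V} {G : EnrichedFunctor V D V}
    {L : EnrichedFunctor V (C × D) V} {b : ∀ X : C × D, F.obj X.1 ⊗ G.obj X.2 ⟶ L.obj X}
    (h₁ : ∀ d, IsNatural (tensR F (G.obj d)) ((insertRight d).comp V L) (fun c => b (c, d)))
    (h₂ : ∀ c, IsNatural (tensL (F.obj c) G) ((insertLeft c).comp V L) (fun d => b (c, d))) :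
    IsNatural (extTensor F G) L b := by
  apply isNatural_of_partial
  · intro c c' d
    have h := h₁ d c c'
    rw [act_insertRight, act_tensR] at h
    rw [actFst_extTensor]
    exact h
  · intro c d d'
    have h := h₂ c d d'
    rw [act_insertLeft, act_tensL] at h
    rw [actSnd_extTensor]
    exact h

lemma isNatural_tensL_whiskerRight (F : EnrichedFunctor V D V)
    {P Q : V} (f : P ⟶ Q) : IsNatural (tensL P F) (tensL Q F) (fun X => f ▷ F.obj X) := by
  intro X Y
  rw [act_tensL, act_tensL]
  change ((α_ P (F.obj X) (hom V X Y)).hom ≫ P ◁ act F X Y) ≫ f ▷ F.obj Y =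
    f ▷ F.obj X ▷ hom V X Y ≫ (α_ Q (F.obj X) (hom V X Y)).hom ≫ Q ◁ act F X Y
  rw [Category.assoc, whisker_exchange, associator_naturality_left_assoc]

/-- The factor `Q` and the parameter `P` are fused into one parameter `Q ⊗ P`. This lets a map out
of a tensor product be regarded as a parametrized map out of its first factor. -/
lemma IsNatural.comp_tensR {F : EnrichedFunctor V C V} {L K : EnrichedFunctor V D V} {Q P : V}
    {J : EnrichedFunctor V C D} {b : ∀ X, F.obj X ⊗ Q ⟶ L.obj (J.obj X)}
    (hb : IsNatural (tensR F Q) (J.comp V L) b) {f : ∀ X, L.obj X ⊗ P ⟶ K.obj X}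
    (hf : IsNatural (tensR L P) K f) :
    IsNatural (tensR F (Q ⊗ P)) (J.comp V K)
      (fun X => (α_ (F.obj X) Q P).inv ≫ b X ▷ P ≫ f (J.obj X)) :=
  (isNatural_associator_inv F Q P).comp ((hb.whiskerRight P).comp (hf.precomp_tensR J))

/-- The mirror case: the fixed left factor, seen through `i`, is braided to the right and joins the
parameter. -/
lemma IsNatural.comp_tensL {F : EnrichedFunctor V C V} {L K : EnrichedFunctor V D V} {Q P N : V}
    {J : EnrichedFunctor V C D} {b : ∀ X, Q ⊗ F.obj X ⟶ L.obj (J.obj X)}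
    (hb : IsNatural (tensL Q F) (J.comp V L) b) (i : N ⟶ Q) {f : ∀ X, L.obj X ⊗ P ⟶ K.obj X}
    (hf : IsNatural (tensR L P) K f) :
    IsNatural (tensR F (N ⊗ P)) (J.comp V K)
      (fun X => (α_ (F.obj X) N P).inv ≫ (β_ (F.obj X) N).hom ▷ P ≫ (i ▷ F.obj X) ▷ P ≫ b X ▷ P ≫
        f (J.obj X)) :=
  (isNatural_associator_inv F N P).comp (((isNatural_braiding F N).whiskerRight P).comp
    (((isNatural_tensL_whiskerRight F i).whiskerRight P).comp
      ((hb.whiskerRight P).comp (hf.precomp_tensR J))))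

lemma isNatural_actFst (L : EnrichedFunctor V (C × D) V) (c c' : C) :
    IsNatural (tensR ((insertLeft c).comp V L) (hom V c c')) ((insertLeft c').comp V L)
      (fun d => actFst L c c' d) := by
  intro d d'
  rw [act_tensR, act_insertLeft, act_insertLeft]
  have h := congrArg (fun z => swapR (L.obj (c, d)) (hom V c c') (hom V d d') ≫ z)
    (actSnd_actFst L c c' d d')
  refine (Category.assoc _ _ _).trans (h.trans ?_)
  exact (Category.assoc _ _ _).symm.trans ((congrArg (· ≫ _)
    (swapR_swapR (L.obj (c, d)) (hom V c c') (hom V d d'))).trans (Category.id_comp _))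

end Precomp

/-! ### Generating families of presheaves -/

section Generates

variable {V : Type u} [Category.{v} V] [MonoidalCategory V] [SymmetricCategory V]
  [MonoidalClosed V] [HasLimits V] [HasColimits V]
variable {A : Type v} [EnrichedCategory V A] {tA : EnrichedFunctor V (A × A) A}

/-- A family of maps `N s ⟶ L (c s)` generates the presheaf `L` if (parametrized) maps out of `L`
are determined by their restrictions along the family. -/
def Generates (L : EnrichedFunctor V Aᵒᵖ V) {σ : Type w} {N : σ → V} {c : σ → A}
    (i : ∀ s, N s ⟶ L.obj (op (c s))) : Prop :=
  ∀ (K : EnrichedFunctor V Aᵒᵖ V) (P : V) (f g : ∀ C, L.obj C ⊗ P ⟶ K.obj C),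
    IsNatural (tensR L P) K f → IsNatural (tensR L P) K g →
    (∀ s, i s ▷ P ≫ f (op (c s)) = i s ▷ P ≫ g (op (c s))) → ∀ C, f C = g C

lemma generates_self (L : EnrichedFunctor V Aᵒᵖ V) :
    Generates L (c := fun X : A => X) (fun X => 𝟙 (L.obj (op X))) := by
  intro K P f g _ _ h C
  simpa using h C.unop

/-- The Yoneda argument with a parameter: an element of a representable is the identity acted on by
that element, so a natural map is determined by its value at the identity. -/
lemma eq_of_unit_act {H₀ H P K₀ Z : V} {y : 𝟙_ V ⟶ H₀} {a : H₀ ⊗ H ⟶ H}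
    (hy : y ▷ H ≫ a = (λ_ H).hom) {f : H ⊗ P ⟶ Z} {f₀ : H₀ ⊗ P ⟶ K₀} {r : K₀ ⊗ H ⟶ Z}
    (h : a ▷ P ≫ f = swapR H₀ H P ≫ f₀ ▷ H ≫ r) :
    f = (λ_ H).inv ▷ P ≫ swapR (𝟙_ V) H P ≫ (y ▷ P ≫ f₀) ▷ H ≫ r := by
  rw [comp_whiskerRight_assoc, ← reassoc_of% (swapR_naturality_left y H P), ← h,
    ← comp_whiskerRight_assoc (y ▷ H), hy, ← comp_whiskerRight_assoc, Iso.inv_hom_id,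
    id_whiskerRight, Category.id_comp]

lemma generates_yoneda (I : A) :
    Generates (yonedaObj (V := V) I) (σ := PUnit.{1}) (c := fun _ => I) (fun _ => eId V I) := by
  intro K P f g hf hg h C
  have e := e_id_comp V (op I) C
  rw [Iso.inv_comp_eq, Category.comp_id] at e
  have e' : eId V (op I) ▷ hom V (op I) C ≫ act (yonedaObj (V := V) I) (op I) C = (λ_ _).hom :=
    (congrArg (fun z => _ ≫ z) (lam_ev _)).trans e
  refine (eq_of_unit_act e' (hf.tensR_act (op I) C)).trans (Eq.trans ?_
    (eq_of_unit_act e' (hg.tensR_act (op I) C)).symm)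
  exact congrArg (fun z => _ ≫ _ ≫ z ▷ hom V (op I) C ≫ act K (op I) C) (h PUnit.unit)

lemma isNatural_dayι_fst (F G : EnrichedFunctor V Aᵒᵖ V) (Y : A) :
    IsNatural (tensR F (G.obj (op Y)))
      (((insertRight (op Y)).comp V (opTensor tA)).comp V (day tA F G))
      (fun X => dayι tA F G X.unop Y) :=
  fun X X' => ((isNatural_dayι tA F G).extTensor_fst (op Y) X X').trans
    (congrArg (fun z => _ ≫ z) (act_comp_assoc _ _ _ _ _))

lemma isNatural_dayι_snd (F G : EnrichedFunctor V Aᵒᵖ V) (X : A) :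
    IsNatural (tensL (F.obj (op X)) G)
      (((insertLeft (op X)).comp V (opTensor tA)).comp V (day tA F G))
      (fun Y => dayι tA F G X Y.unop) :=
  fun Y Y' => ((isNatural_dayι tA F G).extTensor_snd (op X) Y Y').trans
    (congrArg (fun z => _ ≫ z) (act_comp_assoc _ _ _ _ _))

/-- The half of `Generates.day` that uses generation of `G`: the element `i` of `F X` and the
parameter `P` together serve as a single parameter for a map out of `G`. -/
lemma dayι_snd_ext {F G K : EnrichedFunctor V Aᵒᵖ V} {P N : V}
    {f g : ∀ C, (day tA F G).obj C ⊗ P ⟶ K.obj C} (hf : IsNatural (tensR (day tA F G) P) K f)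
    (hg : IsNatural (tensR (day tA F G) P) K g) {X : A} (i : N ⟶ F.obj (op X))
    {τ : Type w₂} {N' : τ → V} {c' : τ → A} {i' : ∀ t, N' t ⟶ G.obj (op (c' t))}
    (hi' : Generates G i')
    (h : ∀ t, ((i ⊗ₘ i' t) ≫ dayι tA F G X (c' t)) ▷ P ≫ f (op (tA.obj (X, c' t))) =
      ((i ⊗ₘ i' t) ≫ dayι tA F G X (c' t)) ▷ P ≫ g (op (tA.obj (X, c' t)))) (Y : A) :
    i ▷ G.obj (op Y) ▷ P ≫ dayι tA F G X Y ▷ P ≫ f (op (tA.obj (X, Y))) =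
      i ▷ G.obj (op Y) ▷ P ≫ dayι tA F G X Y ▷ P ≫ g (op (tA.obj (X, Y))) := by
  have e := hi' _ _ _ _ ((isNatural_dayι_snd F G X).comp_tensL i hf)
    ((isNatural_dayι_snd F G X).comp_tensL i hg) (fun t => by
    have k := h t
    rw [comp_whiskerRight_assoc, comp_whiskerRight_assoc, MonoidalCategory.tensorHom_def',
      comp_whiskerRight_assoc, comp_whiskerRight_assoc] at k
    -- Brings the generator of `G` to the front, where the generating property expects it.
    have e : ∀ {Z : V} (z : (N ⊗ G.obj (op (c' t))) ⊗ P ⟶ Z),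
        i' t ▷ (N ⊗ P) ≫ (α_ (G.obj (op (c' t))) N P).inv ≫ (β_ (G.obj (op (c' t))) N).hom ▷ P ≫ z =
        (α_ (N' t) N P).inv ≫ (β_ (N' t) N).hom ▷ P ≫ (N ◁ i' t) ▷ P ≫ z := by
      intro Z z
      rw [associator_inv_naturality_left_assoc, ← comp_whiskerRight_assoc (i' t ▷ N),
        BraidedCategory.braiding_naturality_left, comp_whiskerRight_assoc]
    exact (e _).trans ((congrArg (fun z => _ ≫ _ ≫ z) k).trans (e _).symm)) (op Y)
  have e' := (cancel_epi (α_ (G.obj (op Y)) N P).inv).1 e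
  exact (cancel_epi (whiskerRightIso (β_ (G.obj (op Y)) N) P).hom).1 e'

/-- Fixing one factor turns a map out of `F ⊗ G` into a map out of the other factor with a larger
parameter. Applying generation to each factor in turn settles the claim, and this is why generation
is required for arbitrary parameters and not only for maps of presheaves. -/
lemma Generates.day {F G : EnrichedFunctor V Aᵒᵖ V} {σ : Type w₁} {τ : Type w₂} {N : σ → V}
    {c : σ → A} {i : ∀ s, N s ⟶ F.obj (op (c s))} (hi : Generates F i) {N' : τ → V} {c' : τ → A}
    {i' : ∀ t, N' t ⟶ G.obj (op (c' t))} (hi' : Generates G i') :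
    Generates (DayMonad.day tA F G) (σ := σ × τ) (N := fun s => N s.1 ⊗ N' s.2)
      (c := fun s => tA.obj (c s.1, c' s.2))
      (fun s => (i s.1 ⊗ₘ i' s.2) ≫ dayι tA F G (c s.1) (c' s.2)) := by
  intro K P f g hf hg h
  apply day_natural_ext hf hg
  intro X Y
  have e := hi _ _ _ _ ((isNatural_dayι_fst F G Y).comp_tensR hf)
    ((isNatural_dayι_fst F G Y).comp_tensR hg) (fun s => by
    have k := dayι_snd_ext hf hg (i s) hi' (fun t => h (s, t)) Y
    refine (associator_inv_naturality_left_assoc _ _ _ _).trans (Eq.trans ?_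
        (associator_inv_naturality_left_assoc _ _ _ _).symm)
    exact congrArg (fun z => _ ≫ z) k) (op X)
  exact (cancel_epi (α_ (F.obj (op X)) (G.obj (op Y)) P).inv).1 e

lemma Generates.mor_ext {L K : EnrichedFunctor V Aᵒᵖ V} {σ : Type w} {N : σ → V} {c : σ → A}
    {i : ∀ s, N s ⟶ L.obj (op (c s))} (hi : Generates L i) {φ ψ : Mor V L K}
    (h : ∀ s, i s ≫ component φ (op (c s)) = i s ≫ component ψ (op (c s))) : φ = ψ := by
  apply DayMonad.mor_ext
  intro X
  have e := hi K (𝟙_ V) _ _ (isNatural_pcomp φ) (isNatural_pcomp ψ) (fun s => by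
    rw [pcomp_mor, pcomp_mor, rightUnitor_naturality_assoc, rightUnitor_naturality_assoc, h]) X
  rw [component_eq, component_eq]
  exact congrArg (fun z => _ ≫ z) e

/-- `V`-naturality of a family of maps of presheaves can be checked on generators. -/
lemma isNat_of_generates {C : Type w₁} [EnrichedCategory V C]
    {Φ Ψ : EnrichedFunctor V C (EnrichedFunctor V Aᵒᵖ V)} {θ : ∀ x, Mor V (Φ.obj x) (Ψ.obj x)}
    {σ : Type w} {c : σ → A} (N : σ → EnrichedFunctor V C V)
    (i : ∀ s x, (N s).obj x ⟶ (Φ.obj x).obj (op (c s)))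
    (hi : ∀ x, Generates (Φ.obj x) (fun s => i s x))
    (h₁ : ∀ s, IsNatural (N s) (Φ.comp V (evalF (op (c s)))) (i s))
    (h₂ : ∀ s, IsNatural (N s) (Ψ.comp V (evalF (op (c s))))
      (fun x => i s x ≫ component (θ x) (op (c s)))) : IsNat Φ Ψ θ := by
  rw [isNat_iff_eval]
  intro X x y
  rw [act_comp', act_comp']
  -- The two legs of the naturality square are both natural maps out of `Φ x`, with the hom-object
  -- from `x` to `y` as parameter.
  refine hi x (Ψ.obj y) (hom V x y)
    (fun X => pcomp (Φ.map x y) X ≫ component (θ y) X)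
    (fun X => component (θ x) X ▷ hom V x y ≫ pcomp (Ψ.map x y) X)
    ((isNatural_pcomp _).comp (isNatural_component _))
    (((isNatural_component _).whiskerRight _).comp (isNatural_pcomp _)) ?_ X
  intro s
  have e₁ := h₁ s x y
  have e₂ := h₂ s x y
  rw [act_comp'] at e₁ e₂
  have e₃ := congrArg (fun z => z ≫ component (θ y) (op (c s))) e₁
  refine (Category.assoc _ _ _).symm.trans (e₃.symm.trans ((Category.assoc _ _ _).trans
    (e₂.trans ?_)))
  exact comp_whiskerRight_assoc (i s x) (component (θ x) (op (c s))) (hom V x y)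
    (pcomp (Ψ.map x y) (op (c s)))

end Generates

/-! ### One fixed variable in products of functors -/

section Insert

variable {V : Type u} [Category.{v} V] [MonoidalCategory V] [SymmetricCategory V]
variable {C : Type w₁} {D : Type w₂} {E : Type w₃}
  [EnrichedCategory V C] [EnrichedCategory V D] [EnrichedCategory V E]

lemma insertRight_prodMap (J : EnrichedFunctor V C E) (d : D) (X Y : C) :
    (insertRight d).map X Y ≫ (prodMap J (EnrichedFunctor.id V D)).map (X, d) (Y, d) =
      J.map X Y ≫ (insertRight d).map (J.obj X) (J.obj Y) := by
  rw [insertRight_map, insertRight_map]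
  change ((ρ_ (hom V X Y)).inv ≫ hom V X Y ◁ eId V d) ≫ (J.map X Y ⊗ₘ 𝟙 (hom V d d)) =
    J.map X Y ≫ (ρ_ _).inv ≫ hom V (J.obj X) (J.obj Y) ◁ eId V d
  rw [Category.assoc, MonoidalCategory.tensorHom_id, whisker_exchange,
    rightUnitor_inv_naturality_assoc]

lemma insertLeft_prodMap (J : EnrichedFunctor V C E) (c : C) (d d' : D) :
    (insertLeft c).map d d' ≫ (prodMap J (EnrichedFunctor.id V D)).map (c, d) (c, d') =
      (insertLeft (J.obj c)).map d d' := by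
  change ((λ_ (hom V d d')).inv ≫ eId V c ▷ hom V d d') ≫ (J.map c c ⊗ₘ 𝟙 (hom V d d')) =
    (λ_ (hom V d d')).inv ≫ eId V (J.obj c) ▷ hom V d d'
  rw [Category.assoc, MonoidalCategory.tensorHom_id, ← comp_whiskerRight, J.map_id]

variable [MonoidalClosed V]

lemma act_insertRight_prodMap (J : EnrichedFunctor V C E) (L : EnrichedFunctor V (E × D) V) (d : D)
    (X Y : C) : act ((insertRight d).comp V ((prodMap J (EnrichedFunctor.id V D)).comp V L)) X Y =
      act (J.comp V ((insertRight d).comp V L)) X Y := by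
  rw [act_comp', act_comp']
  refine (pact_functor_comp (prodMap J (EnrichedFunctor.id V D)) L _).trans ?_
  refine Eq.trans ?_ (pact_functor_comp (insertRight d) L _).symm
  exact congrArg (pact L) (insertRight_prodMap J d X Y)

lemma act_insertLeft_prodMap (J : EnrichedFunctor V C E) (L : EnrichedFunctor V (E × D) V) (c : C)
    (d d' : D) :
    act ((insertLeft c).comp V ((prodMap J (EnrichedFunctor.id V D)).comp V L)) d d' =
      actSnd L (J.obj c) d d' := by
  rw [act_comp']
  refine (pact_functor_comp (prodMap J (EnrichedFunctor.id V D)) L _).trans ?_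
  exact congrArg (pact L) (insertLeft_prodMap J c d d')

lemma IsNatural.whiskerLeft_comp_tensR {L K : EnrichedFunctor V C V} {P Q : V} (m : Q ⟶ P)
    {φ : ∀ X, L.obj X ⊗ P ⟶ K.obj X} (hφ : IsNatural (tensR L P) K φ) :
    IsNatural (tensR L Q) K (fun X => L.obj X ◁ m ≫ φ X) :=
  (isNatural_tensR_whiskerLeft L m).comp hφ

lemma IsNatural.comp_actSnd {L : EnrichedFunctor V C V} {N : EnrichedFunctor V (C × D) V} {P : V}
    {d : D} {φ : ∀ X, L.obj X ⊗ P ⟶ N.obj (X, d)}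
    (hφ : IsNatural (tensR L P) ((insertRight d).comp V N) φ) (d' : D) :
    IsNatural (tensR L (P ⊗ hom V d d')) ((insertRight d').comp V N)
      (fun X => (α_ (L.obj X) P (hom V d d')).inv ≫ φ X ▷ hom V d d' ≫ actSnd N X d d') :=
  (isNatural_associator_inv L P (hom V d d')).comp
    ((hφ.whiskerRight (hom V d d')).comp (isNatural_actSnd N d d'))

end Insert

/-! ### Maps out of twofold and threefold Day tensors -/

section Desc

variable {V : Type u} [Category.{v} V] [MonoidalCategory V] [SymmetricCategory V]
  [MonoidalClosed V] [HasLimits V] [HasColimits V]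
variable {A : Type v} [EnrichedCategory V A] {tA : EnrichedFunctor V (A × A) A}
variable {F G H K : EnrichedFunctor V Aᵒᵖ V}

/-- The map of presheaves out of a Day tensor given by a natural family. -/
def dayDesc (b : ∀ X Y : A, F.obj (op X) ⊗ G.obj (op Y) ⟶ K.obj (op (tA.obj (X, Y))))
    (hb : IsNatural (extTensor F G) ((opTensor tA).comp V K) (fun X => b X.1.unop X.2.unop)) :
    Mor V (day tA F G) K :=
  morOf _ ((isNatural_rightUnitor_inv (day tA F G)).comp
    (isNatural_dayDescR (fun X Y => (ρ_ (F.obj (op X) ⊗ G.obj (op Y))).hom ≫ b X Y)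
      ((isNatural_rightUnitor (extTensor F G)).comp hb)))

lemma dayι_desc (b : ∀ X Y : A, F.obj (op X) ⊗ G.obj (op Y) ⟶ K.obj (op (tA.obj (X, Y)))) (hb)
    (X Y : A) : dayι tA F G X Y ≫ component (dayDesc b hb) (op (tA.obj (X, Y))) = b X Y := by
  rw [dayDesc, component_morOf]
  refine (rightUnitor_inv_naturality_assoc _ _).trans ?_
  refine (congrArg (fun z => _ ≫ z) (dayι_descR _ _ X Y)).trans ?_
  exact Iso.inv_hom_id_assoc _ _

variable (a : ∀ X Y Z : A, (F.obj (op X) ⊗ G.obj (op Y)) ⊗ H.obj (op Z) ⟶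
    K.obj (op (tA.obj (tA.obj (X, Y), Z))))
  (ha : IsNatural (extTensor (extTensor F G) H)
    ((prodMap (opTensor tA) (EnrichedFunctor.id V Aᵒᵖ)).comp V ((opTensor tA).comp V K))
    (fun X => a X.1.1.unop X.1.2.unop X.2.unop))

include ha in
lemma desc₂_natural_fst (Z : A) : IsNatural (tensR (extTensor F G) (H.obj (op Z)))
    ((opTensor tA).comp V ((insertRight (op Z)).comp V ((opTensor tA).comp V K)))
    (fun X => a X.1.unop X.2.unop Z) :=
  fun X Y => (ha.extTensor_fst (op Z) X Y).trans
    (congrArg (fun z => _ ≫ z) (act_insertRight_prodMap _ _ _ _ _))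

include ha in
lemma desc₂_natural_snd (X Y Z Z' : A) :
    (F.obj (op X) ⊗ G.obj (op Y)) ◁ act H (op Z) (op Z') ≫ a X Y Z' =
      (α_ _ _ _).inv ≫ a X Y Z ▷ hom V (op Z) (op Z') ≫
        actSnd ((opTensor tA).comp V K) (op (tA.obj (X, Y))) (op Z) (op Z') := by
  have h := ha.extTensor_snd (op X, op Y) (op Z) (op Z')
  rw [act_tensL, act_insertLeft_prodMap] at h
  exact (Iso.eq_inv_comp _).2 ((Category.assoc _ _ _).symm.trans h)

/-- The map `(F ⊗ G)(C) ⊗ H(Z) ⟶ K(C ⊗ Z)` given by a natural family. -/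
def desc₂At (Z : A) (C : Aᵒᵖ) :
    (day tA F G).obj C ⊗ H.obj (op Z) ⟶ K.obj (op (tA.obj (C.unop, Z))) :=
  dayDescR (K := (insertRight (op Z)).comp V ((opTensor tA).comp V K))
    (fun X Y => a X Y Z) (desc₂_natural_fst a ha Z) C

lemma dayι_desc₂At (X Y Z : A) :
    dayι tA F G X Y ▷ H.obj (op Z) ≫ desc₂At a ha Z (op (tA.obj (X, Y))) = a X Y Z :=
  dayι_descR _ _ X Y

lemma isNatural_desc₂At (Z : A) : IsNatural (tensR (day tA F G) (H.obj (op Z)))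
    ((insertRight (op Z)).comp V ((opTensor tA).comp V K)) (desc₂At a ha Z) :=
  isNatural_dayDescR (K := (insertRight (op Z)).comp V ((opTensor tA).comp V K))
    (fun X Y => a X Y Z) (desc₂_natural_fst a ha Z)

/-- Both sides are natural maps out of `F ⊗ G`, so they need only be compared along `dayι`; there
the claim is naturality of `a` in its third variable. -/
lemma desc₂At_natural (Z Z' : A) (C : Aᵒᵖ) :
    (day tA F G).obj C ◁ act H (op Z) (op Z') ≫ desc₂At a ha Z' C =
      (α_ _ _ _).inv ≫ desc₂At a ha Z C ▷ hom V (op Z) (op Z') ≫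
        actSnd ((opTensor tA).comp V K) C (op Z) (op Z') := by
  refine day_natural_ext (K := (insertRight (op Z')).comp V ((opTensor tA).comp V K))
    ((isNatural_desc₂At a ha Z').whiskerLeft_comp_tensR (act H (op Z) (op Z')))
    ((isNatural_desc₂At a ha Z).comp_actSnd (op Z')) ?_ C
  intro X Y
  refine (whisker_exchange_assoc _ _ _).symm.trans ?_
  refine (congrArg (fun z => _ ≫ z) (dayι_desc₂At a ha X Y Z')).trans ?_
  refine (desc₂_natural_snd a ha X Y Z Z').trans ?_
  refine Eq.trans ?_ (associator_inv_naturality_left_assoc _ _ _ _).symm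
  refine congrArg (fun z => _ ≫ z) ?_
  exact (congrArg (fun z => z ▷ _ ≫ _) (dayι_desc₂At a ha X Y Z)).symm.trans
    (comp_whiskerRight_assoc _ _ _ _)

lemma desc₂_natural :
    IsNatural (extTensor (day tA F G) H) ((opTensor tA).comp V K)
      (fun X => desc₂At a ha X.2.unop X.1) := by
  apply isNatural_extTensor
  · intro Z
    exact isNatural_desc₂At a ha Z.unop
  · rintro C ⟨Z⟩ ⟨Z'⟩
    rw [act_tensL, act_insertLeft]
    refine (Category.assoc _ _ _).trans
      ((congrArg (fun z => _ ≫ z) (desc₂At_natural a ha Z Z' C)).trans ?_)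
    exact Iso.hom_inv_id_assoc _ _

/-- The map of presheaves out of an iterated Day tensor given by a natural family. -/
def dayDesc₂ : Mor V (day tA (day tA F G) H) K :=
  dayDesc (fun X Z => desc₂At a ha Z (op X)) (desc₂_natural a ha)

lemma dayι_desc₂ (X Y Z : A) :
    dayι tA F G X Y ▷ H.obj (op Z) ≫ dayι tA (day tA F G) H (tA.obj (X, Y)) Z ≫
      component (dayDesc₂ a ha) (op (tA.obj (tA.obj (X, Y), Z))) = a X Y Z := by
  rw [dayDesc₂, dayι_desc, dayι_desc₂At]

end Desc

/-! ### The underlying category of a `V`-category -/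

section Underlying

variable {V : Type u} [Category.{v} V] [MonoidalCategory V]
variable {C : Type w} {D : Type w₁} [EnrichedCategory V C] [EnrichedCategory V D]

lemma eId_mcomp {X Y : C} (f : Mor V X Y) : mcomp (eId V X) f = f := by
  have h := e_id_comp V X Y
  rw [Iso.inv_comp_eq, Category.comp_id] at h
  rw [mcomp, MonoidalCategory.tensorHom_def'_assoc, h, leftUnitor_naturality,
    Iso.inv_hom_id_assoc]

lemma mcomp_eId {X Y : C} (f : Mor V X Y) : mcomp f (eId V Y) = f := by
  have h := e_comp_id V X Y
  rw [Iso.inv_comp_eq, Category.comp_id] at h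
  rw [mcomp, MonoidalCategory.tensorHom_def_assoc, h, rightUnitor_naturality,
    ← unitors_equal, Iso.inv_hom_id_assoc]

lemma mcomp_assoc {W X Y Z : C} (f : Mor V W X) (g : Mor V X Y) (h : Mor V Y Z) :
    mcomp (mcomp f g) h = mcomp f (mcomp g h) := by
  have e := Category.assoc (ForgetEnrichment.homOf V f) (ForgetEnrichment.homOf V g)
    (ForgetEnrichment.homOf V h)
  have k : ∀ {X Y Z : C} (f : Mor V X Y) (g : Mor V Y Z), mcomp f g =
      ForgetEnrichment.homTo V (ForgetEnrichment.homOf V f ≫ ForgetEnrichment.homOf V g) :=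
    fun f g => (Category.assoc _ _ _).symm
  rw [k, k, k, k]
  exact e

lemma mmap_eId (F : EnrichedFunctor V C D) (X : C) : mmap F (eId V X) = eId V (F.obj X) :=
  F.map_id X

lemma mmap_mcomp (F : EnrichedFunctor V C D) {X Y Z : C} (f : Mor V X Y) (g : Mor V Y Z) :
    mmap F (mcomp f g) = mcomp (mmap F f) (mmap F g) := by
  simp only [mmap, mcomp, Category.assoc]
  rw [F.map_comp, tensorHom_comp_tensorHom_assoc]

/-- The underlying category of a `V`-category. -/
def Underlying (V : Type u) [Category.{v} V] [MonoidalCategory V] (C : Type w)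
    [EnrichedCategory V C] : Type w := C

instance : Category (Underlying V C) where
  Hom X Y := Mor V (C := C) X Y
  id X := eId V (C := C) X
  comp f g := mcomp (C := C) f g
  id_comp := eId_mcomp (C := C)
  comp_id := mcomp_eId (C := C)
  assoc := mcomp_assoc (C := C)

variable [SymmetricCategory V]

/-- A pair of maps as a map in a product. -/
def mpair {X X' : C} {Y Y' : D} (f : Mor V X X') (g : Mor V Y Y') : Mor V (X, Y) (X', Y') :=
  (λ_ (𝟙_ V)).inv ≫ (f ⊗ₘ g)

lemma mpair_eId (X : C) (Y : D) : mpair (eId V X) (eId V Y) = eId V (X, Y) := rfl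

lemma mpair_mcomp {X X' X'' : C} {Y Y' Y'' : D} (f : Mor V X X') (f' : Mor V X' X'')
    (g : Mor V Y Y') (g' : Mor V Y' Y'') :
    mpair (mcomp f f') (mcomp g g') = mcomp (mpair f g) (mpair f' g') := by
  change (λ_ (𝟙_ V)).inv ≫ ((λ_ (𝟙_ V)).inv ≫ (f ⊗ₘ f') ≫ eComp V X X' X'' ⊗ₘ
    (λ_ (𝟙_ V)).inv ≫ (g ⊗ₘ g') ≫ eComp V Y Y' Y'') =
    (λ_ (𝟙_ V)).inv ≫ ((λ_ (𝟙_ V)).inv ≫ (f ⊗ₘ g) ⊗ₘ (λ_ (𝟙_ V)).inv ≫ (f' ⊗ₘ g')) ≫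
      tensorμ (hom V X X') (hom V Y Y') (hom V X' X'') (hom V Y' Y'') ≫
        (eComp V X X' X'' ⊗ₘ eComp V Y Y' Y'')
  rw [← tensorHom_comp_tensorHom, ← tensorHom_comp_tensorHom, ← tensorHom_comp_tensorHom,
    Category.assoc, tensorμ_natural_assoc]
  have h : ((λ_ (𝟙_ V)).inv ⊗ₘ (λ_ (𝟙_ V)).inv) ≫ tensorμ (𝟙_ V) (𝟙_ V) (𝟙_ V) (𝟙_ V) =
      ((λ_ (𝟙_ V)).inv ⊗ₘ (λ_ (𝟙_ V)).inv) := by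
    simp only [tensorμ, MonoidalCategory.tensorHom_def, braiding_tensorUnit_right]
    monoidal
  rw [reassoc_of% h]

lemma mtensor_eq (tA : EnrichedFunctor V (C × C) C) {X X' Y Y' : C} (f : Mor V X X')
    (g : Mor V Y Y') : mtensor tA f g = mmap tA (mpair f g) :=
  (Category.assoc _ _ _).symm

lemma mtensor_eId (tA : EnrichedFunctor V (C × C) C) (X Y : C) :
    mtensor tA (eId V X) (eId V Y) = eId V (tA.obj (X, Y)) := by
  rw [mtensor_eq, mpair_eId, mmap_eId]

lemma mtensor_mcomp (tA : EnrichedFunctor V (C × C) C) {X X' X'' Y Y' Y'' : C} (f : Mor V X X')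
    (f' : Mor V X' X'') (g : Mor V Y Y') (g' : Mor V Y' Y'') :
    mtensor tA (mcomp f f') (mcomp g g') = mcomp (mtensor tA f g) (mtensor tA f' g') := by
  rw [mtensor_eq, mtensor_eq, mtensor_eq, mpair_mcomp, mmap_mcomp]

variable [MonoidalClosed V]

/-- Precomposing the enriched naturality square with an element `f` of the hom-object gives the
ordinary one. -/
lemma IsNat.mcomp_eq {F G : EnrichedFunctor V C D} {θ : ∀ X, Mor V (F.obj X) (G.obj X)}
    (h : IsNat F G θ) {X Y : C} (f : Mor V X Y) :
    mcomp (mmap F f) (θ Y) = mcomp (θ X) (mmap G f) := by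
  have e := congrArg (fun z => (ρ_ (𝟙_ V)).inv ≫ f ▷ 𝟙_ V ≫ z) (h X Y)
  have e1 : f ▷ 𝟙_ V ≫ (F.map X Y ⊗ₘ θ Y) = (f ≫ F.map X Y) ⊗ₘ θ Y := by
    rw [← MonoidalCategory.tensorHom_id, tensorHom_comp_tensorHom, Category.id_comp]
  have e2 : 𝟙_ V ◁ f ≫ (θ X ⊗ₘ G.map X Y) = θ X ⊗ₘ (f ≫ G.map X Y) := by
    rw [← MonoidalCategory.id_tensorHom, tensorHom_comp_tensorHom, Category.id_comp]
  simp only [reassoc_of% e1, BraidedCategory.braiding_naturality_left_assoc,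
    reassoc_of% e2, rightUnitor_inv_braiding_assoc] at e
  rw [mcomp, mcomp, mmap, mmap]
  refine Eq.trans ?_ e
  rw [unitors_inv_equal]

end Underlying

/-! ### Consequences of coherence, obtained in the underlying symmetric monoidal category -/

section Coherence

variable {V : Type u} [Category.{v} V] [MonoidalCategory V] [SymmetricCategory V]
  [MonoidalClosed V]
variable {C : Type w} [EnrichedCategory V C] {tA : EnrichedFunctor V (C × C) C} {unit : C}
  {S : MonoidalData tA unit}

lemma IsSymmetricMonoidal.assoc_naturality (hS : IsSymmetricMonoidal S) {X X' Y Y' Z Z' : C}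
    (f : Mor V X X') (g : Mor V Y Y') (h : Mor V Z Z') :
    mcomp (mtensor tA (mtensor tA f g) h) (S.assoc X' Y' Z') =
      mcomp (S.assoc X Y Z) (mtensor tA f (mtensor tA g h)) := by
  have e := hS.assoc_nat.mcomp_eq (X := ((X, Y), Z)) (Y := ((X', Y'), Z')) (mpair (mpair f g) h)
  have e1 : mmap ((prodMap tA (EnrichedFunctor.id V C)).comp V tA) (mpair (mpair f g) h) =
      mtensor tA (mtensor tA f g) h := by
    change ((λ_ (𝟙_ V)).inv ≫ ((λ_ (𝟙_ V)).inv ≫ (f ⊗ₘ g) ⊗ₘ h)) ≫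
      (tA.map (X, Y) (X', Y') ⊗ₘ 𝟙 (hom V Z Z')) ≫ tA.map (tA.obj (X, Y), Z) (tA.obj (X', Y'), Z') =
      (λ_ (𝟙_ V)).inv ≫ ((λ_ (𝟙_ V)).inv ≫ (f ⊗ₘ g) ≫ tA.map (X, Y) (X', Y') ⊗ₘ h) ≫
        tA.map (tA.obj (X, Y), Z) (tA.obj (X', Y'), Z')
    rw [Category.assoc, tensorHom_comp_tensorHom_assoc, Category.assoc, Category.comp_id]
  have e2 : mmap ((prodAssoc V C C C).comp V ((prodMap (EnrichedFunctor.id V C) tA).comp V tA))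
      (mpair (mpair f g) h) = mtensor tA f (mtensor tA g h) := by
    change ((λ_ (𝟙_ V)).inv ≫ ((λ_ (𝟙_ V)).inv ≫ (f ⊗ₘ g) ⊗ₘ h)) ≫
      (α_ (hom V X X') (hom V Y Y') (hom V Z Z')).hom ≫
      (𝟙 (hom V X X') ⊗ₘ tA.map (Y, Z) (Y', Z')) ≫ tA.map (X, tA.obj (Y, Z)) (X', tA.obj (Y', Z')) =
      (λ_ (𝟙_ V)).inv ≫ (f ⊗ₘ (λ_ (𝟙_ V)).inv ≫ (g ⊗ₘ h) ≫ tA.map (Y, Z) (Y', Z')) ≫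
        tA.map (X, tA.obj (Y, Z)) (X', tA.obj (Y', Z'))
    have k : (λ_ (𝟙_ V)).inv ≫ ((λ_ (𝟙_ V)).inv ≫ (f ⊗ₘ g) ⊗ₘ h) ≫
        (α_ (hom V X X') (hom V Y Y') (hom V Z Z')).hom =
        (λ_ (𝟙_ V)).inv ≫ (f ⊗ₘ (λ_ (𝟙_ V)).inv ≫ (g ⊗ₘ h)) := by
      have k1 : ((λ_ (𝟙_ V)).inv ≫ (f ⊗ₘ g) ⊗ₘ h) = (λ_ (𝟙_ V)).inv ▷ _ ≫ ((f ⊗ₘ g) ⊗ₘ h) := by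
        rw [← MonoidalCategory.tensorHom_id, tensorHom_comp_tensorHom, Category.id_comp]
      have k2 : (f ⊗ₘ (λ_ (𝟙_ V)).inv ≫ (g ⊗ₘ h)) = _ ◁ (λ_ (𝟙_ V)).inv ≫ (f ⊗ₘ (g ⊗ₘ h)) := by
        rw [← MonoidalCategory.id_tensorHom, tensorHom_comp_tensorHom, Category.id_comp]
      rw [k1, k2, Category.assoc, associator_naturality]
      monoidal
    rw [Category.assoc, reassoc_of% k, tensorHom_comp_tensorHom_assoc, Category.assoc,
      Category.comp_id]
  rw [e1, e2] at e
  exact e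

lemma IsSymmetricMonoidal.leftUnitor_naturality (hS : IsSymmetricMonoidal S) {X X' : C}
    (f : Mor V X X') :
    mcomp (mtensor tA (eId V unit) f) (S.leftUnitor X') = mcomp (S.leftUnitor X) f := by
  have e := hS.leftUnitor_nat.mcomp_eq f
  have e1 : mmap ((insertLeft unit).comp V tA) f = mtensor tA (eId V unit) f := by
    change f ≫ ((λ_ (hom V X X')).inv ≫ eId V unit ▷ hom V X X') ≫ tA.map (unit, X) (unit, X') = _
    rw [mtensor, Category.assoc, leftUnitor_inv_naturality_assoc, MonoidalCategory.tensorHom_def'_assoc]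
  have e2 : mmap (EnrichedFunctor.id V C) f = f := Category.comp_id _
  rw [e1, e2] at e
  exact e

lemma IsSymmetricMonoidal.rightUnitor_naturality (hS : IsSymmetricMonoidal S) {X X' : C}
    (f : Mor V X X') :
    mcomp (mtensor tA f (eId V unit)) (S.rightUnitor X') = mcomp (S.rightUnitor X) f := by
  have e := hS.rightUnitor_nat.mcomp_eq f
  have e1 : mmap ((insertRight unit).comp V tA) f = mtensor tA f (eId V unit) := by
    change f ≫ (insertRight unit).map X X' ≫ tA.map (X, unit) (X', unit) = _
    rw [insertRight_map, mtensor, MonoidalCategory.tensorHom_def_assoc, unitors_inv_equal,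
      ← rightUnitor_inv_naturality_assoc]
    exact congrArg (f ≫ ·) (Category.assoc _ _ _)
  have e2 : mmap (EnrichedFunctor.id V C) f = f := Category.comp_id _
  rw [e1, e2] at e
  exact e

lemma IsSymmetricMonoidal.braiding_naturality (hS : IsSymmetricMonoidal S) {X X' Y Y' : C}
    (f : Mor V X X') (g : Mor V Y Y') :
    mcomp (mtensor tA f g) (S.braiding X' Y') = mcomp (S.braiding X Y) (mtensor tA g f) := by
  have e := hS.braiding_nat.mcomp_eq (X := (X, Y)) (Y := (X', Y')) (mpair f g)
  have e2 : mmap ((prodSwap V C C).comp V tA) (mpair f g) = mtensor tA g f := by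
    change ((λ_ (𝟙_ V)).inv ≫ (f ⊗ₘ g)) ≫ (β_ (hom V X X') (hom V Y Y')).hom ≫
      tA.map (Y, X) (Y', X') = (λ_ (𝟙_ V)).inv ≫ (g ⊗ₘ f) ≫ tA.map (Y, X) (Y', X')
    rw [Category.assoc, BraidedCategory.braiding_naturality_assoc, leftUnitor_inv_braiding_assoc,
      unitors_inv_equal]
  rw [e2, ← mtensor_eq] at e
  exact e

/-- The isomorphism of the underlying category given by an invertible map. -/
def isoOf {X Y : C} {f : Mor V X Y} (h : MIsIso f) :
    (show Underlying V C from X) ≅ (show Underlying V C from Y) where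
  hom := f
  inv := h.choose
  hom_inv_id := h.choose_spec.1
  inv_hom_id := h.choose_spec.2

/-- The monoidal structure of the underlying category. -/
abbrev monoidalStruct (hS : IsSymmetricMonoidal S) : MonoidalCategoryStruct (Underlying V C) where
  tensorObj X Y := tA.obj (X, Y)
  tensorHom {X X' Y Y'} f g := mtensor tA (X := X) (X' := X') (Y := Y) (Y' := Y') f g
  whiskerLeft X {Y Y'} f := mtensor tA (X := X) (X' := X) (Y := Y) (Y' := Y') (eId V (C := C) X) f
  whiskerRight {X X'} f Y := mtensor tA (X := X) (X' := X') (Y := Y) (Y' := Y) f (eId V (C := C) Y)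
  tensorUnit := unit
  associator X Y Z := isoOf (hS.assoc_iso X Y Z)
  leftUnitor X := isoOf (hS.leftUnitor_iso X)
  rightUnitor X := isoOf (hS.rightUnitor_iso X)

/-- The underlying category is monoidal. -/
abbrev monoidalUnderlying (hS : IsSymmetricMonoidal S) : MonoidalCategory (Underlying V C) :=
  letI := monoidalStruct hS
  MonoidalCategory.ofTensorHom
    (id_tensorHom_id := fun X Y => mtensor_eId tA X Y)
    (id_tensorHom := fun _ _ _ _ => rfl)
    (tensorHom_id := fun _ _ => rfl)
    (tensorHom_comp_tensorHom := fun f g f' g' => (mtensor_mcomp tA f f' g g').symm)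
    (associator_naturality := fun f g h => hS.assoc_naturality f g h)
    (leftUnitor_naturality := fun f => hS.leftUnitor_naturality f)
    (rightUnitor_naturality := fun f => hS.rightUnitor_naturality f)
    (pentagon := fun W X Y Z => hS.pentagon W X Y Z)
    (triangle := fun X Y => hS.triangle X Y)

/-- Inverting the forward hexagon for `Z`, `X`, `Y` gives the reverse one, because the inverse of
each braiding is the opposite braiding. -/
lemma hexagon_reverse_of_forward {D : Type w} [Category.{v} D] [MonoidalCategory D]
    (b : ∀ X Y : D, X ⊗ Y ≅ Y ⊗ X) (hb : ∀ X Y, (b X Y).inv = (b Y X).hom)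
    (h : ∀ X Y Z : D, (α_ X Y Z).hom ≫ (b X (Y ⊗ Z)).hom ≫ (α_ Y Z X).hom =
      (b X Y).hom ▷ Z ≫ (α_ Y X Z).hom ≫ Y ◁ (b X Z).hom) (X Y Z : D) :
    (α_ X Y Z).inv ≫ (b (X ⊗ Y) Z).hom ≫ (α_ Z X Y).inv =
      X ◁ (b Y Z).hom ≫ (α_ X Z Y).inv ≫ (b X Z).hom ▷ Y := by
  have e : α_ Z X Y ≪≫ b Z (X ⊗ Y) ≪≫ α_ X Y Z =
      whiskerRightIso (b Z X) Y ≪≫ α_ X Z Y ≪≫ whiskerLeftIso X (b Z Y) := Iso.ext (h Z X Y)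
  have e' := congrArg Iso.inv e
  simpa [hb] using e'

/-- The underlying category is symmetric monoidal. -/
abbrev symmetricUnderlying (hS : IsSymmetricMonoidal S) :
    letI := monoidalUnderlying hS
    SymmetricCategory (Underlying V C) :=
  letI := monoidalUnderlying hS
  have hf : ∀ X Y Z : Underlying V C,
      (α_ X Y Z).hom ≫ (show X ⊗ (Y ⊗ Z) ⟶ (Y ⊗ Z) ⊗ X from S.braiding X (tA.obj (Y, Z))) ≫
        (α_ Y Z X).hom = ((show X ⊗ Y ⟶ Y ⊗ X from S.braiding X Y) ▷ Z) ≫ (α_ Y X Z).hom ≫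
          (Y ◁ (show X ⊗ Z ⟶ Z ⊗ X from S.braiding X Z)) := hS.hexagon
  { braiding := fun X Y =>
      { hom := S.braiding X Y
        inv := S.braiding Y X
        hom_inv_id := hS.symmetry X Y
        inv_hom_id := hS.symmetry Y X }
    braiding_naturality_right := fun X _ _ f => hS.braiding_naturality (eId V (C := C) X) f
    braiding_naturality_left := fun f Z => hS.braiding_naturality f (eId V (C := C) Z)
    hexagon_forward := hf
    hexagon_reverse := fun X Y Z => hexagon_reverse_of_forward (D := Underlying V C)
      (fun X Y => { hom := S.braiding X Y, inv := S.braiding Y X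
                    hom_inv_id := hS.symmetry X Y, inv_hom_id := hS.symmetry Y X })
      (fun _ _ => rfl) hf X Y Z
    symmetry := hS.symmetry }

/-- Not among the axioms but a consequence of them; passing to the underlying category makes the
general theorem on braided categories available. -/
lemma IsSymmetricMonoidal.braiding_leftUnitor (hS : IsSymmetricMonoidal S) (X : C) :
    mcomp (S.braiding X unit) (S.leftUnitor X) = S.rightUnitor X := by
  let := monoidalUnderlying hS
  let := symmetricUnderlying hS
  exact CategoryTheory.braiding_leftUnitor (C := Underlying V C) X

/-- Each associator followed by a braiding rotates a threefold tensor, and three rotations are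
trivial. This displays an inverse of the associator built from associators and braidings only. -/
lemma assoc_braiding_cycle {D : Type w} [Category.{v} D] [MonoidalCategory D] [SymmetricCategory D]
    (X Y Z : D) : (α_ X Y Z).hom ≫ (β_ X (Y ⊗ Z)).hom ≫ (α_ Y Z X).hom ≫ (β_ Y (Z ⊗ X)).hom ≫
      (α_ Z X Y).hom ≫ (β_ Z (X ⊗ Y)).hom = 𝟙 _ := by
  have h := BraidedCategory.yang_baxter X Y Z
  have h1 : Z ◁ (β_ X Y).hom ≫ Z ◁ (β_ Y X).hom = 𝟙 _ := by
    rw [← MonoidalCategory.whiskerLeft_comp, SymmetricCategory.symmetry,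
      MonoidalCategory.whiskerLeft_id]
  have h2 : (β_ X Z).hom ▷ Y ≫ (β_ Z X).hom ▷ Y = 𝟙 _ := by
    rw [← comp_whiskerRight, SymmetricCategory.symmetry, id_whiskerRight]
  have h3 : X ◁ (β_ Y Z).hom ≫ X ◁ (β_ Z Y).hom = 𝟙 _ := by
    rw [← MonoidalCategory.whiskerLeft_comp, SymmetricCategory.symmetry,
      MonoidalCategory.whiskerLeft_id]
  rw [Iso.inv_comp_eq] at h
  simp only [BraidedCategory.braiding_tensor_right_hom, Category.assoc, Iso.hom_inv_id_assoc,
    Iso.inv_hom_id_assoc, reassoc_of% h, reassoc_of% h1, reassoc_of% h2, reassoc_of% h3,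
    Iso.hom_inv_id]

lemma IsSymmetricMonoidal.cycle (hS : IsSymmetricMonoidal S) (X Y Z : C) :
    mcomp (S.assoc X Y Z) (mcomp (S.braiding X (tA.obj (Y, Z))) (mcomp (S.assoc Y Z X)
      (mcomp (S.braiding Y (tA.obj (Z, X))) (mcomp (S.assoc Z X Y)
        (S.braiding Z (tA.obj (X, Y))))))) = eId V _ := by
  let := monoidalUnderlying hS
  let := symmetricUnderlying hS
  exact assoc_braiding_cycle (D := Underlying V C) X Y Z

end Coherence

/-! ### Composites of natural families on products -/

section Naturality

variable {V : Type u} [Category.{v} V] [MonoidalCategory V] [SymmetricCategory V]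
  [MonoidalClosed V]
variable {C : Type w₁} {D : Type w₂} {E : Type w₃} {C' : Type w₄}
  [EnrichedCategory V C] [EnrichedCategory V D] [EnrichedCategory V E] [EnrichedCategory V C']

lemma act_id_comp (F : EnrichedFunctor V C V) (X Y : C) :
    act ((EnrichedFunctor.id V C).comp V F) X Y = act F X Y := by
  rw [act_comp']
  exact pact_id F X Y

lemma IsNatural.extTensor_whiskerRight {M N : EnrichedFunctor V C V} (G : EnrichedFunctor V D V)
    {a : ∀ X, M.obj X ⟶ N.obj X} (ha : IsNatural M N a) :
    IsNatural (extTensor M G) (extTensor N G) (fun X => a X.1 ▷ G.obj X.2) := fun X Y =>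
  (congrArg (act (extTensor M G) X Y ≫ ·) (tensorHom_id (a Y.1) (G.obj Y.2))).symm.trans
    ((ha.tensor (isNatural_id G) X Y).trans
      (congrArg (fun z => z ▷ hom V X Y ≫ act (extTensor N G) X Y)
        (tensorHom_id (a X.1) (G.obj X.2))))

lemma IsNatural.extTensor_whiskerLeft {M N : EnrichedFunctor V C V} (G : EnrichedFunctor V D V)
    {a : ∀ X, M.obj X ⟶ N.obj X} (ha : IsNatural M N a) :
    IsNatural (extTensor G M) (extTensor G N) (fun X => G.obj X.1 ◁ a X.2) := fun X Y =>
  (congrArg (act (extTensor G M) X Y ≫ ·) (id_tensorHom (G.obj Y.1) (a Y.2))).symm.trans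
    (((isNatural_id G).tensor ha X Y).trans
      (congrArg (fun z => z ▷ hom V X Y ≫ act (extTensor G N) X Y)
        (id_tensorHom (G.obj X.1) (a X.2))))

lemma IsNatural.assoc {N : EnrichedFunctor V C V} {J : EnrichedFunctor V C D}
    {L : EnrichedFunctor V D E} {F : EnrichedFunctor V E V}
    {b : ∀ X, N.obj X ⟶ F.obj (L.obj (J.obj X))} (hb : IsNatural N (J.comp V (L.comp V F)) b) :
    IsNatural N ((J.comp V L).comp V F) b :=
  fun X Y => (hb X Y).trans (congrArg (fun z => _ ≫ z) (act_comp_assoc J L F X Y))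

lemma IsNatural.comp_prodMap_left {M : EnrichedFunctor V C' V} {J : EnrichedFunctor V C' C}
    {F : EnrichedFunctor V C V} {G : EnrichedFunctor V D V} {L : EnrichedFunctor V (C × D) V}
    {a : ∀ X, M.obj X ⟶ F.obj (J.obj X)} (ha : IsNatural M (J.comp V F) a)
    {b : ∀ X : C × D, F.obj X.1 ⊗ G.obj X.2 ⟶ L.obj X} (hb : IsNatural (extTensor F G) L b) :
    IsNatural (extTensor M G) ((prodMap J (EnrichedFunctor.id V D)).comp V L)
      (fun X => a X.1 ▷ G.obj X.2 ≫ b (J.obj X.1, X.2)) := by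
  have h : IsNatural (extTensor (J.comp V F) G)
      ((prodMap J (EnrichedFunctor.id V D)).comp V L) (fun X => b (J.obj X.1, X.2)) := by
    intro X Y
    have e := act_prodMap_extTensor J (EnrichedFunctor.id V D) F G X Y
    have e' : act (extTensor (J.comp V F) ((EnrichedFunctor.id V D).comp V G)) X Y =
        act (extTensor (J.comp V F) G) X Y := by
      rw [act_extTensor, act_extTensor, act_id_comp]
      rfl
    exact (congrArg (· ≫ b (J.obj Y.1, Y.2)) (e.trans e')).symm.trans
      (hb.precomp (prodMap J (EnrichedFunctor.id V D)) X Y)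
  exact (ha.extTensor_whiskerRight G).comp h

lemma IsNatural.comp_prodMap_right {M : EnrichedFunctor V C' V} {J : EnrichedFunctor V C' C}
    {F : EnrichedFunctor V C V} {G : EnrichedFunctor V D V} {L : EnrichedFunctor V (D × C) V}
    {a : ∀ X, M.obj X ⟶ F.obj (J.obj X)} (ha : IsNatural M (J.comp V F) a)
    {b : ∀ X : D × C, G.obj X.1 ⊗ F.obj X.2 ⟶ L.obj X} (hb : IsNatural (extTensor G F) L b) :
    IsNatural (extTensor G M) ((prodMap (EnrichedFunctor.id V D) J).comp V L)
      (fun X => G.obj X.1 ◁ a X.2 ≫ b (X.1, J.obj X.2)) := by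
  have h : IsNatural (extTensor G (J.comp V F))
      ((prodMap (EnrichedFunctor.id V D) J).comp V L) (fun X => b (X.1, J.obj X.2)) := by
    intro X Y
    have e := act_prodMap_extTensor (EnrichedFunctor.id V D) J G F X Y
    have e' : act (extTensor ((EnrichedFunctor.id V D).comp V G) (J.comp V F)) X Y =
        act (extTensor G (J.comp V F)) X Y := by
      rw [act_extTensor, act_extTensor, act_id_comp]
      rfl
    exact (congrArg (· ≫ b (Y.1, J.obj Y.2)) (e.trans e')).symm.trans
      (hb.precomp (prodMap (EnrichedFunctor.id V D) J) X Y)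
  exact (ha.extTensor_whiskerLeft G).comp h

lemma isNatural_leftUnitor (F : EnrichedFunctor V C V) :
    IsNatural (tensL (𝟙_ V) F) F (fun X => (λ_ (F.obj X)).hom) := by
  intro X Y
  rw [act_tensL]
  change ((α_ (𝟙_ V) (F.obj X) (hom V X Y)).hom ≫ 𝟙_ V ◁ act F X Y) ≫ (λ_ (F.obj Y)).hom =
    (λ_ (F.obj X)).hom ▷ hom V X Y ≫ act F X Y
  simp

/-- Naturality in the target of the action is associativity of that action. It supplies half of the
naturality of the left unitor. -/
lemma isNatural_act (N : EnrichedFunctor V C V) (I : C) :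
    IsNatural (tensL (N.obj I) (corepr I)) N (fun X => act N I X) := by
  intro X Y
  rw [act_tensL]
  have e : act (corepr (V := V) I) X Y = eComp V I X Y := lam_ev _
  have h := act_comp N I X Y
  rw [Iso.eq_inv_comp] at h
  rw [e]
  exact (Category.assoc _ _ _).trans h

end Naturality

/-! ### Construction of the braiding, associator and left unitor of the Day tensor -/

section DayData

variable {V : Type u} [Category.{v} V] [MonoidalCategory V] [SymmetricCategory V]
  [MonoidalClosed V] [HasLimits V] [HasColimits V]
variable {A : Type v} [EnrichedCategory V A] {tA : EnrichedFunctor V (A × A) A} {unit : A}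
  {S : MonoidalData tA unit} (hS : IsSymmetricMonoidal S)
variable (F G H : EnrichedFunctor V Aᵒᵖ V)

include hS

/-- `V`-naturality of the constraint of `A`, transported to `K` by `restrict_natural`; the
associator and left unitor are treated likewise. -/
lemma isNatural_restrict_braiding (K : EnrichedFunctor V Aᵒᵖ V) :
    IsNatural ((prodSwap V Aᵒᵖ Aᵒᵖ).comp V ((opTensor tA).comp V K)) ((opTensor tA).comp V K)
      (fun X => restrict K (S.braiding X.1.unop X.2.unop)) := by
  intro X Y
  rw [act_comp', act_comp']
  refine (congrArg (· ≫ _) (pact_functor_comp (opTensor tA) K _)).trans ?_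
  exact restrict_natural K hS.braiding_nat (Y.1.unop, Y.2.unop) (X.1.unop, X.2.unop)

lemma isNatural_restrict_assoc (K : EnrichedFunctor V Aᵒᵖ V) :
    IsNatural ((prodAssoc V Aᵒᵖ Aᵒᵖ Aᵒᵖ).comp V
        ((prodMap (EnrichedFunctor.id V Aᵒᵖ) (opTensor tA)).comp V ((opTensor tA).comp V K)))
      ((prodMap (opTensor tA) (EnrichedFunctor.id V Aᵒᵖ)).comp V ((opTensor tA).comp V K))
      (fun X => restrict K (S.assoc X.1.1.unop X.1.2.unop X.2.unop)) := by
  intro X Y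
  rw [act_comp', act_comp']
  refine (congrArg (· ≫ _) ((pact_functor_comp (prodMap (EnrichedFunctor.id V Aᵒᵖ) (opTensor tA))
    ((opTensor tA).comp V K) _).trans ((pact_functor_comp (opTensor tA) K _).trans
      (congrArg (pact K) (Category.assoc _ _ _))))).trans ?_
  refine Eq.trans ?_ (congrArg (_ ≫ ·) (pact_functor_comp (opTensor tA) K _).symm)
  exact restrict_natural K hS.assoc_nat ((Y.1.1.unop, Y.1.2.unop), Y.2.unop)
    ((X.1.1.unop, X.1.2.unop), X.2.unop)

lemma isNatural_restrict_leftUnitor (K : EnrichedFunctor V Aᵒᵖ V) :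
    IsNatural K ((insertLeft (op unit)).comp V ((opTensor tA).comp V K))
      (fun X => restrict K (S.leftUnitor X.unop)) := by
  intro X Y
  rw [act_comp']
  refine Eq.trans ?_ (congrArg (_ ≫ ·) (pact_functor_comp (opTensor tA) K _).symm)
  refine (congrArg (· ≫ _) (pact_id K X Y)).symm.trans ?_
  exact restrict_natural K hS.leftUnitor_nat Y.unop X.unop

/-- The braiding of the Day tensor. -/
def dayBraiding : Mor V (day tA F G) (day tA G F) :=
  dayDesc (fun X Y => (β_ (F.obj (op X)) (G.obj (op Y))).hom ≫ dayι tA G F Y X ≫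
      restrict (day tA G F) (S.braiding X Y))
    ((isNatural_swap F G).comp (((isNatural_dayι tA G F).precomp (prodSwap V Aᵒᵖ Aᵒᵖ)).comp
      (isNatural_restrict_braiding hS (day tA G F))))

/-- The associator of the Day tensor. -/
def dayAssoc : Mor V (day tA (day tA F G) H) (day tA F (day tA G H)) :=
  dayDesc₂ (fun X Y Z => (α_ (F.obj (op X)) (G.obj (op Y)) (H.obj (op Z))).hom ≫
      (F.obj (op X) ◁ dayι tA G H Y Z ≫ dayι tA F (day tA G H) X (tA.obj (Y, Z))) ≫
        restrict (day tA F (day tA G H)) (S.assoc X Y Z))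
    ((isNatural_assoc F G H).comp ((((isNatural_dayι tA G H).comp_prodMap_right
      (isNatural_dayι tA F (day tA G H))).precomp (prodAssoc V Aᵒᵖ Aᵒᵖ Aᵒᵖ)).comp
        (isNatural_restrict_assoc hS (day tA F (day tA G H)))))

/-- The left unitor of the Day tensor. -/
def dayLeftUnitor : Mor V (day tA (yonedaObj unit) F) F :=
  -- A pair `(f, y)` in `A(X, I) ⊗ F Y` goes to `y` restricted along `I ⊗ Y ≅ Y` and then along `f ⊗
  -- Y`. Naturality is checked separately in `X` and `Y`.
  dayDesc (fun X Y => (β_ ((yonedaObj unit).obj (op X)) (F.obj (op Y))).hom ≫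
      restrict F (S.leftUnitor Y) ▷ (yonedaObj unit).obj (op X) ≫
        actFst ((opTensor tA).comp V F) (op unit) (op X) (op Y)) (by
    refine isNatural_extTensor (L := (opTensor tA).comp V F) ?_ ?_
    · rintro ⟨Y⟩
      have h := isNatural_act ((insertRight (op Y)).comp V ((opTensor tA).comp V F)) (op unit)
      simp only [act_insertRight] at h
      exact (isNatural_braiding (yonedaObj unit) (F.obj (op Y))).comp
        ((isNatural_tensL_whiskerRight (yonedaObj unit) (restrict F (S.leftUnitor Y))).comp h)
    · rintro ⟨X⟩
      have h := isNatural_actFst ((opTensor tA).comp V F) (op unit) (op X)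
      exact ((isNatural_braiding F ((yonedaObj unit).obj (op X))).inv
        (fun _ => SymmetricCategory.symmetry _ _) (fun _ => SymmetricCategory.symmetry _ _)).comp
          (((isNatural_restrict_leftUnitor hS F).whiskerRight _).comp h))

end DayData

/-! ### The calculus of maps acting on generalized elements -/

section Carries

variable {V : Type u} [Category.{v} V] [MonoidalCategory V] [SymmetricCategory V]
  [MonoidalClosed V] [HasLimits V] [HasColimits V]
variable {A : Type v} [EnrichedCategory V A]
variable {F G K L : EnrichedFunctor V Aᵒᵖ V}

/-- The map of presheaves `φ` carries the generalized element `x` of `L c` to the generalized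
element `y` of `K c'`, up to reparametrization along `m` and restriction along `f`. -/
def Carries (φ : Mor V L K) {P Q : V} {c c' : A} (x : P ⟶ L.obj (op c)) (m : P ⟶ Q)
    (y : Q ⟶ K.obj (op c')) (f : Mor V c c') : Prop :=
  x ≫ component φ (op c) = m ≫ y ≫ restrict K f

lemma carries_eId {P : V} {c : A} (x : P ⟶ L.obj (op c)) :
    Carries (eId V L) x (𝟙 P) x (eId V c) := by
  rw [Carries, component_eId, restrict_eId, Category.id_comp]

/-- Components commute with restriction, so the part in `V` and the part in `A` compose
independently. -/
lemma Carries.mcomp {φ : Mor V F G} {ψ : Mor V G K} {P Q R : V} {c c' c'' : A}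
    {x : P ⟶ F.obj (op c)} {m : P ⟶ Q} {y : Q ⟶ G.obj (op c')} {f : Mor V c c'}
    {n : Q ⟶ R} {z : R ⟶ K.obj (op c'')} {g : Mor V c' c''} (h : Carries φ x m y f)
    (k : Carries ψ y n z g) : Carries (mcomp φ ψ) x (m ≫ n) z (DayMonad.mcomp f g) := by
  rw [Carries] at h k ⊢
  rw [component_mcomp, reassoc_of% h, restrict_component, reassoc_of% k, restrict_mcomp,
    Category.assoc]

/-- The testing principle for all laws below: two maps agree if they carry each generator to the
same element with equal parts in `V` and equal parts in `A`. -/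
lemma Generates.mor_ext_of_carries {σ : Type w} {N : σ → V} {c : σ → A}
    {i : ∀ s, N s ⟶ L.obj (op (c s))} (hi : Generates L i) {φ ψ : Mor V L K} {Q : σ → V}
    {c' : σ → A} {m m' : ∀ s, N s ⟶ Q s} {y : ∀ s, Q s ⟶ K.obj (op (c' s))}
    {f f' : ∀ s, Mor V (c s) (c' s)} (h : ∀ s, Carries φ (i s) (m s) (y s) (f s))
    (h' : ∀ s, Carries ψ (i s) (m' s) (y s) (f' s)) (hm : ∀ s, m s = m' s)
    (hf : ∀ s, f s = f' s) : φ = ψ :=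
  hi.mor_ext fun s => (h s).trans (by rw [hm, hf]; exact (h' s).symm)

end Carries

/-! ### Tensors of generalized elements, and the constraints acting on them -/

section Dmul

variable {V : Type u} [Category.{v} V] [MonoidalCategory V] [SymmetricCategory V]
  [MonoidalClosed V] [HasLimits V] [HasColimits V]
variable {A : Type v} [EnrichedCategory V A] (tA : EnrichedFunctor V (A × A) A) {unit : A}
variable {F G H K L : EnrichedFunctor V Aᵒᵖ V}

/-- The tensor product of generalized elements of two presheaves. -/
def dmul {P Q : V} {X Y : A} (x : P ⟶ F.obj (op X)) (y : Q ⟶ G.obj (op Y)) :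
    P ⊗ Q ⟶ (day tA F G).obj (op (tA.obj (X, Y))) :=
  (x ⊗ₘ y) ≫ dayι tA F G X Y

variable {tA}

lemma dayι_restrict {X X' Y Y' : A} (f : Mor V X X') (g : Mor V Y Y') :
    dayι tA F G X' Y' ≫ restrict (day tA F G) (mtensor tA f g) =
      (restrict F f ⊗ₘ restrict G g) ≫ dayι tA F G X Y := by
  have h := (isNatural_dayι tA F G).pact (X := (op X', op Y')) (Y := (op X, op Y)) (mpair f g)
  have h1 : pact (extTensor F G) (X := (op X', op Y')) (Y := (op X, op Y)) (mpair f g) =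
      (ρ_ _).hom ≫ (restrict F f ⊗ₘ restrict G g) := by
    have e := pact_extTensor F G (X := (op X', op Y')) (Y := (op X, op Y)) f g
    rw [pact_restrict, pact_restrict, ← tensorHom_comp_tensorHom] at e
    have k := tensor_right_unitality (F.obj (op X')) (G.obj (op Y'))
    refine (whiskerLeft_pact (extTensor F G) (X := (op X', op Y')) (Y := (op X, op Y))
      (λ_ (𝟙_ V)).inv (f ⊗ₘ g)).symm.trans ((congrArg (fun z => _ ≫ z) e).trans ?_)
    exact ((reassoc_of% k) (restrict F f ⊗ₘ restrict G g)).symm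
  have h2 : pact ((opTensor tA).comp V (day tA F G)) (X := (op X', op Y')) (Y := (op X, op Y))
      (mpair f g) = (ρ_ _).hom ≫ restrict (day tA F G) (mtensor tA f g) := by
    refine (pact_functor_comp (opTensor tA) (day tA F G) _).trans ?_
    rw [← pact_restrict, mtensor_eq]
    rfl
  rw [h1, h2] at h
  have h' : (ρ_ (F.obj (op X') ⊗ G.obj (op Y'))).hom ≫ (restrict F f ⊗ₘ restrict G g) ≫
      dayι tA F G X Y = dayι tA F G X' Y' ▷ 𝟙_ V ≫ (ρ_ _).hom ≫
        restrict (day tA F G) (mtensor tA f g) := (Category.assoc _ _ _).symm.trans h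
  rw [rightUnitor_naturality_assoc] at h'
  exact ((cancel_epi _).1 h').symm

/-- Naturality of `dayι` in the presheaves handles `φ ⊗ ψ`; its naturality in the objects of `A`
gathers the two restrictions into one along `f ⊗ g`. -/
lemma Carries.mtensor {F' G' : EnrichedFunctor V Aᵒᵖ V} {φ : Mor V F F'} {ψ : Mor V G G'}
    {P Q P' Q' : V} {X X' Y Y' : A}
    {x : P ⟶ F.obj (op X)} {m : P ⟶ P'} {x' : P' ⟶ F'.obj (op X')} {f : Mor V X X'}
    {y : Q ⟶ G.obj (op Y)} {n : Q ⟶ Q'} {y' : Q' ⟶ G'.obj (op Y')} {g : Mor V Y Y'}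
    (h : Carries φ x m x' f) (k : Carries ψ y n y' g) :
    Carries (mtensor (dayTensor tA) φ ψ) (dmul tA x y) (m ⊗ₘ n) (dmul tA x' y')
      (DayMonad.mtensor tA f g) := by
  rw [Carries] at h k ⊢
  rw [dmul, dmul, Category.assoc, dayι_mtensor, tensorHom_comp_tensorHom_assoc, h, k,
    Category.assoc, dayι_restrict, tensorHom_comp_tensorHom_assoc, tensorHom_comp_tensorHom_assoc,
    Category.assoc, Category.assoc]

section Laws

variable {S : MonoidalData tA unit} {D : MonoidalData (dayTensor tA) (yonedaObj unit)}
  (hD : IsDayData S D)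

include hD

lemma IsDayData.carries_braiding {P Q : V} {X Y : A} (x : P ⟶ F.obj (op X))
    (y : Q ⟶ G.obj (op Y)) :
    Carries (D.braiding F G) (dmul tA x y) (β_ P Q).hom (dmul tA y x) (S.braiding X Y) := by
  rw [Carries, dmul, dmul, Category.assoc, hD.braiding, Category.assoc,
    BraidedCategory.braiding_naturality_assoc]

/-- The defining equation of the associator, precomposed with arbitrary elements. In this form it
can be chained with other constraints. -/
lemma IsDayData.carries_assoc {P Q R : V} {X Y Z : A} (x : P ⟶ F.obj (op X))
    (y : Q ⟶ G.obj (op Y)) (z : R ⟶ H.obj (op Z)) :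
    Carries (D.assoc F G H) (dmul tA (dmul tA x y) z) (α_ P Q R).hom
      (dmul tA x (dmul tA y z)) (S.assoc X Y Z) := by
  have e1 : ((x ⊗ₘ y) ≫ dayι tA F G X Y) ⊗ₘ z =
      ((x ⊗ₘ y) ⊗ₘ z) ≫ dayι tA F G X Y ▷ H.obj (op Z) := by
    rw [← MonoidalCategory.tensorHom_id, tensorHom_comp_tensorHom, Category.comp_id]
  have e2 : x ⊗ₘ ((y ⊗ₘ z) ≫ dayι tA G H Y Z) =
      (x ⊗ₘ (y ⊗ₘ z)) ≫ F.obj (op X) ◁ dayι tA G H Y Z := by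
    rw [← MonoidalCategory.id_tensorHom, tensorHom_comp_tensorHom, Category.comp_id]
  rw [Carries, dmul, dmul, dmul, dmul, e1, e2, Category.assoc, Category.assoc, hD.assoc,
    associator_naturality_assoc, Category.assoc, Category.assoc]

lemma IsDayData.carries_leftUnitor {P : V} {X : A} (x : P ⟶ F.obj (op X)) :
    Carries (D.leftUnitor F) (dmul tA (F := yonedaObj unit) (eId V unit) x) (λ_ P).hom x
      (S.leftUnitor X) := by
  have h := hD.leftUnitor F X
  refine (Category.assoc _ _ _).trans ?_
  refine (congrArg (fun z => z ≫ _) (MonoidalCategory.tensorHom_def' _ _)).trans ((Category.assoc _ _ _).trans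
    ((congrArg (fun z => _ ≫ z) h).trans ?_))
  exact leftUnitor_naturality_assoc _ _

lemma IsDayData.carries_rightUnitor {P : V} {X : A} (x : P ⟶ F.obj (op X)) :
    Carries (D.rightUnitor F) (dmul tA (G := yonedaObj unit) x (eId V unit)) (ρ_ P).hom x
      (S.rightUnitor X) := by
  have h := hD.rightUnitor F X
  refine (Category.assoc _ _ _).trans ?_
  refine (congrArg (fun z => z ≫ _) (MonoidalCategory.tensorHom_def _ _)).trans ((Category.assoc _ _ _).trans
    ((congrArg (fun z => _ ≫ z) h).trans ?_))
  exact rightUnitor_naturality_assoc _ _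

end Laws

end Dmul

/-! ### The canonical structure maps and their defining equations -/

section DayData

variable {V : Type u} [Category.{v} V] [MonoidalCategory V] [SymmetricCategory V]
  [MonoidalClosed V] [HasLimits V] [HasColimits V]
variable {A : Type v} [EnrichedCategory V A] {tA : EnrichedFunctor V (A × A) A} {unit : A}
  {S : MonoidalData tA unit} (hS : IsSymmetricMonoidal S)

/-- The symmetric monoidal structure maps of the Day tensor. -/
def dayData : MonoidalData (dayTensor tA) (yonedaObj unit) where
  assoc F G H := dayAssoc hS F G H
  leftUnitor F := dayLeftUnitor hS F
  -- Coherence leaves no choice: the right unitor must be the braiding followed by the left unitor.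
  -- Its defining equation then comes from the same identity in `A`.
  rightUnitor F := mcomp (dayBraiding hS F (yonedaObj unit)) (dayLeftUnitor hS F)
  braiding F G := dayBraiding hS F G

lemma dayι_braiding (F G : EnrichedFunctor V Aᵒᵖ V) (X Y : A) :
    dayι tA F G X Y ≫ component (dayBraiding hS F G) (op (tA.obj (X, Y))) =
      (β_ (F.obj (op X)) (G.obj (op Y))).hom ≫ dayι tA G F Y X ≫
        restrict (day tA G F) (S.braiding X Y) :=
  dayι_desc _ _ X Y

lemma dayι_leftUnitor (F : EnrichedFunctor V Aᵒᵖ V) (X : A) :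
    eId V unit ▷ F.obj (op X) ≫ dayι tA (yonedaObj unit) F unit X ≫
        component (dayLeftUnitor hS F) (op (tA.obj (unit, X))) =
      (λ_ (F.obj (op X))).hom ≫ restrict F (S.leftUnitor X) := by
  refine Eq.trans (congrArg (fun z => eId V unit ▷ F.obj (op X) ≫ z) (dayι_desc _ _ unit X)) ?_
  refine (BraidedCategory.braiding_naturality_left_assoc _ _ _).trans ?_
  have h : (F.obj (op (tA.obj (unit, X)))) ◁ eId V unit ≫
      actFst ((opTensor tA).comp V F) (op unit) (op unit) (op X) = (ρ_ _).hom := by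
    rw [← act_insertRight]
    exact act_id ((insertRight (op X)).comp V ((opTensor tA).comp V F)) (op unit)
  refine (congrArg (fun z => _ ≫ z) ((whisker_exchange_assoc _ _ _).trans
    ((congrArg (fun z => _ ≫ z) h).trans (rightUnitor_naturality _)))).trans ?_
  exact braiding_rightUnitor_assoc _ _

lemma isDayData : IsDayData S (dayData hS) where
  assoc F G H X Y Z := (dayι_desc₂ _ _ X Y Z).trans
    (congrArg (fun z => _ ≫ z) (Category.assoc _ _ _))
  leftUnitor F X := dayι_leftUnitor hS F X
  rightUnitor F X := by
    have h : component (mcomp (dayBraiding hS F (yonedaObj unit)) (dayLeftUnitor hS F))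
      (op (tA.obj (X, unit))) = component (dayBraiding hS F (yonedaObj unit)) (op (tA.obj (X, unit)))
        ≫ component (dayLeftUnitor hS F) (op (tA.obj (X, unit))) := component_mcomp _ _ _
    refine (congrArg (fun z => _ ≫ _ ≫ z) h).trans ?_
    refine (congrArg (fun z => _ ≫ z) ((Category.assoc _ _ _).symm.trans
      (congrArg (fun z => z ≫ _) (dayι_braiding hS F (yonedaObj unit) X unit)))).trans ?_
    rw [Category.assoc, Category.assoc, restrict_component, ← hS.braiding_leftUnitor,
      restrict_mcomp]
    refine (BraidedCategory.braiding_naturality_right_assoc _ _ _).trans ?_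
    have e := congrArg (fun z => z ≫ restrict F (S.braiding X unit)) (dayι_leftUnitor hS F X)
    refine (congrArg (fun z => _ ≫ z) (((congrArg (fun z => _ ≫ z)
      (Category.assoc _ _ _).symm).trans (Category.assoc _ _ _).symm).trans
        (e.trans (Category.assoc _ _ _)))).trans ?_
    exact braiding_leftUnitor_assoc _ _
  braiding F G X Y := dayι_braiding hS F G X Y

end DayData

/-! ### Coherence and invertibility of the Day constraints -/

section Laws

variable {V : Type u} [Category.{v} V] [MonoidalCategory V] [SymmetricCategory V]
  [MonoidalClosed V] [HasLimits V] [HasColimits V]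
variable {A : Type v} [EnrichedCategory V A] {tA : EnrichedFunctor V (A × A) A} {unit : A}
  {S : MonoidalData tA unit} (hS : IsSymmetricMonoidal S)
  {D : MonoidalData (dayTensor tA) (yonedaObj unit)} (hD : IsDayData S D)

include hS hD

/-- On a tensor of four elements both sides act through the pentagon in `V` and the pentagon in `A`.
The other coherence laws have the same proof, with the unit represented by the identity of `I`. -/
lemma IsDayData.pentagon (F G H K : EnrichedFunctor V Aᵒᵖ V) :
    mcomp (mtensor (dayTensor tA) (D.assoc F G H) (eId V K))
        (mcomp (D.assoc F ((dayTensor tA).obj (G, H)) K)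
          (mtensor (dayTensor tA) (eId V F) (D.assoc G H K))) =
      mcomp (D.assoc ((dayTensor tA).obj (F, G)) H K)
        (D.assoc F G ((dayTensor tA).obj (H, K))) :=
  ((((generates_self F).day (generates_self G)).day (generates_self H)).day
    (generates_self K)).mor_ext_of_carries
    (fun _ => ((hD.carries_assoc _ _ _).mtensor (carries_eId _)).mcomp
      ((hD.carries_assoc _ _ _).mcomp ((carries_eId _).mtensor (hD.carries_assoc _ _ _))))
    (fun _ => (hD.carries_assoc _ _ _).mcomp (hD.carries_assoc _ _ _))
    (fun _ => by simp) (fun _ => hS.pentagon _ _ _ _)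

lemma IsDayData.triangle (F G : EnrichedFunctor V Aᵒᵖ V) :
    mcomp (D.assoc F (yonedaObj unit) G) (mtensor (dayTensor tA) (eId V F) (D.leftUnitor G)) =
      mtensor (dayTensor tA) (D.rightUnitor F) (eId V G) :=
  (((generates_self F).day (generates_yoneda unit)).day (generates_self G)).mor_ext_of_carries
    (fun _ => (hD.carries_assoc _ _ _).mcomp
      ((carries_eId _).mtensor (hD.carries_leftUnitor _)))
    (fun _ => (hD.carries_rightUnitor _).mtensor (carries_eId _))
    (fun _ => by simp) (fun _ => hS.triangle _ _)

lemma IsDayData.hexagon (F G H : EnrichedFunctor V Aᵒᵖ V) :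
    mcomp (D.assoc F G H) (mcomp (D.braiding F ((dayTensor tA).obj (G, H))) (D.assoc G H F)) =
      mcomp (mtensor (dayTensor tA) (D.braiding F G) (eId V H))
        (mcomp (D.assoc G F H) (mtensor (dayTensor tA) (eId V G) (D.braiding F H))) :=
  (((generates_self F).day (generates_self G)).day (generates_self H)).mor_ext_of_carries
    (fun _ => (hD.carries_assoc _ _ _).mcomp ((hD.carries_braiding _ _).mcomp
      (hD.carries_assoc _ _ _)))
    (fun _ => ((hD.carries_braiding _ _).mtensor (carries_eId _)).mcomp
      ((hD.carries_assoc _ _ _).mcomp ((carries_eId _).mtensor (hD.carries_braiding _ _))))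
    (fun _ => by simp) (fun _ => hS.hexagon _ _ _)

lemma IsDayData.symmetry (F G : EnrichedFunctor V Aᵒᵖ V) :
    mcomp (D.braiding F G) (D.braiding G F) = eId V ((dayTensor tA).obj (F, G)) :=
  ((generates_self F).day (generates_self G)).mor_ext_of_carries
    (fun _ => (hD.carries_braiding _ _).mcomp (hD.carries_braiding _ _))
    (fun _ => carries_eId _) (fun _ => by simp) (fun _ => hS.symmetry _ _)

lemma IsDayData.cycle (F G H : EnrichedFunctor V Aᵒᵖ V) :
    mcomp (D.assoc F G H) (mcomp (D.braiding F ((dayTensor tA).obj (G, H))) (mcomp (D.assoc G H F)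
      (mcomp (D.braiding G ((dayTensor tA).obj (H, F))) (mcomp (D.assoc H F G)
        (D.braiding H ((dayTensor tA).obj (F, G))))))) = eId V _ :=
  (((generates_self F).day (generates_self G)).day (generates_self H)).mor_ext_of_carries
    (fun _ => (hD.carries_assoc _ _ _).mcomp ((hD.carries_braiding _ _).mcomp
      ((hD.carries_assoc _ _ _).mcomp ((hD.carries_braiding _ _).mcomp
        ((hD.carries_assoc _ _ _).mcomp (hD.carries_braiding _ _))))))
    (fun _ => carries_eId _) (fun _ => assoc_braiding_cycle _ _ _) (fun _ => hS.cycle _ _ _)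

/-- The cycle for `F`, `G`, `H` exhibits the remaining five arrows as an inverse on one side. The
cycle for `G`, `H`, `F`, conjugated by an invertible braiding, shows that they are an inverse on the
other side. -/
lemma IsDayData.assoc_iso (F G H : EnrichedFunctor V Aᵒᵖ V) : MIsIso (D.assoc F G H) := by
  refine ⟨mcomp (D.braiding F ((dayTensor tA).obj (G, H))) (mcomp (D.assoc G H F)
      (mcomp (D.braiding G ((dayTensor tA).obj (H, F))) (mcomp (D.assoc H F G)
        (D.braiding H ((dayTensor tA).obj (F, G)))))), hD.cycle hS F G H, ?_⟩
  have h := hD.cycle hS G H F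
  have e : ∀ {X Y Z W : EnrichedFunctor V Aᵒᵖ V} {a : Mor V X Y} {a' : Mor V Y X}
      {b : Mor V Y Z} {c : Mor V Z W} {d : Mor V W X}, mcomp a a' = eId V X →
      mcomp b (mcomp c (mcomp d a)) = eId V Y → mcomp a (mcomp b (mcomp c d)) = eId V X := by
    intro X Y Z W a a' b c d h₁ h₂
    have := congrArg (fun z => mcomp a (mcomp z a')) h₂
    simpa only [mcomp_assoc, h₁, mcomp_eId, eId_mcomp] using this
  have k := e (hD.symmetry hS F ((dayTensor tA).obj (G, H)))
    (b := mcomp (D.assoc G H F) (D.braiding G ((dayTensor tA).obj (H, F))))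
    (c := mcomp (D.assoc H F G) (D.braiding H ((dayTensor tA).obj (F, G))))
    (d := D.assoc F G H) (by simpa only [mcomp_assoc] using h)
  simpa only [mcomp_assoc] using k

omit hS hD in
lemma MIsIso.mcomp {C : Type w} [EnrichedCategory V C] {X Y Z : C} {f : Mor V X Y} {g : Mor V Y Z}
    (hf : MIsIso f) (hg : MIsIso g) : MIsIso (DayMonad.mcomp f g) := by
  obtain ⟨f', h₁, h₂⟩ := hf
  obtain ⟨g', k₁, k₂⟩ := hg
  refine ⟨DayMonad.mcomp g' f', ?_, ?_⟩
  · rw [mcomp_assoc, ← mcomp_assoc g, k₁, eId_mcomp, h₁]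
  · rw [mcomp_assoc, ← mcomp_assoc f', h₂, eId_mcomp, k₂]

omit hD in
lemma isNatural_insert_restrict {F K : EnrichedFunctor V Aᵒᵖ V} {Q : V} (e : 𝟙_ V ⟶ Q)
    {b : ∀ X : Aᵒᵖ, Q ⊗ F.obj X ⟶ K.obj (op (tA.obj (unit, X.unop)))}
    (hb : IsNatural (tensL Q F) ((insertLeft (op unit)).comp V ((opTensor tA).comp V K)) b)
    {l : ∀ X : A, Mor V X (tA.obj (unit, X))}
    (h₁ : ∀ X, DayMonad.mcomp (S.leftUnitor X) (l X) = eId V _)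
    (h₂ : ∀ X, DayMonad.mcomp (l X) (S.leftUnitor X) = eId V X) :
    IsNatural F K (fun X => (((λ_ (F.obj X)).inv ≫ e ▷ F.obj X) ≫ b X) ≫
      restrict K (l X.unop)) := by
  have k := isNatural_restrict_leftUnitor hS K
  have k' := k.inv (c := fun X => restrict K (l X.unop))
    (fun X => (restrict_mcomp _ _ _).symm.trans ((congrArg _ (h₂ X.unop)).trans (restrict_eId _ _)))
    (fun X => (restrict_mcomp _ _ _).symm.trans ((congrArg _ (h₁ X.unop)).trans (restrict_eId _ _)))
  exact ((isNatural_insert F e).comp hb).comp k'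

omit hD in
/-- The inverse of the left unitor of the Day tensor. -/
def dayLeftUnitorInv (F : EnrichedFunctor V Aᵒᵖ V) {l : ∀ X : A, Mor V X (tA.obj (unit, X))}
    (h₁ : ∀ X, mcomp (S.leftUnitor X) (l X) = eId V _)
    (h₂ : ∀ X, mcomp (l X) (S.leftUnitor X) = eId V X) :
    Mor V F (day tA (yonedaObj unit) F) :=
  morOf _ (isNatural_insert_restrict hS (K := day tA (yonedaObj unit) F) (eId V unit)
    ((isNatural_dayι tA (yonedaObj unit) F).extTensor_snd (op unit)) h₁ h₂)

/-- The inverse sends `x` to `1_I ⊗ x` restricted along the inverse unitor of `A`. Elements of the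
form `1_I ⊗ x` generate `A(-, I) ⊗ F`, so both composites can be tested on them. -/
lemma IsDayData.leftUnitor_iso (F : EnrichedFunctor V Aᵒᵖ V) : MIsIso (D.leftUnitor F) := by
  choose l h₁ h₂ using hS.leftUnitor_iso
  have h : ∀ {P : V} {X : A} (x : P ⟶ F.obj (op X)),
      Carries (dayLeftUnitorInv hS F h₁ h₂) x (λ_ P).inv
        (dmul tA (F := yonedaObj unit) (eId V unit) x) (l X) := by
    intro P X x
    refine (congrArg (fun z => x ≫ z) (component_morOf _ _ _)).trans ?_
    have e : x ≫ (λ_ (F.obj (op X))).inv ≫ eId V unit ▷ F.obj (op X) =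
        (λ_ P).inv ≫ (eId V unit ⊗ₘ x) := by
      rw [leftUnitor_inv_naturality_assoc, MonoidalCategory.tensorHom_def']
    have e' : ∀ {M M' : V} (f : hom V unit unit ⊗ F.obj (op X) ⟶ M) (g : M ⟶ M'),
        x ≫ (((λ_ (F.obj (op X))).inv ≫ eId V unit ▷ F.obj (op X)) ≫ f) ≫ g =
          (λ_ P).inv ≫ ((eId V unit ⊗ₘ x) ≫ f) ≫ g := by
      intro M M' f g
      rw [Category.assoc, Category.assoc, reassoc_of% e, Category.assoc]
    exact e' _ _
  refine ⟨dayLeftUnitorInv hS F h₁ h₂, ?_, ?_⟩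
  · exact (((generates_yoneda unit).day (generates_self F)).mor_ext_of_carries
      (fun _ => (hD.carries_leftUnitor _).mcomp (h _))
      (fun _ => carries_eId _) (fun _ => by simp) (fun _ => h₁ _))
  · exact ((generates_self F).mor_ext_of_carries (fun _ => (h _).mcomp (hD.carries_leftUnitor _))
      (fun _ => carries_eId _) (fun _ => by simp) (fun _ => h₂ _))

lemma IsDayData.braiding_leftUnitor (F : EnrichedFunctor V Aᵒᵖ V) :
    mcomp (D.braiding F (yonedaObj unit)) (D.leftUnitor F) = D.rightUnitor F :=
  ((generates_self F).day (generates_yoneda unit)).mor_ext_of_carries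
    (fun _ => (hD.carries_braiding _ _).mcomp (hD.carries_leftUnitor _))
    (fun _ => hD.carries_rightUnitor _) (fun _ => by simp) (fun _ => hS.braiding_leftUnitor _)

lemma IsDayData.rightUnitor_iso (F : EnrichedFunctor V Aᵒᵖ V) : MIsIso (D.rightUnitor F) := by
  rw [← hD.braiding_leftUnitor hS]
  exact MIsIso.mcomp ⟨_, hD.symmetry hS _ _, hD.symmetry hS _ _⟩ (hD.leftUnitor_iso hS F)

end Laws

/-! ### `V`-naturality of the Day constraints -/

section Naturality

variable {V : Type u} [Category.{v} V] [MonoidalCategory V] [SymmetricCategory V]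
  [MonoidalClosed V] [HasLimits V] [HasColimits V]
variable {A : Type v} [EnrichedCategory V A] {tA : EnrichedFunctor V (A × A) A} {unit : A}
  {S : MonoidalData tA unit} (hS : IsSymmetricMonoidal S)
  {D : MonoidalData (dayTensor tA) (yonedaObj unit)} (hD : IsDayData S D)

lemma IsNatural.congr {C : Type w₁} [EnrichedCategory V C] {M N : EnrichedFunctor V C V}
    {b c : ∀ X, M.obj X ⟶ N.obj X} (hb : IsNatural M N b) (h : ∀ X, b X = c X) :
    IsNatural M N c := by
  rwa [← show b = c from funext h]

lemma IsNatural.to_id_comp {C : Type w₁} [EnrichedCategory V C] {M N : EnrichedFunctor V C V}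
    {b : ∀ X, M.obj X ⟶ N.obj X} (hb : IsNatural M N b) :
    IsNatural M ((EnrichedFunctor.id V C).comp V N) b :=
  fun X Y => (hb X Y).trans (congrArg (fun z => _ ≫ z) (act_id_comp N X Y).symm)

lemma Generates.congr {L : EnrichedFunctor V Aᵒᵖ V} {σ : Type w} {N : σ → V} {c : σ → A}
    {i j : ∀ s, N s ⟶ L.obj (op (c s))} (hi : Generates L i) (h : ∀ s, i s = j s) :
    Generates L j := by
  rwa [← show i = j from funext h]

lemma generates_dayι (F G : EnrichedFunctor V Aᵒᵖ V) :
    Generates (day tA F G) (σ := A × A) (c := fun s => tA.obj (s.1, s.2))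
      (fun s => dayι tA F G s.1 s.2) :=
  ((generates_self F).day (generates_self G)).congr fun s => by
    rw [id_tensorHom_id, Category.id_comp]

lemma generates_dayι_dayι (F G H : EnrichedFunctor V Aᵒᵖ V) :
    Generates (day tA (day tA F G) H) (σ := (A × A) × A)
      (c := fun s => tA.obj (tA.obj (s.1.1, s.1.2), s.2))
      (fun s => dayι tA F G s.1.1 s.1.2 ▷ H.obj (op s.2) ≫
        dayι tA (day tA F G) H (tA.obj (s.1.1, s.1.2)) s.2) :=
  ((generates_dayι F G).day (generates_self H)).congr fun s => by
    rw [MonoidalCategory.tensorHom_id]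

lemma generates_eId_dayι (I : A) (F : EnrichedFunctor V Aᵒᵖ V) :
    Generates (day tA (yonedaObj I) F) (σ := A) (c := fun X => tA.obj (I, X))
      (fun X => eId V I ▷ F.obj (op X) ≫ dayι tA (yonedaObj I) F I X) := by
  intro K P f g hf hg h
  refine ((generates_yoneda I).day (generates_self F)) K P f g hf hg ?_
  rintro ⟨-, X⟩
  have e := MonoidalCategory.tensorHom_id (eId V I) (F.obj (op X))
  exact (congrArg (fun z => (z ≫ dayι tA (yonedaObj I) F I X) ▷ P ≫ f _) e).trans
    ((h X).trans (congrArg (fun z => (z ≫ dayι tA (yonedaObj I) F I X) ▷ P ≫ g _) e.symm))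

lemma generates_dayι_eId (I : A) (F : EnrichedFunctor V Aᵒᵖ V) :
    Generates (day tA F (yonedaObj I)) (σ := A) (c := fun X => tA.obj (X, I))
      (fun X => F.obj (op X) ◁ eId V I ≫ dayι tA F (yonedaObj I) X I) := by
  intro K P f g hf hg h
  refine ((generates_self F).day (generates_yoneda I)) K P f g hf hg ?_
  rintro ⟨X, -⟩
  have e := MonoidalCategory.id_tensorHom (F.obj (op X)) (eId V I)
  exact (congrArg (fun z => (z ≫ dayι tA F (yonedaObj I) X I) ▷ P ≫ f _) e).trans
    ((h X).trans (congrArg (fun z => (z ≫ dayι tA F (yonedaObj I) X I) ▷ P ≫ g _) e.symm))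

include hD

/-- The defining equation expresses the associator on the generators at `X`, `Y`, `Z` as an
associator of `V`, two maps `dayι` and a restriction, each natural in the presheaves. The other
constraints follow the same pattern. -/
lemma IsDayData.assoc_nat : IsNat
    ((prodMap (dayTensor tA) (EnrichedFunctor.id V _)).comp V (dayTensor tA))
    ((prodAssoc V _ _ _).comp V
      ((prodMap (EnrichedFunctor.id V _) (dayTensor tA)).comp V (dayTensor tA)))
    (fun X => D.assoc X.1.1 X.1.2 X.2) := by
  refine isNat_of_generates (σ := (A × A) × A)
    (c := fun s => tA.obj (tA.obj (s.1.1, s.1.2), s.2))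
    (fun s => extTensor (extTensor (evalF (V := V) (op s.1.1)) (evalF (op s.1.2)))
      (evalF (op s.2)))
    (fun s x => dayι tA x.1.1 x.1.2 s.1.1 s.1.2 ▷ x.2.obj (op s.2) ≫
        dayι tA (day tA x.1.1 x.1.2) x.2 (tA.obj (s.1.1, s.1.2)) s.2)
    (fun x => generates_dayι_dayι x.1.1 x.1.2 x.2) ?_ ?_
  · rintro ⟨⟨X, Y⟩, Z⟩
    exact ((isNatural_dayι_presheaf tA X Y).comp_prodMap_left (J := dayTensor tA)
      (G := evalF (op Z)) (F := evalF (op (tA.obj (X, Y))))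
      (isNatural_dayι_presheaf tA (tA.obj (X, Y)) Z)).assoc
  · rintro ⟨⟨X, Y⟩, Z⟩
    have h := ((isNatural_assoc (evalF (V := V) (op X)) (evalF (op Y)) (evalF (op Z))).comp
      ((((isNatural_dayι_presheaf tA Y Z).comp_prodMap_right (J := dayTensor tA)
        (G := evalF (op X)) (F := evalF (op (tA.obj (Y, Z))))
        (isNatural_dayι_presheaf tA X (tA.obj (Y, Z)))).assoc.precomp (prodAssoc V _ _ _)).assoc)).comp
      ((isNatural_restrict (S.assoc X Y Z)).precomp ((prodAssoc V _ _ _).comp V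
      ((prodMap (EnrichedFunctor.id V _) (dayTensor tA)).comp V (dayTensor tA))))
    refine h.congr fun x => ?_
    refine Eq.trans ?_ ((Category.assoc _ _ _).trans (hD.assoc x.1.1 x.1.2 x.2 X Y Z)).symm
    exact (Category.assoc _ _ _).trans (congrArg (fun z => _ ≫ z) (Category.assoc _ _ _))

lemma IsDayData.leftUnitor_nat : IsNat ((insertLeft (yonedaObj unit)).comp V (dayTensor tA))
    (EnrichedFunctor.id V _) D.leftUnitor := by
  refine isNat_of_generates (σ := A) (c := fun X => tA.obj (unit, X))
    (fun X => tensL (𝟙_ V) (evalF (V := V) (op X)))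
    (fun X F => eId V unit ▷ F.obj (op X) ≫ dayι tA (yonedaObj unit) F unit X)
    (fun F => generates_eId_dayι unit F) ?_ ?_
  · intro X
    exact ((isNatural_tensL_whiskerRight (evalF (V := V) (op X))
      (Q := (yonedaObj unit).obj (op unit)) (eId V unit)).comp
        ((isNatural_dayι_presheaf tA unit X).extTensor_snd (yonedaObj unit))).assoc
  · intro X
    have h := ((isNatural_leftUnitor (evalF (V := V) (op X))).comp
      (isNatural_restrict (S.leftUnitor X))).to_id_comp
    exact h.congr fun F => (hD.leftUnitor F X).symm.trans (Category.assoc _ _ _).symm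

lemma IsDayData.rightUnitor_nat : IsNat ((insertRight (yonedaObj unit)).comp V (dayTensor tA))
    (EnrichedFunctor.id V _) D.rightUnitor := by
  refine isNat_of_generates (σ := A) (c := fun X => tA.obj (X, unit))
    (fun X => tensR (evalF (V := V) (op X)) (𝟙_ V))
    (fun X F => F.obj (op X) ◁ eId V unit ≫ dayι tA F (yonedaObj unit) X unit)
    (fun F => generates_dayι_eId unit F) ?_ ?_
  · intro X
    exact ((isNatural_tensR_whiskerLeft (evalF (V := V) (op X))
      (Q := (yonedaObj unit).obj (op unit)) (eId V unit)).comp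
        ((isNatural_dayι_presheaf tA X unit).extTensor_fst (yonedaObj unit))).assoc
  · intro X
    have h := ((isNatural_rightUnitor (evalF (V := V) (op X))).comp
      (isNatural_restrict (S.rightUnitor X))).to_id_comp
    exact h.congr fun F => (hD.rightUnitor F X).symm.trans (Category.assoc _ _ _).symm

lemma IsDayData.braiding_nat : IsNat (dayTensor tA) ((prodSwap V _ _).comp V (dayTensor tA))
    (fun X => D.braiding X.1 X.2) := by
  refine isNat_of_generates (σ := A × A) (c := fun s => tA.obj (s.1, s.2))
    (fun s => extTensor (evalF (V := V) (op s.1)) (evalF (op s.2)))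
    (fun s x => dayι tA x.1 x.2 s.1 s.2) (fun x => generates_dayι x.1 x.2) ?_ ?_
  · rintro ⟨X, Y⟩
    exact isNatural_dayι_presheaf tA X Y
  · rintro ⟨X, Y⟩
    have h := ((isNatural_swap (evalF (V := V) (op X)) (evalF (op Y))).comp
      ((isNatural_dayι_presheaf tA Y X).precomp (prodSwap V _ _)).assoc).comp
      ((isNatural_restrict (S.braiding X Y)).precomp ((prodSwap V _ _).comp V (dayTensor tA)))
    exact h.congr fun x => (Category.assoc _ _ _).trans (hD.braiding x.1 x.2 X Y).symm

include hS in
/-- The Day tensor is symmetric monoidal. -/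
theorem IsDayData.isSymmetricMonoidal : IsSymmetricMonoidal D where
  assoc_iso := hD.assoc_iso hS
  leftUnitor_iso := hD.leftUnitor_iso hS
  rightUnitor_iso := hD.rightUnitor_iso hS
  assoc_nat := hD.assoc_nat
  leftUnitor_nat := hD.leftUnitor_nat
  rightUnitor_nat := hD.rightUnitor_nat
  braiding_nat := hD.braiding_nat
  pentagon := hD.pentagon hS
  triangle := hD.triangle hS
  hexagon := hD.hexagon hS
  symmetry := hD.symmetry hS

end Naturality

/-! ### Naturality of unit, multiplication and strength for morphisms of `V` -/

section OnHom

variable {V : Type u} [Category.{v} V] [MonoidalCategory V] [SymmetricCategory V]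
  [MonoidalClosed V]
variable {T : EnrichedFunctor V V V} (M : StrongMonad (selfData V) T)

lemma unitMap_onHom {X Y : V} (f : X ⟶ Y) : f ≫ unitMap M Y = unitMap M X ≫ onHom T f := by
  have h := unitMap_natural M ((ρ_ X).hom ≫ f)
  rw [mapAct_rightUnitor, rightUnitor_naturality_assoc, Category.assoc] at h
  exact (cancel_epi _).1 h

lemma mulMap_onHom {X Y : V} (f : X ⟶ Y) :
    onHom T (onHom T f) ≫ mulMap M Y = mulMap M X ≫ onHom T f := by
  have h := mulMap_natural M ((ρ_ X).hom ≫ f)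
  rw [mapAct_rightUnitor, mapAct_rightUnitor, rightUnitor_naturality_assoc, Category.assoc] at h
  exact (cancel_epi _).1 h

/-- This is `str_natural` with both parameters trivial. -/
lemma str_onHom {X X' Y Y' : V} (f : X ⟶ X') (g : Y ⟶ Y') :
    (f ⊗ₘ onHom T g) ≫ str M X' Y' = str M X Y ≫ onHom T (f ⊗ₘ g) := by
  have h := congrArg (fun z => (X ⊗ T.obj Y) ◁ (λ_ (𝟙_ V)).inv ≫ z)
    (str_natural M ((ρ_ X).hom ≫ f) ((ρ_ Y).hom ≫ g))
  have k := tensor_right_unitality X (T.obj Y)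
  have k' := tensor_right_unitality X Y
  rw [mapAct_rightUnitor, ← tensorHom_comp_tensorHom, ← tensorHom_comp_tensorHom,
    Category.assoc, ← reassoc_of% k, whisker_exchange_assoc, ← mapAct_whiskerLeft,
    ← reassoc_of% k', mapAct_rightUnitor, rightUnitor_naturality_assoc] at h
  exact (cancel_epi _).1 h

end OnHom

/-! ### The pointwise monad on presheaves -/

section Naturality

variable {V : Type u} [Category.{v} V] [MonoidalCategory V] [SymmetricCategory V]
  [MonoidalClosed V] [HasLimits V]
variable {A : Type v} [EnrichedCategory V A] {C : Type w₁} {D : Type w₂} {E : Type w₃}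
  [EnrichedCategory V C] [EnrichedCategory V D] [EnrichedCategory V E]

lemma IsNatural.assoc_symm {N : EnrichedFunctor V C V} {J : EnrichedFunctor V C D}
    {L : EnrichedFunctor V D E} {F : EnrichedFunctor V E V}
    {b : ∀ X, N.obj X ⟶ F.obj (L.obj (J.obj X))} (hb : IsNatural N ((J.comp V L).comp V F) b) :
    IsNatural N (J.comp V (L.comp V F)) b :=
  fun X Y => (hb X Y).trans (congrArg (fun z => _ ≫ z) (act_comp_assoc J L F X Y).symm)

/-- The two functors have equal values by definition, but their maps on hom-objects agree only
through the projection equation of the end; the identity family passes from one to the other. -/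
lemma isNatural_evalF_postcomp (T : EnrichedFunctor V V V) (X : Aᵒᵖ) :
    IsNatural ((evalF (V := V) X).comp V T) ((postcomp T).comp V (evalF X))
      (fun F => 𝟙 (T.obj (F.obj X))) := by
  intro F G
  rw [act_comp_mapAct, act_postcomp_evalF]
  exact (Category.comp_id _).trans
    ((congrArg (fun z => z ≫ _) (id_whiskerRight _ _)).trans (Category.id_comp _)).symm

lemma pact_postcomp_evalF (T : EnrichedFunctor V V V) (X : Aᵒᵖ) {F G : EnrichedFunctor V Aᵒᵖ V}
    {P : V} (t : P ⟶ hom V F G) :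
    pact ((postcomp T).comp V (evalF X)) t = mapAct T (pact (evalF X) t) := by
  rw [← pact_comp_mapAct]
  exact (((Category.comp_id _).symm.trans ((isNatural_evalF_postcomp T X).pact t)).trans
    ((congrArg (fun z => z ≫ _) (id_whiskerRight _ _)).trans (Category.id_comp _))).symm

variable {T : EnrichedFunctor V V V} (M : StrongMonad (selfData V) T)

/-- The unit of the monad on presheaves. -/
def presheafUnit (F : EnrichedFunctor V Aᵒᵖ V) : Mor V F ((postcomp T).obj F) :=
  morOf (G := F.comp V T) (fun X => unitMap M (F.obj X)) (isNatural_unitMap M F)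

/-- The multiplication of the monad on presheaves. -/
def presheafMul (F : EnrichedFunctor V Aᵒᵖ V) :
    Mor V ((postcomp T).obj ((postcomp T).obj F)) ((postcomp T).obj F) :=
  morOf (F := (F.comp V T).comp V T) (G := F.comp V T) (fun X => mulMap M (F.obj X))
    (isNatural_mulMap M F)

lemma component_presheafUnit (F : EnrichedFunctor V Aᵒᵖ V) (X : Aᵒᵖ) :
    component (presheafUnit M F) X = unitMap M (F.obj X) :=
  component_morOf _ _ _

lemma component_presheafMul (F : EnrichedFunctor V Aᵒᵖ V) (X : Aᵒᵖ) :
    component (presheafMul M F) X = mulMap M (F.obj X) :=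
  component_morOf _ _ _

/-- The monad on presheaves given by post-composition with a monad. -/
def presheafMonad : EnrichedMonad (postcomp (C := Aᵒᵖ) T) where
  η := presheafUnit M
  μ := presheafMul M
  η_nat := isNat_iff_eval.2 fun X F G => by
    rw [act_postcomp_evalF, act_id_comp]
    exact (congrArg (fun z => act (evalF X) F G ≫ z) (component_presheafUnit M G X)).trans
      ((unitMap_natural M (act (evalF X) F G)).trans
        (congrArg (fun z => z ▷ hom V F G ≫ mapAct T (act (evalF X) F G))
          (component_presheafUnit M F X).symm))
  μ_nat := isNat_iff_eval.2 fun X F G => by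
    have e : act (((postcomp T).comp V (postcomp T)).comp V (evalF X)) F G =
        mapAct T (mapAct T (act (evalF X) F G)) := by
      rw [← act_comp_assoc, act_comp', pact_postcomp_evalF, ← act_comp', act_postcomp_evalF]
      rfl
    rw [act_postcomp_evalF, e]
    exact (congrArg (fun z => mapAct T (mapAct T (act (evalF X) F G)) ≫ z)
      (component_presheafMul M G X)).trans ((mulMap_natural M (act (evalF X) F G)).trans
        (congrArg (fun z => z ▷ hom V F G ≫ mapAct T (act (evalF X) F G))
          (component_presheafMul M F X).symm))
  left_unit F := mor_ext fun X => by
    rw [component_mcomp, component_presheafUnit, component_presheafMul, component_eId]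
    exact unitMap_mulMap M (F.obj X)
  right_unit F := mor_ext fun X => by
    rw [component_mcomp, component_mmap_postcomp, component_presheafUnit, component_presheafMul,
      component_eId]
    exact onHom_unitMap_mulMap M (F.obj X)
  assoc F := mor_ext fun X => by
    rw [component_mcomp, component_mcomp, component_mmap_postcomp, component_presheafMul,
      component_presheafMul]
    exact onHom_mulMap_mulMap M (F.obj X)

end Naturality

/-! ### The strength on presheaves -/

section Strength

variable {V : Type u} [Category.{v} V] [MonoidalCategory V] [SymmetricCategory V]
  [MonoidalClosed V] [HasLimits V] [HasColimits V]
variable {A : Type v} [EnrichedCategory V A] {tA : EnrichedFunctor V (A × A) A} {unit : A}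
variable {T : EnrichedFunctor V V V} (M : StrongMonad (selfData V) T)
variable {F G H K L : EnrichedFunctor V Aᵒᵖ V}

variable (F G) in
/-- The strength of the monad on presheaves. -/
def dayStrength : Mor V ((dayTensor tA).obj (F, (postcomp T).obj G))
    ((postcomp T).obj ((dayTensor tA).obj (F, G))) :=
  dayDesc (G := G.comp V T) (K := (day tA F G).comp V T) (fun X Y => str M (F.obj (op X)) (G.obj (op Y)) ≫ onHom T (dayι tA F G X Y))
    (((isNatural_str M F G).comp (isNatural_dayι tA F G).onHom).assoc_symm)

lemma dayι_strength (X Y : A) :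
    dayι tA F (G.comp V T) X Y ≫ component (dayStrength M F G) (op (tA.obj (X, Y))) =
      str M (F.obj (op X)) (G.obj (op Y)) ≫ onHom T (dayι tA F G X Y) :=
  dayι_desc (G := G.comp V T) (K := (day tA F G).comp V T) _ _ X Y

/-- Applying `T` changes the part in `V` to its image under `T` and keeps the part in `A`, since `T
∘ K` restricts by `T` of the restriction of `K`. -/
lemma Carries.mmap {φ : Mor V L K} {P Q : V} {c c' : A} {x : P ⟶ L.obj (op c)} {m : P ⟶ Q}
    {y : Q ⟶ K.obj (op c')} {f : Mor V c c'} (h : Carries φ x m y f) :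
    Carries (L := L.comp V T) (K := K.comp V T) (mmap (postcomp T) φ) (onHom T x) (onHom T m)
      (onHom T y) f := by
  rw [Carries] at h
  have e := congrArg (onHom T) h
  rw [onHom_comp, onHom_comp, onHom_comp, ← restrict_comp] at e
  exact (congrArg (fun z => _ ≫ z) (component_mmap_postcomp φ (op c))).trans e

lemma carries_of_eId {φ : Mor V L K} {P Q : V} {c : A} {x : P ⟶ L.obj (op c)} {m : P ⟶ Q}
    {y : Q ⟶ K.obj (op c)} (h : x ≫ component φ (op c) = m ≫ y) :
    Carries φ x m y (eId V c) := by
  rw [Carries, restrict_eId, Category.comp_id, h]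

lemma carries_unit {P : V} {c : A} (x : P ⟶ F.obj (op c)) :
    Carries (K := F.comp V T) (presheafUnit M F) x (unitMap M P) (onHom T x) (eId V c) :=
  carries_of_eId ((congrArg (fun z => _ ≫ z) (component_presheafUnit M F (op c))).trans
    (unitMap_onHom M x))

lemma carries_mul {P : V} {c : A} (x : P ⟶ F.obj (op c)) :
    Carries (L := (F.comp V T).comp V T) (K := F.comp V T) (presheafMul M F)
      (onHom T (onHom T x)) (mulMap M P) (onHom T x) (eId V c) :=
  carries_of_eId ((congrArg (fun z => _ ≫ z) (component_presheafMul M F (op c))).trans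
    (mulMap_onHom M x))

/-- The defining equation of the presheaf strength combined with naturality of `t`. The part in `A`
is an identity, because the strength does not move the indices. -/
lemma carries_strength {P Q : V} {X Y : A} (x : P ⟶ F.obj (op X)) (y : Q ⟶ G.obj (op Y)) :
    Carries (K := (day tA F G).comp V T) (dayStrength M F G)
      (dmul tA (G := G.comp V T) x (onHom T y)) (str M P Q) (onHom T (dmul tA x y))
      (eId V (tA.obj (X, Y))) :=
  carries_of_eId ((Category.assoc _ _ _).trans
    ((congrArg (fun z => _ ≫ z) (dayι_strength M X Y)).trans (by
      rw [dmul, onHom_comp]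
      refine ((Category.assoc _ _ _).symm.trans (congrArg (fun z => z ≫ _)
        (str_onHom M x y))).trans (Category.assoc _ _ _))))

-- The identities of `T F X` generate `T ∘ F`; they are written as `T` of an identity so that the
-- rules for `onHom` elements apply to them.
variable (F) in
lemma generates_onHom : Generates (F.comp V T) (c := fun X : A => X)
    (fun X => onHom T (𝟙 (F.obj (op X)))) :=
  (generates_self (F.comp V T)).congr fun _ => (onHom_id T _).symm

variable (F) in
lemma generates_onHom_onHom : Generates ((F.comp V T).comp V T) (c := fun X : A => X)
    (fun X => onHom T (onHom T (𝟙 (F.obj (op X))))) :=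
  (generates_self ((F.comp V T).comp V T)).congr fun _ =>
    ((congrArg (onHom T) (onHom_id T _)).trans (onHom_id T _)).symm

section

variable {J : EnrichedFunctor V (EnrichedFunctor V Aᵒᵖ V × EnrichedFunctor V Aᵒᵖ V)
    (EnrichedFunctor V Aᵒᵖ V)} {X Y Z : Aᵒᵖ}
  {d : ∀ x : EnrichedFunctor V Aᵒᵖ V × EnrichedFunctor V Aᵒᵖ V,
    x.1.obj X ⊗ x.2.obj Y ⟶ (J.obj x).obj Z}
  (hd : IsNatural (extTensor (evalF (V := V) X) (evalF Y)) (J.comp V (evalF Z)) d)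

include hd

variable (T) in
lemma isNatural_postcomp_right : IsNatural (extTensor (evalF (V := V) X) ((evalF Y).comp V T))
    (((prodMap (EnrichedFunctor.id V _) (postcomp T)).comp V J).comp V (evalF Z))
    (fun x => d (x.1, x.2.comp V T)) := by
  have h := ((isNatural_evalF_postcomp T Y).comp_prodMap_right (J := postcomp T)
    (G := evalF X) (F := evalF Y) hd).assoc
  exact h.congr fun x => (congrArg (fun z => z ≫ _) (MonoidalCategory.whiskerLeft_id _ _)).trans
    (Category.id_comp _)

lemma isNatural_str_postcomp : IsNatural (extTensor (evalF (V := V) X) ((evalF Y).comp V T))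
    ((J.comp V (postcomp T)).comp V (evalF Z))
    (fun x => str M (x.1.obj X) (x.2.obj Y) ≫ onHom T (d x)) := by
  have h := ((isNatural_str M (evalF (V := V) X) (evalF Y)).comp hd.onHom).assoc_symm
  have h' := (h.comp ((isNatural_evalF_postcomp T Z).precomp J)).assoc
  exact h'.congr fun x => Category.comp_id _

end

/-- On generators the strength is `t` followed by `T` of `dayι`, and both are natural in the two
presheaves. -/
lemma dayStrength_nat : IsNat ((prodMap (EnrichedFunctor.id V _) (postcomp T)).comp V (dayTensor tA))
    ((dayTensor tA).comp V (postcomp T)) (fun X => dayStrength (tA := tA) M X.1 X.2) := by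
  have hi : ∀ x : EnrichedFunctor V Aᵒᵖ V × EnrichedFunctor V Aᵒᵖ V,
      Generates (((prodMap (EnrichedFunctor.id V _) (postcomp T)).comp V (dayTensor tA)).obj x)
        (fun s : A × A => dayι tA x.1 (x.2.comp V T) s.1 s.2) :=
    fun x => generates_dayι (tA := tA) x.1 (x.2.comp V T)
  refine isNat_of_generates (σ := A × A) (c := fun s => tA.obj (s.1, s.2))
    (fun s => extTensor (evalF (V := V) (op s.1)) ((evalF (op s.2)).comp V T))
    (fun s x => dayι tA x.1 (x.2.comp V T) s.1 s.2) hi ?_ ?_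
  · rintro ⟨X, Y⟩
    exact isNatural_postcomp_right T (isNatural_dayι_presheaf tA X Y)
  · rintro ⟨X, Y⟩
    exact (isNatural_str_postcomp M (isNatural_dayι_presheaf tA X Y)).congr
      fun x => (dayι_strength M X Y).symm

variable {S : MonoidalData tA unit} {D : MonoidalData (dayTensor tA) (yonedaObj unit)}

/-- The strong monad on presheaves given by post-composition with a strong monad. -/
def presheafStrongMonad (hD : IsDayData S D) : StrongMonad D (postcomp T) where
  toEnrichedMonad := presheafMonad M
  strength F G := dayStrength M F G
  strength_nat := dayStrength_nat M
  -- Every axiom is tested on tensors of elements: the part in `V` is the same axiom for `T`, and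
  -- the part in `A` involves only identities and at most one constraint of `A`.
  strength_unit F G := ((generates_self F).day (generates_self G)).mor_ext_of_carries
    (fun _ => ((carries_eId _).mtensor (carries_unit M _)).mcomp (carries_strength M _ _))
    (fun _ => carries_unit M _) (fun _ => by rw [id_tensorHom, str_unit])
    (fun _ => by rw [mtensor_eId, mcomp_eId])
  strength_leftUnitor F := ((generates_yoneda unit).day (generates_onHom F)).mor_ext_of_carries
    (fun _ => (carries_strength M _ _).mcomp (hD.carries_leftUnitor _).mmap)
    (fun _ => hD.carries_leftUnitor _) (fun _ => str_leftUnitor M _) (fun _ => eId_mcomp _)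
  strength_mul F G := ((generates_self F).day (generates_onHom_onHom G)).mor_ext_of_carries
    (fun _ => (carries_strength M _ _).mcomp ((carries_strength M _ _).mmap.mcomp
      (carries_mul M _)))
    (fun _ => ((carries_eId _).mtensor (carries_mul M _)).mcomp (carries_strength M _ _))
    (fun _ => by rw [id_tensorHom, str_mul])
    (fun _ => by rw [mtensor_eId, eId_mcomp])
  strength_assoc F G H :=
    (((generates_self F).day (generates_self G)).day (generates_onHom H)).mor_ext_of_carries
      (fun _ => (carries_strength M _ _).mcomp (hD.carries_assoc _ _ _).mmap)
      (fun _ => (hD.carries_assoc _ _ _).mcomp (((carries_eId _).mtensor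
        (carries_strength M _ _)).mcomp (carries_strength M _ _)))
      (fun _ => by rw [id_tensorHom, str_assoc])
      (fun _ => by rw [mtensor_eId, eId_mcomp, mcomp_eId, mcomp_eId])

end Strength

/-! ### Commutativity -/

section Commutative

variable {V : Type u} [Category.{v} V] [MonoidalCategory V] [SymmetricCategory V]
  [MonoidalClosed V] [HasLimits V] [HasColimits V]
variable {A : Type v} [EnrichedCategory V A] {tA : EnrichedFunctor V (A × A) A} {unit : A}
variable {T : EnrichedFunctor V V V} (M : StrongMonad (selfData V) T)
variable {F G : EnrichedFunctor V Aᵒᵖ V}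
variable {S : MonoidalData tA unit} {D : MonoidalData (dayTensor tA) (yonedaObj unit)}

/-- The costrength braids before and after the strength. The two braidings of `A` cancel by
symmetry, so the part in `A` is an identity. -/
lemma carries_costrength (hS : IsSymmetricMonoidal S) (hD : IsDayData S D) {P Q : V} {X Y : A}
    (x : P ⟶ F.obj (op X)) (y : Q ⟶ G.obj (op Y)) :
    Carries (K := (day tA F G).comp V T) ((presheafStrongMonad M hD).costrength F G)
      (dmul tA (F := F.comp V T) (onHom T x) y) (costr M P Q) (onHom T (dmul tA x y))
      (eId V (tA.obj (X, Y))) := by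
  have h := (hD.carries_braiding (F := F.comp V T) (onHom T x) y).mcomp
    ((carries_strength M y x).mcomp (hD.carries_braiding y x).mmap)
  rw [eId_mcomp, hS.symmetry] at h
  exact h

/-- The parts in `A` are the same composite of identities, and the parts in `V` agree by
commutativity of `T`. -/
lemma presheafStrongMonad_isCommutative (hS : IsSymmetricMonoidal S) (hD : IsDayData S D)
    (hM : M.IsCommutative) : (presheafStrongMonad M hD).IsCommutative := fun F G =>
  ((generates_onHom F).day (generates_onHom G)).mor_ext_of_carries
    (fun _ => (carries_costrength M hS hD _ _).mcomp ((carries_strength M _ _).mmap.mcomp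
      (carries_mul M _)))
    (fun _ => (carries_strength M _ _).mcomp ((carries_costrength M hS hD _ _).mmap.mcomp
      (carries_mul M _)))
    (fun _ => str_comm M hM _ _) (fun _ => rfl)

end Commutative

/-! ### The comparison map `ξ` -/

section Coend

variable {V : Type u} [Category.{v} V] [MonoidalCategory V] [SymmetricCategory V]
  [MonoidalClosed V] [HasColimits V]
variable {K : Type v} [EnrichedCategory V K] (T : EnrichedFunctor V V V)

lemma IsNatural.lact {H H' : EnrichedFunctor V (Kᵒᵖ × K) V} {θ : ∀ X, H.obj X ⟶ H'.obj X}
    (hθ : IsNatural H H' θ) (k l : K) :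
    DayMonad.lact H k l ≫ θ (op k, k) = θ (op l, k) ▷ hom V k l ≫ DayMonad.lact H' k l :=
  hθ.pact (X := (op l, k)) (Y := (op k, k)) ((ρ_ (hom V k l)).inv ≫ hom V k l ◁ eId V k)

lemma IsNatural.ract {H H' : EnrichedFunctor V (Kᵒᵖ × K) V} {θ : ∀ X, H.obj X ⟶ H'.obj X}
    (hθ : IsNatural H H' θ) (k l : K) :
    DayMonad.ract H k l ≫ θ (op l, l) = θ (op l, k) ▷ hom V k l ≫ DayMonad.ract H' k l :=
  hθ.pact (X := (op l, k)) (Y := (op l, l)) ((λ_ (hom V k l)).inv ≫ eId V (op l) ▷ hom V k l)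

/-- The map of coends induced by a natural family. -/
def coendHom {H H' : EnrichedFunctor V (Kᵒᵖ × K) V} (θ : ∀ X, H.obj X ⟶ H'.obj X)
    (hθ : IsNatural H H' θ) : coend H ⟶ coend H' :=
  coendDesc H (fun k => θ (op k, k) ≫ coendι H' k) fun k l => by
    rw [← Category.assoc, hθ.lact, ← Category.assoc, hθ.ract, Category.assoc, Category.assoc,
      coend_condition]

lemma coendι_hom {H H' : EnrichedFunctor V (Kᵒᵖ × K) V} (θ : ∀ X, H.obj X ⟶ H'.obj X) (hθ)
    (k : K) : coendι H k ≫ coendHom θ hθ = θ (op k, k) ≫ coendι H' k :=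
  coendι_desc H _ _ k

/-- The canonical map `∫^k T H(k, k) ⟶ T ∫^k H(k, k)`. -/
def coendComparison (H : EnrichedFunctor V (Kᵒᵖ × K) V) :
    coend (H.comp V T) ⟶ T.obj (coend H) :=
  coendDesc (H.comp V T) (fun k => onHom T (coendι H k)) fun k l => by
    have e₁ : lact (H.comp V T) k l = mapAct T (lact H k l) :=
      pact_comp_mapAct T H (X := (op l, k)) (Y := (op k, k)) _
    have e₂ : ract (H.comp V T) k l = mapAct T (ract H k l) :=
      pact_comp_mapAct T H (X := (op l, k)) (Y := (op l, l)) _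
    rw [e₁, e₂]
    -- The relation for `T H` is `T`, with the hom-object as parameter, applied to the coend
    -- relation for `H`.
    exact (mapAct_post T _ _).symm.trans
      ((congrArg (mapAct T) (coend_condition H k l)).trans (mapAct_post T _ _))

lemma isCanonical_coendComparison (H : EnrichedFunctor V (Kᵒᵖ × K) V) :
    IsCanonical T H (coendComparison T H) :=
  fun k => coendι_desc (H.comp V T) _ _ k

lemma IsCanonical.unique {H : EnrichedFunctor V (Kᵒᵖ × K) V}
    {ξ ξ' : coend (H.comp V T) ⟶ T.obj (coend H)} (h : IsCanonical T H ξ)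
    (h' : IsCanonical T H ξ') : ξ = ξ' :=
  coend_hom_ext _ fun k => (h k).trans (h' k).symm

end Coend

/-! ### The strength as `∫ t` followed by `ξ` -/

section CoendStrength

variable {V : Type u} [Category.{v} V] [MonoidalCategory V] [SymmetricCategory V]
  [MonoidalClosed V] [HasLimits V] [HasColimits V]
variable {A : Type v} [EnrichedCategory V A] {tA : EnrichedFunctor V (A × A) A}
variable {T : EnrichedFunctor V V V} (M : StrongMonad (selfData V) T)

/-- The weight is absorbed by a second strength after `a`. In this form the map is visibly a
composite of natural families, so it induces a map of coends. -/
lemma isNatural_str_weighted {K : Type v} [EnrichedCategory V K] (W : EnrichedFunctor V K V)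
    {N N' : EnrichedFunctor V Kᵒᵖ V} {a : ∀ k, N'.obj k ⟶ T.obj (N.obj k)}
    (ha : IsNatural N' (N.comp V T) a) :
    IsNatural (weighted W N') ((weighted W N).comp V T)
      (fun X => W.obj X.2 ◁ a X.1 ≫ str M (W.obj X.2) (N.obj X.1)) :=
  (((ha.extTensor_whiskerLeft W).comp (isNatural_str M W N)).precomp (prodSwap V Kᵒᵖ K)).assoc

variable (F G : EnrichedFunctor V Aᵒᵖ V)

lemma isNatural_str_dayArg :
    IsNatural (dayArg F (G.comp V T)) ((dayArg F G).comp V T)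
      (fun X => str M (F.obj (op X.unop.1)) (G.obj (op X.unop.2))) :=
  ((isNatural_str M F G).precomp (opProd V A A)).assoc

variable (tA) in
/-- The map of coends induced by the strength. -/
def coendStrength (C : Aᵒᵖ) : coend (dayIntegrand tA F (G.comp V T) C) ⟶
    coend ((dayIntegrand tA F G C).comp V T) :=
  coendHom _ (isNatural_str_weighted M (dayWeight tA C) (isNatural_str_dayArg M F G))

/-- The induced map uses `t` at `F X` and then at the weight; the associativity axiom of the
strength identifies this with the single strength at weight `⊗ F X`. -/
lemma isCoendStrength_coendStrength (C : Aᵒᵖ) :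
    IsCoendStrength M F G C (coendStrength tA M F G C) := fun X Y => by
  refine (coendι_hom _ _ (X, Y)).trans ?_
  have h := str_assoc M (hom V C.unop (tA.obj (X, Y))) (F.obj (op X)) (G.obj (op Y))
  have e : (α_ (hom V C.unop (tA.obj (X, Y))) (F.obj (op X)) (T.obj (G.obj (op Y)))).inv ≫
      str M (hom V C.unop (tA.obj (X, Y)) ⊗ F.obj (op X)) (G.obj (op Y)) ≫
        onHom T (α_ (hom V C.unop (tA.obj (X, Y))) (F.obj (op X)) (G.obj (op Y))).hom =
      hom V C.unop (tA.obj (X, Y)) ◁ str M (F.obj (op X)) (G.obj (op Y)) ≫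
        str M (hom V C.unop (tA.obj (X, Y))) (F.obj (op X) ⊗ G.obj (op Y)) := by
    rw [h, Iso.inv_hom_id_assoc]
  refine (congrArg (fun z => z ≫ coendι ((dayIntegrand tA F G C).comp V T) (X, Y)) e.symm).trans ?_
  exact (Category.assoc _ _ _).trans (congrArg (fun z => _ ≫ z) (Category.assoc _ _ _))

/-- The coprojection is `dayι` followed by an action, and the component of the strength commutes
with actions; so the hom-object enters only as a parameter of `T`. -/
lemma dayE_strength (X Y : A) (C : Aᵒᵖ) :
    dayE tA F (G.comp V T) X Y C ≫ component (dayStrength (tA := tA) M F G) C =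
      str M (F.obj (op X)) (G.obj (op Y)) ▷ hom V (op (tA.obj (X, Y))) C ≫
        mapAct T (dayE tA F G X Y C) := by
  have h := isNatural_component (F := day tA F (G.comp V T)) (G := (day tA F G).comp V T)
    (dayStrength (tA := tA) M F G) (op (tA.obj (X, Y))) C
  rw [act_comp_mapAct] at h
  rw [← dayι_act, ← dayι_act]
  refine (Category.assoc _ _ _).trans ?_
  refine (congrArg (fun z => dayι tA F (G.comp V T) X Y ▷ _ ≫ z) h).trans ?_
  refine (comp_whiskerRight_assoc _ _ _ _).symm.trans ?_
  refine (congrArg (fun z => z ▷ _ ≫ _) (dayι_strength M X Y)).trans ?_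
  refine (comp_whiskerRight_assoc _ _ _ _).trans ?_
  exact congrArg (fun z => _ ≫ z) (mapAct_pre T _ _).symm

/-- Compared on coprojections. On the left the weight is a parameter of `T`, by `dayE_strength`; on
the right it is tensored into the first argument of the strength. By `str_weighted` the two agree.
-/
lemma component_dayStrength (C : Aᵒᵖ) :
    component (dayStrength (tA := tA) M F G) C =
      coendStrength tA M F G C ≫ coendComparison T (dayIntegrand tA F G C) := by
  refine coend_hom_ext (dayIntegrand tA F (G.comp V T) C) ?_
  rintro ⟨X, Y⟩
  have h := dayE_strength (tA := tA) M F G X Y C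
  have e : mapAct T (dayE tA F G X Y C) = mapAct T (β_ (F.obj (op X) ⊗ G.obj (op Y))
      (hom V C.unop (tA.obj (X, Y)))).hom ≫ onHom T (dayCoproj tA F G C X Y) :=
    mapAct_post T _ _
  have h₁ := congrArg (fun z => (β_ (hom V C.unop (tA.obj (X, Y)))
    (F.obj (op X) ⊗ T.obj (G.obj (op Y)))).hom ≫ z) (h.trans (congrArg (fun z => _ ≫ z) e))
  have h₂ := isCoendStrength_coendStrength (tA := tA) M F G C X Y
  have h₃ := isCanonical_coendComparison T (dayIntegrand tA F G C) (X, Y)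
  have h₄ := str_weighted M (hom V C.unop (tA.obj (X, Y))) (F.obj (op X)) (G.obj (op Y))
  have l : (β_ (hom V C.unop (tA.obj (X, Y))) (F.obj (op X) ⊗ T.obj (G.obj (op Y)))).hom ≫
      dayE tA F (G.comp V T) X Y C = dayCoproj tA F (G.comp V T) C X Y :=
    SymmetricCategory.symmetry_assoc _ _ _
  have l' : dayCoproj tA F (G.comp V T) C X Y ≫ component (dayStrength (tA := tA) M F G) C =
      ((β_ (hom V C.unop (tA.obj (X, Y))) (F.obj (op X) ⊗ T.obj (G.obj (op Y)))).hom ≫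
        str M (F.obj (op X)) (G.obj (op Y)) ▷ hom V C.unop (tA.obj (X, Y)) ≫
        mapAct T (β_ (F.obj (op X) ⊗ G.obj (op Y)) (hom V C.unop (tA.obj (X, Y)))).hom) ≫
          onHom T (dayCoproj tA F G C X Y) := by
    refine (congrArg (fun z => z ≫ component (dayStrength (tA := tA) M F G) C) l.symm).trans ?_
    refine (Category.assoc _ _ _).trans (h₁.trans ?_)
    exact ((Category.assoc _ _ _).trans (congrArg (fun z => _ ≫ z) (Category.assoc _ _ _))).symm
  refine l'.trans ((congrArg (fun z => z ≫ _) h₄.symm).trans ?_)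
  refine Eq.trans ?_ ((Category.assoc _ _ _).symm.trans
    (congrArg (fun z => z ≫ coendComparison T (dayIntegrand tA F G C)) h₂)).symm
  refine Eq.trans (congrArg (fun z => _ ≫ z) h₃.symm) ?_
  refine (Category.assoc _ _ _).trans ?_
  refine Eq.trans ?_ (Category.assoc _ _ _).symm
  refine congrArg (fun z => _ ≫ z) ?_
  refine (Category.assoc _ _ _).trans ?_
  refine Eq.trans ?_ (Category.assoc _ _ _).symm
  exact congrArg (fun z => _ ≫ z) (Category.assoc _ _ _).symm

end CoendStrength

end DayMonad

end

/-! ### The theorem -/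

theorem mainTheorem4 {V : Type u} [Category.{v} V] [MonoidalCategory V] [SymmetricCategory V]
    [MonoidalClosed V] [HasLimits V] [HasColimits V]
    {A : Type v} [EnrichedCategory V A] {tensor : EnrichedFunctor V (A × A) A} {unit : A}
    (S : MonoidalData tensor unit) (hS : IsSymmetricMonoidal S)
    (T : EnrichedFunctor V V V) (M : StrongMonad (selfData V) T) (hM : M.IsCommutative) :
    (∀ (K : Type v) [EnrichedCategory V K] (H : EnrichedFunctor V (Kᵒᵖ × K) V),
      ∃! ξ : coend (H.comp V T) ⟶ T.obj (coend H), IsCanonical T H ξ) ∧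
    ∃ D : MonoidalData (dayTensor tensor) (yonedaObj unit),
      IsDayData S D ∧ IsSymmetricMonoidal D ∧
      ∃ M' : StrongMonad D (postcomp T), M'.IsCommutative ∧
        (∀ (F : EnrichedFunctor V Aᵒᵖ V) (C : Aᵒᵖ),
          component (M'.η F) C = unname (M.η (F.obj C)) ∧
          component (M'.μ F) C = unname (M.μ (F.obj C))) ∧
        (∀ (F G : EnrichedFunctor V Aᵒᵖ V) (C : Aᵒᵖ),
          ∃ (τ : coend (dayIntegrand tensor F (G.comp V T) C) ⟶
              coend ((dayIntegrand tensor F G C).comp V T))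
            (ξ : coend ((dayIntegrand tensor F G C).comp V T) ⟶
              T.obj (coend (dayIntegrand tensor F G C))),
            IsCoendStrength M F G C τ ∧ IsCanonical T (dayIntegrand tensor F G C) ξ ∧
              component (M'.strength F G) C = τ ≫ ξ) := by
  refine ⟨fun K _ H => ⟨coendComparison T H, isCanonical_coendComparison T H,
    fun ξ h => h.unique T (isCanonical_coendComparison T H)⟩, dayData hS, isDayData hS,
    (isDayData hS).isSymmetricMonoidal hS, presheafStrongMonad M (isDayData hS),
    presheafStrongMonad_isCommutative M hS (isDayData hS) hM, fun F C => ?_, fun F G C => ?_⟩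
  · exact ⟨component_presheafUnit M F C, component_presheafMul M F C⟩
  · exact ⟨coendStrength tensor M F G C, coendComparison T (dayIntegrand tensor F G C),
      isCoendStrength_coendStrength M F G C,
      isCanonical_coendComparison T (dayIntegrand tensor F G C), component_dayStrength M F G C⟩
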